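/- Let $n\ge 2$, $I_0=\{1,\dots,n-1\}$, $I=I_0\sqcup\{\bar 1\}$, $\alpha_i=\epsilon_i-\epsilon_{i+1}\in\mathbf Z^n$ for $i\in I_0$, $\alpha_{\bar 1}=\alpha_1$, and $\mathrm{wt}_i=\mu_i-\mu_{i+1}$ for a weight $\mu\in\mathbf Z^n$ and $i\in I_0$. An abstract $\mathfrak q(n)$-crystal (with weights allowed in all of $\mathbf Z^n$) is a set $B$ with maps $\mathrm{wt}\colon B\to\mathbf Z^n$, $\varepsilon_i,\varphi_i\colon B\to\mathbf Z\sqcup\{-\infty\}$ ($i\in I_0$) and $e_i,f_i\colon B\to B\sqcup\{\mathbf 0\}$ ($i\in I$) such that: $e_i$ and $f_i$ ($i\in I$) change the weight by $+\alpha_i$ and $-\alpha_i$; $f_ib=b'$ iff $e_ib'=b$; for $i\in I_0$, $\varphi_i=\varepsilon_i+\mathrm{wt}_i$, $e_i$ lowers $\varepsilon_i$ and raises $\varphi_i$ by $1$, $f_i$ does the opposite, and $e_ib=f_ib=\mathbf 0$ if $\varphi_i(b)=-\infty$; for $3\le i\le n-1$, $e_{\bar 1},f_{\bar 1}$ commute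 with $e_i,f_i$, and $e_{\bar 1}$ preserves $\varepsilon_i,\varphi_i$. **Tableaux.** A hook word is a word $u_1\ge\dots\ge u_k<u_{k+1}<\dots<u_N$ with $1\le k\le N$. A semistandard decomposition tableau is a filling $T$, with letters in $\{1,\dots,n\}$, of a shifted diagram with at most $n$ rows of strictly decreasing lengths such that every nonempty row $v_i$ (read from left to right, rows numbered from the top) is a hook word and has maximal length among the hook subwords (not necessarily consecutive) of $v_{i+1}v_i$. For $\lambda=-\lambda_1\epsilon_1-\dots-\lambda_n\epsilon_n$ with integers $\lambda_1>\lambda_2>\dots>\lambda_n\ge 0$, $\mathrm{SDT}(\lambda)$ is the set of those whose $i$-th row has $\lambda_i$ boxes. Let $\mathrm{rd}(T)$ be the word obtained by reading each row from right to left, starting at the top row, $\mathrm{rd}_1(T)$ its subword of letters $1,2$, and, for $i\in I_0$, $\mathrm{red}_i(T)$ the word left from its letters $i,i+1$ after successively removing all pairs $(i+1,i)$ (in that order). For $i\in I_0$, $e_i$ changes the leftmost $i+1$ in $\mathrm{red}_i(T)$ to $i$, and $f_i$ changes the rightmost $i$ in $\mathrm{red}_i(T)$ to $i+1$; $e_{\bar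 1}$ changes the leftmost letter of $\mathrm{rd}_1(T)$ from $2$ to $1$, and $f_{\bar 1}$ from $1$ to $2$; each operator gives $\mathbf 0$ if there is no such letter. On $\mathrm{SDT}(\lambda)$, $\varepsilon_i(T)$ and $\varphi_i(T)$ are the numbers of letters $i+1$ and $i$ in $\mathrm{red}_i(T)$, and $\mathrm{wt}(T)$ is the content of $T$. **The limit.** $\mathrm{SDT}(-\infty)$ is the set of semistandard decomposition tableaux with $n$ rows such that, for $1\le i\le n$, the number of leftmost $i$-boxes in row $n-i+1$ exceeds the number of all boxes in row $n-i+2$ by exactly one (row $n+1$ being empty). Its operators are as above, except that if the tableau $T'$ obtained is not in this set, then in the case of $e_i$ (resp. $f_i$) one adds a box $n-k+1$ at the left end of (resp. removes the leftmost box from) row $k$ for each $1\le k\le n-i$, where $i=1$ for the index $\bar 1$. If $T$ has row lengths $\eta_1,\dots,\eta_n$ and $\nu=-\sum_j\eta_j\epsilon_{n+1-j}$, then in $\mathrm{SDT}(-\infty)$ the weight of $T$ is its content plus $\nu$, $\varphi_i(T)$ is the number of letters $i$ in $\mathrm{red}_i(T)$, and $\varepsilon_i(T)$ is the number of letters $i+1$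 in $\mathrm{red}_i(T)$ minus $\nu_i-\nu_{i+1}$. Let $L^{-\infty}$ be its element whose $i$-th row from the bottom consists of $i$ letters $i$. **Tensor products.** On $B\otimes C=B\times C$: $\mathrm{wt}(b\otimes c)=\mathrm{wt}(b)+\mathrm{wt}(c)$, $\varepsilon_i(b\otimes c)=\max(\varepsilon_i(c),\varepsilon_i(b)-\mathrm{wt}_i(c))$, $\varphi_i(b\otimes c)=\max(\varphi_i(b),\varphi_i(c)+\mathrm{wt}_i(b))$; for $i\in I_0$, $e_i(b\otimes c)$ is $e_ib\otimes c$ if $\varphi_i(c)<\varepsilon_i(b)$ and $b\otimes e_ic$ otherwise, and $f_i(b\otimes c)$ is $f_ib\otimes c$ if $\varphi_i(c)\le\varepsilon_i(b)$ and $b\otimes f_ic$ otherwise; $e_{\bar 1}$ and $f_{\bar 1}$ act on $c$ if $e_{\bar 1}b=f_{\bar 1}b=\mathbf 0$ and on $b$ otherwise. For $\mu\in\mathbf Z^n$, $\mathcal R^\vee_\mu=\{r^\vee_\mu\}$ has weight $\mu$, $\varepsilon_i=0$, $\varphi_i=\mu_i-\mu_{i+1}$, and all operators equal to $\mathbf 0$.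 **Theorem.** Let $\lambda=-\lambda_1\epsilon_1-\dots-\lambda_n\epsilon_n$ with integers $\lambda_1>\lambda_2>\dots>\lambda_n\ge 0$, let $k\in\mathbf Z$ be arbitrary, and let $$\mu=\sum_{i=1}^n(\lambda_i-k)\,\epsilon_{n+1-i}.$$ Let $\mathcal C$ be the connected component of $\mathrm{SDT}(-\infty)\otimes\mathcal R^\vee_\mu$ generated by $L^{-\infty}\otimes r^\vee_\mu$ under all $e_i,f_i$, $i\in I$, with the restricted operations. Then $\mathcal C$ and $\mathrm{SDT}(\lambda)$ are abstract $\mathfrak q(n)$-crystals (weights in $\mathbf Z^n$), and they are isomorphic as $\mathfrak q(n)$-crystals up to the weight shift by $k(1,\dots,1)$: there is a bijection $\psi\colon\mathcal C\to\mathrm{SDT}(\lambda)$ that commutes with $e_i$ and $f_i$ for all $i\in I$, preserves $\varepsilon_i$ and $\varphi_i$ for all $i\in I_0$, and satisfies $\mathrm{wt}(\psi(b))=\mathrm{wt}(b)+k(1,\dots,1)$ for all $b\in\mathcal C$. In particular, for $k=0$ it is an isomorphism of crystals in the strict sense. -/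

import Mathlib

/-!
Conventions. All indices are 0-based: the letter, coordinate or row number `a : Fin n` stands for
`a + 1` in the usual 1-based notation.  `Option B` is `B ⊔ {𝟎}`, with `none = 𝟎`, and
`WithBot ℤ` is `ℤ ⊔ {-∞}`.  The weight lattice `ℤⁿ` is `Fin n → ℤ`.
-/

namespace QueerCrystal

/-- The index set `I₀ = {1, …, n - 1}`; the element `i` stands for `i + 1`. -/
abbrev I0 (n : ℕ) : Type := {i : ℕ // i + 1 < n}

/-- The letter `i` attached to `i ∈ I₀`. -/
def I0.lo {n : ℕ} (i : I0 n) : Fin n := ⟨i.1, Nat.lt_of_succ_lt i.2⟩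

/-- The letter `i + 1` attached to `i ∈ I₀`. -/
def I0.hi {n : ℕ} (i : I0 n) : Fin n := ⟨i.1 + 1, i.2⟩

/-- The element `1 ∈ I₀` (it exists since `n ≥ 2`). -/
def I0.first (n : ℕ) [hn : n.AtLeastTwo] : I0 n := ⟨0, hn.prop⟩

/-- The index set `I = I₀ ⊔ {1̄}`. -/
inductive QIndex (n : ℕ) : Type
  | num (i : I0 n) : QIndex n
  | bar : QIndex n

/-- The element of `I₀` whose simple root is attached to an index: `i` to `i` and `1` to `1̄`. -/
def QIndex.base {n : ℕ} [n.AtLeastTwo] : QIndex n → I0 n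
  | .num i => i
  | .bar => I0.first n

/-- The simple root `α_i = ε_i - ε_{i+1}`. -/
def simpleRoot {n : ℕ} (i : I0 n) : Fin n → ℤ := Pi.single i.lo 1 - Pi.single i.hi 1

/-- `wt_i = μ_i - μ_{i+1}` for a weight `μ`. -/
def wtI {n : ℕ} (i : I0 n) (μ : Fin n → ℤ) : ℤ := μ i.lo - μ i.hi

/-! ### Crystals -/

/-- The data of a `𝔮(n)`-crystal on a set `B`; the axioms are in `IsQCrystal`. -/
structure CrystalData (n : ℕ) (B : Type*) where
  wt : B → Fin n → ℤ
  ε : I0 n → B → WithBot ℤ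
  φ : I0 n → B → WithBot ℤ
  e : QIndex n → B → Option B
  f : QIndex n → B → Option B

/-- The axioms of an abstract `𝔮(n)`-crystal, weights being allowed in all of `ℤⁿ`. -/
structure IsQCrystal {n : ℕ} [n.AtLeastTwo] {B : Type*} (X : CrystalData n B) : Prop where
  wt_e : ∀ i b b', X.e i b = some b' → X.wt b' = X.wt b + simpleRoot i.base
  wt_f : ∀ i b b', X.f i b = some b' → X.wt b' = X.wt b - simpleRoot i.base
  φ_eq : ∀ i b, X.φ i b = X.ε i b + ((wtI i (X.wt b) : ℤ) : WithBot ℤ)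
  f_iff_e : ∀ i b b', X.f i b = some b' ↔ X.e i b' = some b
  string_e : ∀ i b b', X.e (.num i) b = some b' → X.ε i b' + 1 = X.ε i b ∧ X.φ i b' = X.φ i b + 1
  string_f : ∀ i b b', X.f (.num i) b = some b' → X.ε i b' = X.ε i b + 1 ∧ X.φ i b' + 1 = X.φ i b
  φ_bot : ∀ i b, X.φ i b = ⊥ → X.e (.num i) b = none ∧ X.f (.num i) b = none
  /-- `e_1̄`, `f_1̄` commute with `e_i`, `f_i` for `3 ≤ i ≤ n - 1`. -/
  comm : ∀ i : I0 n, 2 ≤ i.1 → ∀ b,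
    (X.e .bar b).bind (X.e (.num i)) = (X.e (.num i) b).bind (X.e .bar) ∧
    (X.e .bar b).bind (X.f (.num i)) = (X.f (.num i) b).bind (X.e .bar) ∧
    (X.f .bar b).bind (X.e (.num i)) = (X.e (.num i) b).bind (X.f .bar) ∧
    (X.f .bar b).bind (X.f (.num i)) = (X.f (.num i) b).bind (X.f .bar)
  string_bar : ∀ i : I0 n, 2 ≤ i.1 → ∀ b b', X.e .bar b = some b' →
    X.ε i b' = X.ε i b ∧ X.φ i b' = X.φ i b

/-- `ψ` is an isomorphism of `𝔮(n)`-crystals after the weights of `X` are translated by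
`c (1, …, 1)`.  For `c = 0` this is an isomorphism in the strict sense. -/
structure IsShiftedIso {n : ℕ} {B C : Type*} (X : CrystalData n B) (Y : CrystalData n C) (c : ℤ)
    (ψ : B ≃ C) : Prop where
  wt : ∀ b j, Y.wt (ψ b) j = X.wt b j + c
  ε : ∀ i b, Y.ε i (ψ b) = X.ε i b
  φ : ∀ i b, Y.φ i (ψ b) = X.φ i b
  e : ∀ i b, Y.e i (ψ b) = (X.e i b).map ψ
  f : ∀ i b, Y.f i (ψ b) = (X.f i b).map ψ

open Classical in
/-- The tensor product of crystals. -/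
noncomputable def tensor {n : ℕ} {B C : Type*} (X : CrystalData n B) (Y : CrystalData n C) :
    CrystalData n (B × C) where
  wt p := X.wt p.1 + Y.wt p.2
  ε i p := max (Y.ε i p.2) (X.ε i p.1 + ((-wtI i (Y.wt p.2) : ℤ) : WithBot ℤ))
  φ i p := max (X.φ i p.1) (Y.φ i p.2 + ((wtI i (X.wt p.1) : ℤ) : WithBot ℤ))
  e
    | .num i, p =>
      if Y.φ i p.2 < X.ε i p.1 then (X.e (.num i) p.1).map (fun b => (b, p.2))
      else (Y.e (.num i) p.2).map (fun c => (p.1, c))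
    | .bar, p =>
      if X.e .bar p.1 = none ∧ X.f .bar p.1 = none then (Y.e .bar p.2).map (fun c => (p.1, c))
      else (X.e .bar p.1).map (fun b => (b, p.2))
  f
    | .num i, p =>
      if Y.φ i p.2 ≤ X.ε i p.1 then (X.f (.num i) p.1).map (fun b => (b, p.2))
      else (Y.f (.num i) p.2).map (fun c => (p.1, c))
    | .bar, p =>
      if X.e .bar p.1 = none ∧ X.f .bar p.1 = none then (Y.f .bar p.2).map (fun c => (p.1, c))
      else (X.f .bar p.1).map (fun b => (b, p.2))

/-- The one-element crystal `R_μ^∨ = {r_μ^∨}`. -/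
def dualR {n : ℕ} (μ : Fin n → ℤ) : CrystalData n Unit where
  wt _ := μ
  ε _ _ := 0
  φ i _ := ((μ i.lo - μ i.hi : ℤ) : WithBot ℤ)
  e _ _ := none
  f _ _ := none

/-- `b'` is obtained from `b` by one crystal operator. -/
def CrystalData.Step {n : ℕ} {B : Type*} (X : CrystalData n B) (b b' : B) : Prop :=
  ∃ i, X.e i b = some b' ∨ X.f i b = some b'

/-- `b` is obtained from `x` by a finite sequence of operators `e_i`, `f_i` with `i ∈ I`. -/
def CrystalData.Generated {n : ℕ} {B : Type*} (X : CrystalData n B) (x b : B) : Prop :=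
  Relation.ReflTransGen X.Step x b

/-- The connected component generated by `x`, with the operations restricted from `X`. -/
def CrystalData.component {n : ℕ} {B : Type*} (X : CrystalData n B) (x : B) :
    CrystalData n {b : B // X.Generated x b} where
  wt b := X.wt b.1
  ε i b := X.ε i b.1
  φ i b := X.φ i b.1
  e i b := (X.e i b.1).pmap Subtype.mk
    (fun _ hc => Relation.ReflTransGen.tail b.2 ⟨i, Or.inl hc⟩)
  f i b := (X.f i b.1).pmap Subtype.mk
    (fun _ hc => Relation.ReflTransGen.tail b.2 ⟨i, Or.inr hc⟩)

/-! ### Tableaux -/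

/-- A filling with `n` rows (the last ones may be empty): `T k` is the `k`-th row from the top, read
from left to right.  In the shifted diagram the row `k` is moved `k` units to the right. -/
abbrev Tableau (n : ℕ) : Type := Fin n → List (Fin n)

/-- Hook words `u₁ ≥ ⋯ ≥ u_k < u_{k+1} < ⋯ < u_N` with `1 ≤ k ≤ N`. -/
def IsHookWord {n : ℕ} (u : List (Fin n)) : Prop :=
  ∃ (a : List (Fin n)) (x : Fin n) (b : List (Fin n)),
    u = a ++ x :: b ∧ (a ++ [x]).Pairwise (· ≥ ·) ∧ (x :: b).Pairwise (· < ·)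

/-- Semistandard decomposition tableaux: with `v_k` the `k`-th row, every nonempty `v_k` is a hook
word, and it is a hook subword (i.e. subsequence) of maximal length in `v_{k+1} v_k`. -/
structure IsDecomposition {n : ℕ} (T : Tableau n) : Prop where
  hook : ∀ k, T k ≠ [] → IsHookWord (T k)
  maximal : ∀ k k' : Fin n, k'.1 = k.1 + 1 → ∀ w : List (Fin n),
    w.Sublist (T k' ++ T k) → IsHookWord w → w.length ≤ (T k).length

/-- `SDT(λ)` for `λ = -λ₁ε₁ - ⋯ - λ_nε_n`: the semistandard decomposition tableaux whose `k`-th row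
has `λ_k` boxes. -/
def SDT {n : ℕ} (lam : Fin n → ℕ) : Type :=
  {T : Tableau n // IsDecomposition T ∧ ∀ k, (T k).length = lam k}

/-- A box of a tableau, with its entry. -/
structure Box (n : ℕ) : Type where
  row : Fin n
  col : ℕ
  letter : Fin n

/-- The reading word `rd(T)` (rows from right to left, starting with the top row), each letter
recorded together with the position of its box. -/
def reading {n : ℕ} (T : Tableau n) : List (Box n) :=
  (List.finRange n).flatMap fun k => (T k).zipIdx.reverse.map fun p => ⟨k, p.2, p.1⟩

/-- One step of the reduction below.  The list `s` is the reduced word of the part already read,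
written backwards. -/
def redStep {n : ℕ} (i : I0 n) (s : List (Box n)) (x : Box n) : List (Box n) :=
  if x.letter = i.hi then x :: s
  else if x.letter = i.lo then
    match s with
    | [] => [x]
    | y :: s' => if y.letter = i.hi then s' else x :: y :: s'
  else s

/-- `red_i(T)`: the letters `i`, `i + 1` of the reading word that remain after successively
removing all pairs `(i + 1, i)` (in that order). -/
def red {n : ℕ} (i : I0 n) (T : Tableau n) : List (Box n) :=
  ((reading T).foldl (redStep i) []).reverse

/-- The subword `rd_1(T)` of the letters `1`, `2` of the reading word. -/
def readingOne {n : ℕ} [n.AtLeastTwo] (T : Tableau n) : List (Box n) :=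
  (reading T).filter fun x => x.letter = (I0.first n).lo ∨ x.letter = (I0.first n).hi

/-- Replace the entry of the box `x` by `a`. -/
def change {n : ℕ} (T : Tableau n) (x : Box n) (a : Fin n) : Tableau n :=
  Function.update T x.row ((T x.row).set x.col a)

/-- The change of a tableau made by `e_i`: the leftmost `i + 1` of `red_i(T)` becomes an `i`; for
`1̄`, if the leftmost letter of `rd_1(T)` is a `2`, it becomes a `1`. -/
def changeE {n : ℕ} [n.AtLeastTwo] (T : Tableau n) : QIndex n → Option (Tableau n)
  | .num i => ((red i T).find? fun x => x.letter = i.hi).map fun x => change T x i.lo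
  | .bar => ((readingOne T).head?.filter fun x => x.letter = (I0.first n).hi).map
      fun x => change T x (I0.first n).lo

/-- The change of a tableau made by `f_i`: the rightmost `i` of `red_i(T)` becomes an `i + 1`; for
`1̄`, if the leftmost letter of `rd_1(T)` is a `1`, it becomes a `2`. -/
def changeF {n : ℕ} [n.AtLeastTwo] (T : Tableau n) : QIndex n → Option (Tableau n)
  | .num i => ((red i T).reverse.find? fun x => x.letter = i.lo).map fun x => change T x i.hi
  | .bar => ((readingOne T).head?.filter fun x => x.letter = (I0.first n).lo).map
      fun x => change T x (I0.first n).hi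

/-- The content of a tableau: its `j`-th coordinate is the number of boxes with entry `j`. -/
def content {n : ℕ} (T : Tableau n) (j : Fin n) : ℤ := ∑ k, ((T k).count j : ℤ)

/-- The number of letters `i + 1` in `red_i(T)`. -/
def redHi {n : ℕ} (i : I0 n) (T : Tableau n) : ℤ := (red i T).countP fun x => x.letter = i.hi

/-- The number of letters `i` in `red_i(T)`. -/
def redLo {n : ℕ} (i : I0 n) (T : Tableau n) : ℤ := (red i T).countP fun x => x.letter = i.lo

open Classical in
/-- The crystal `SDT(λ)`; `ε_i` and `φ_i` are the numbers of `i + 1` and of `i` in `red_i(T)`.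
The tableau produced by an operator is again in `SDT(λ)`, so the `none` that a membership test
could return is never reached through that test. -/
noncomputable def sdtCrystal {n : ℕ} [n.AtLeastTwo] (lam : Fin n → ℕ) :
    CrystalData n (SDT lam) where
  wt T := content T.1
  ε i T := (redHi i T.1 : ℤ)
  φ i T := (redLo i T.1 : ℤ)
  e i T := (changeE T.1 i).bind fun T' =>
    if h : IsDecomposition T' ∧ ∀ k, (T' k).length = lam k then some ⟨T', h⟩ else none
  f i T := (changeF T.1 i).bind fun T' =>
    if h : IsDecomposition T' ∧ ∀ k, (T' k).length = lam k then some ⟨T', h⟩ else none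

/-! ### The limit crystal -/

/-- The number of boxes in row `k`, zero below the last row. -/
def rowLength {n : ℕ} (T : Tableau n) (k : ℕ) : ℕ := if h : k < n then (T ⟨k, h⟩).length else 0

/-- Dual marginally large tableaux: the number of leftmost `i`-boxes in row `n - i + 1` exceeds the
total number of boxes in row `n - i + 2` by exactly one.  (In 0-based numbering, the row `k` is the
row with leftmost letter `k.rev`.) -/
def DualMarginallyLarge {n : ℕ} (T : Tableau n) : Prop :=
  ∀ k : Fin n, ((T k).takeWhile fun a => a = k.rev).length = rowLength T (k.1 + 1) + 1

/-- `SDT(-∞)`, the set of all dual marginally large semistandard decomposition tableaux. -/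
def SDTInf (n : ℕ) : Type :=
  {T : Tableau n // IsDecomposition T ∧ DualMarginallyLarge T}

/-- Push in a trivial column of height `n - i`, with entries `n, n - 1, …, i + 1` from the top. -/
def pushIn {n : ℕ} (i : I0 n) (T : Tableau n) : Tableau n :=
  fun k => if i.hi ≤ k.rev then k.rev :: T k else T k

/-- Push out a trivial column of height `n - i`. -/
def pushOut {n : ℕ} (i : I0 n) (T : Tableau n) : Tableau n :=
  fun k => if i.hi ≤ k.rev then (T k).tail else T k

/-- The weight `-∑ η_i ε_{n+1-i}`, where `η_i` is the number of boxes in the `i`-th row of `T`. -/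
def shapeShift {n : ℕ} (T : Tableau n) (j : Fin n) : ℤ := -((T j.rev).length : ℤ)

open Classical in
/-- The crystal `SDT(-∞)`.  Weights and string functions are those of the direct limit: the ones of
`T ⊗ t_ν`, where `T` is taken in the finite crystal of its shape and the weight `ν = shapeShift T`
is such that `L^{-∞}` gets weight `0`.  The tableau produced by an operator is again in `SDT(-∞)`, so
the `none` that a membership test could return is never reached through that test. -/
noncomputable def sdtInfCrystal (n : ℕ) [n.AtLeastTwo] : CrystalData n (SDTInf n) where
  wt T := content T.1 + shapeShift T.1
  ε i T := (redHi i T.1 - wtI i (shapeShift T.1) : ℤ)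
  φ i T := (redLo i T.1 : ℤ)
  e i T := (changeE T.1 i).bind fun T' =>
    let T'' := if DualMarginallyLarge T' then T' else pushIn i.base T'
    if h : IsDecomposition T'' ∧ DualMarginallyLarge T'' then some ⟨T'', h⟩ else none
  f i T := (changeF T.1 i).bind fun T' =>
    let T'' := if DualMarginallyLarge T' then T' else pushOut i.base T'
    if h : IsDecomposition T'' ∧ DualMarginallyLarge T'' then some ⟨T'', h⟩ else none

/-- The filling whose `i`-th row from the bottom consists of `i` letters `i`. -/
def lowestTableau (n : ℕ) : Tableau n := fun k => List.replicate (n - k.1) k.rev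

theorem isHookWord_replicate {n : ℕ} (m : ℕ) (a : Fin n) (hm : m ≠ 0) :
    IsHookWord (List.replicate m a) := by
  obtain ⟨m, rfl⟩ := Nat.exists_eq_succ_of_ne_zero hm
  refine ⟨List.replicate m a, a, [], ?_, ?_, ?_⟩
  · rw [List.replicate_succ']
  · rw [← List.replicate_succ', List.pairwise_replicate]
    right
    exact le_refl a
  · simp

theorem lowestTableau_isDecomposition (n : ℕ) : IsDecomposition (lowestTableau n) := by
  constructor
  · intro k _
    exact isHookWord_replicate _ _ (by have := k.2; omega)
  · intro k k' hk w hw hook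
    have hk' := k'.2
    simp only [lowestTableau, List.length_replicate] at hw ⊢
    obtain ⟨w₁, w₂, rfl, h₁, h₂⟩ := List.sublist_append_iff.mp hw
    obtain ⟨p, hp, rfl⟩ := List.sublist_replicate_iff.mp h₁
    obtain ⟨q, hq, rfl⟩ := List.sublist_replicate_iff.mp h₂
    simp only [List.length_append, List.length_replicate]
    by_contra hcon
    have hp0 : p ≠ 0 := by omega
    have hq2 : 2 ≤ q := by omega
    obtain ⟨p, rfl⟩ := Nat.exists_eq_succ_of_ne_zero hp0
    obtain ⟨q, rfl⟩ := Nat.exists_eq_add_of_le' hq2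
    have hlt : k'.rev < k.rev := by
      rw [Fin.lt_def, Fin.val_rev, Fin.val_rev]; omega
    obtain ⟨a, x, b, hab, ha, hb⟩ := hook
    rcases b with _ | ⟨y, b⟩
    · have := ha
      rw [show a ++ [x] = _ from hab.symm] at this
      have := (List.pairwise_append.mp this).2.2 k'.rev (by simp) k.rev (by simp)
      exact absurd hlt (not_lt.mpr this)
    · have hrev := congrArg List.reverse hab
      have hxy : ∃ c d t, (x :: y :: b).reverse = c :: d :: t ∧ d < c := by
        rcases List.eq_nil_or_concat b with rfl | ⟨b', z, rfl⟩
        · exact ⟨y, x, [], by simp, by simpa using hb⟩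
        · rcases List.eq_nil_or_concat b' with rfl | ⟨b'', z', rfl⟩
          · refine ⟨z, y, [x], by simp, ?_⟩
            simp at hb; exact hb.2
          · refine ⟨z, z', b''.reverse ++ [y, x], by simp, ?_⟩
            simp only [List.concat_eq_append, List.pairwise_cons, List.pairwise_append] at hb
            exact hb.2.2.2.2 z' (by simp) z (by simp)
      obtain ⟨c, d, t, hcd, hlt'⟩ := hxy
      rw [List.reverse_append, List.reverse_append, hcd] at hrev
      rw [List.reverse_replicate, List.reverse_replicate] at hrev
      simp only [List.replicate_succ, List.cons_append, List.cons.injEq] at hrev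
      rw [← hrev.1, ← hrev.2.1] at hlt'
      exact lt_irrefl _ hlt'

theorem lowestTableau_large (n : ℕ) : DualMarginallyLarge (lowestTableau n) := by
  intro k
  have hk := k.2
  simp only [lowestTableau, rowLength, List.takeWhile_replicate, decide_true, if_true,
    List.length_replicate]
  split_ifs <;> omega

/-- `L^{-∞}`. -/
def lowestInf (n : ℕ) : SDTInf n :=
  ⟨lowestTableau n, lowestTableau_isDecomposition n, lowestTableau_large n⟩

/-- The weight `μ = ∑ (λ_i - k) ε_{n+1-i}`. -/
def muWeight {n : ℕ} (lam : Fin n → ℕ) (k : ℤ) : Fin n → ℤ := fun j => (lam j.rev : ℤ) - k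

end QueerCrystal

/-! Everything is read off the reading word. `eps i w` is the largest excess of letters `i + 1` over
letters `i` in a tail of `w`, and `phi i w` is `eps i w` minus the total excess; these are the
string functions. Each operator changes one letter, and that letter is singled out by a condition on
what stands before and after it (`SideCond`). Since the same condition serves the `i` before and the
`i + 1` after the change, one relation `Arr` describes `f` in one direction and `e` in the other.
Arrows preserve the lengths of hook subwords in every factor of the word, hence decomposition
tableaux (`Arr.isDecomposition`), and SDT(λ) is a crystal.

SDT(λ) is connected (`generated_lowestSDT`): every tableau leads to the one of lowest weight. If
some `f_i` applies, it lowers the weight. Otherwise the word is a lattice word, and unless it is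
strictly so for all letters, an odd operator conjugated by Weyl group reflections lowers the weight;
the reflections are realised by maximal powers of `e_i` and suitable powers of `f_i`
(`exists_lower`). Only the lowest tableau has a strict lattice word (`eq_lowestSDT`).

In 0-based numbering, the entries of row `k` are at most `k.rev`. Removing the leading run of
letters `k.rev` from every row leaves the core. The core and the shape determine a tableau, and the
core alone determines a dual marginally large one; `toInf` passes from the former to the latter. An
arrow between decomposition tableaux always changes a core letter, and the runs enter the
`i`-signature only through a final block of letters `i + 1` followed by letters `i`, which is
harmless when it has enough letters `i + 1`. Hence `toInf` respects arrows and `φ_i` (`toInf_arr`,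
`phi_toInf`); pushing columns in or out compensates for a changed letter that joins or leaves a run.

The factor of weight μ restores the shape. Content minus row length depends only on the core, so μ
corrects the weight, therefore `ε_i`, and the tensor product rule stops `e_i` exactly where `ε_i` of
the finite tableau reaches 0. The odd operators need no such cut, because every tableau in SDT(λ)
admits `e_1̄` or `f_1̄`. The constant `k` cancels in all differences of coordinates of μ. So the
component is the image of the connected crystal SDT(λ), and the axioms are transported to it. -/

namespace QueerCrystal

/-! ### Signatures of words -/

/-- The number of letters `i + 1` minus the number of letters `i`. -/
def dif (i : ℕ) (w : List ℕ) : ℤ := (w.count (i + 1) : ℤ) - w.count i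

/-- The number of letters `i + 1` left after removing all pairs `(i + 1, i)`. -/
def eps (i : ℕ) : List ℕ → ℤ
  | [] => 0
  | x :: w => max (eps i w) (dif i (x :: w))

/-- The number of letters `i` left after removing all pairs `(i + 1, i)`. -/
def phi (i : ℕ) (w : List ℕ) : ℤ := eps i w - dif i w

@[simp] theorem dif_nil (i : ℕ) : dif i [] = 0 := by simp [dif]

@[simp] theorem eps_nil (i : ℕ) : eps i [] = 0 := rfl

@[simp] theorem phi_nil (i : ℕ) : phi i [] = 0 := by simp [phi]

theorem dif_cons (i x : ℕ) (w : List ℕ) :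
    dif i (x :: w) = dif i w + (if x = i + 1 then 1 else 0) - (if x = i then 1 else 0) := by
  simp only [dif, List.count_cons, beq_iff_eq]
  push_cast
  split_ifs <;> simp <;> ring

theorem dif_append (i : ℕ) (s t : List ℕ) : dif i (s ++ t) = dif i s + dif i t := by
  simp only [dif, List.count_append]; push_cast; ring

theorem eps_cons (i x : ℕ) (w : List ℕ) : eps i (x :: w) = max (eps i w) (dif i (x :: w)) := rfl

theorem dif_le_eps (i : ℕ) (w : List ℕ) : dif i w ≤ eps i w := by
  cases w with
  | nil => simp
  | cons x w => exact le_max_right _ _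

theorem eps_nonneg (i : ℕ) (w : List ℕ) : 0 ≤ eps i w := by
  induction w with
  | nil => simp
  | cons x w ih => exact ih.trans (le_max_left _ _)

theorem phi_nonneg (i : ℕ) (w : List ℕ) : 0 ≤ phi i w := sub_nonneg.mpr (dif_le_eps i w)

/-- A tail of `s ++ t` is a tail of `t`, or a tail of `s` followed by all of `t`. -/
theorem eps_append (i : ℕ) (s t : List ℕ) :
    eps i (s ++ t) = max (eps i t) (eps i s + dif i t) := by
  induction s with
  | nil => simp [dif_le_eps]
  | cons x s ih =>
    rw [List.cons_append, eps_cons, ih, eps_cons, ← List.cons_append, dif_append]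
    omega

theorem phi_append (i : ℕ) (s t : List ℕ) :
    phi i (s ++ t) = max (phi i t - dif i s) (phi i s) := by
  simp only [phi, eps_append, dif_append]
  omega

theorem dif_tail_le_eps (i : ℕ) (s t : List ℕ) : dif i t ≤ eps i (s ++ t) := by
  have := dif_le_eps i t
  rw [eps_append]; omega

theorem exists_tail_dif_eq_eps (i : ℕ) (w : List ℕ) : ∃ s t, w = s ++ t ∧ dif i t = eps i w := by
  induction w with
  | nil => exact ⟨[], [], rfl, by simp⟩
  | cons x w ih =>
    obtain ⟨s, t, rfl, h⟩ := ih
    by_cases hx : eps i (s ++ t) ≤ dif i (x :: (s ++ t))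
    · exact ⟨[], x :: (s ++ t), rfl, by rw [eps_cons]; omega⟩
    · exact ⟨x :: s, t, rfl, by rw [eps_cons]; omega⟩

theorem dif_of_forall_ne {i : ℕ} {w : List ℕ} (h : ∀ x ∈ w, x ≠ i ∧ x ≠ i + 1) : dif i w = 0 := by
  rw [dif, List.count_eq_zero.mpr fun hx => (h _ hx).2 rfl,
    List.count_eq_zero.mpr fun hx => (h _ hx).1 rfl]
  simp

theorem eps_of_forall_ne {i : ℕ} {w : List ℕ} (h : ∀ x ∈ w, x ≠ i ∧ x ≠ i + 1) : eps i w = 0 := by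
  induction w with
  | nil => rfl
  | cons x w ih =>
    rw [eps_cons, ih fun y hy => h y (List.mem_cons_of_mem _ hy), dif_of_forall_ne h]
    simp

/-- The letters `i` and `i + 1` of a word. -/
def sig (i : ℕ) (w : List ℕ) : List ℕ := w.filter fun x => x = i ∨ x = i + 1

@[simp] theorem sig_append (i : ℕ) (s t : List ℕ) : sig i (s ++ t) = sig i s ++ sig i t := by
  simp [sig]

theorem dif_sig (i : ℕ) (w : List ℕ) : dif i (sig i w) = dif i w := by
  simp only [dif, sig]
  rw [List.count_filter (by simp), List.count_filter (by simp)]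

theorem eps_sig (i : ℕ) (w : List ℕ) : eps i (sig i w) = eps i w := by
  induction w with
  | nil => rfl
  | cons x w ih =>
    have hd := dif_sig i (x :: w)
    by_cases hx : x = i ∨ x = i + 1
    · have : sig i (x :: w) = x :: sig i w := by simp [sig, hx]
      rw [this] at hd ⊢
      rw [eps_cons, eps_cons, ih, hd]
    · have : sig i (x :: w) = sig i w := by simp [sig, hx]
      rw [this] at hd ⊢
      rw [eps_cons, ih, ← hd, dif_sig]
      exact (max_eq_left (dif_le_eps i w)).symm

theorem phi_sig (i : ℕ) (w : List ℕ) : phi i (sig i w) = phi i w := by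
  rw [phi, eps_sig, dif_sig, phi]

theorem sig_eq_nil {i : ℕ} {w : List ℕ} (h : ∀ x ∈ w, x ≠ i ∧ x ≠ i + 1) : sig i w = [] := by
  simp only [sig, List.filter_eq_nil_iff]
  intro x hx
  have := h x hx
  simp; omega

/-! ### Elementary changes of words -/

/-- One letter `x` of `w` is replaced by `y`; the parts before and after it satisfy `P`. -/
def OneStep (x y : ℕ) (P : List ℕ → List ℕ → Prop) (w w' : List ℕ) : Prop :=
  ∃ s t, w = s ++ x :: t ∧ w' = s ++ y :: t ∧ P s t

theorem OneStep.symm {x y : ℕ} {P : List ℕ → List ℕ → Prop} {w w' : List ℕ}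
    (h : OneStep x y P w w') : OneStep y x P w' w := by
  obtain ⟨s, t, h₁, h₂, h₃⟩ := h
  exact ⟨s, t, h₂, h₁, h₃⟩

theorem OneStep.length_eq {x y : ℕ} {P : List ℕ → List ℕ → Prop} {w w' : List ℕ}
    (h : OneStep x y P w w') : w'.length = w.length := by
  obtain ⟨s, t, rfl, rfl, -⟩ := h
  simp

/-- The condition on the letters before and after the one that `f_i` or `e_i` changes. -/
def NumCond (i : ℕ) (s t : List ℕ) : Prop := eps i s = 0 ∧ phi i t = 0

/-- The condition on the letters before the one that `f_1̄` or `e_1̄` changes. -/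
def BarCond (s _t : List ℕ) : Prop := ∀ x ∈ s, 2 ≤ x

/-- `w'` is obtained from `w` by `f_i`. -/
abbrev NumArr (i : ℕ) (w w' : List ℕ) : Prop := OneStep i (i + 1) (NumCond i) w w'

/-- `w'` is obtained from `w` by `f_1̄`. -/
abbrev BarArr (w w' : List ℕ) : Prop := OneStep 0 1 BarCond w w'

theorem NumArr.phi_eps {i : ℕ} {w w' : List ℕ} (h : NumArr i w w') :
    phi i w = phi i w' + 1 ∧ eps i w' = eps i w + 1 := by
  obtain ⟨s, t, rfl, rfl, h₁, h₂⟩ := h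
  have := dif_le_eps i s
  have := eps_nonneg i t
  have := dif_le_eps i t
  simp only [phi, eps_append, dif_append, eps_cons, dif_cons] at *
  simp
  omega

/-- The first letter increases `eps` only if it is an `i + 1` with no unmatched `i` after it; then
it is the leftmost unmatched `i + 1`. Otherwise the position found in the rest of the word remains
admissible with this letter in front. -/
theorem exists_e_of_eps_pos {i : ℕ} {w : List ℕ} (h : 0 < eps i w) : ∃ w', NumArr i w' w := by
  suffices ∃ s t, w = s ++ (i + 1) :: t ∧ NumCond i s t by
    obtain ⟨s, t, h₁, h₂⟩ := this
    exact ⟨_, s, t, rfl, h₁, h₂⟩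
  induction w with
  | nil => simp at h
  | cons x w ih =>
    by_cases hx : eps i w < dif i (x :: w)
    · have h₁ := dif_le_eps i w
      rw [dif_cons] at hx
      by_cases hxi : x = i + 1
      · refine ⟨[], w, by simp [hxi], by simp, ?_⟩
        rw [phi]
        simp [hxi] at hx
        omega
      · rw [if_neg hxi] at hx
        split_ifs at hx <;> omega
    · have he : eps i (x :: w) = eps i w := by rw [eps_cons]; omega
      obtain ⟨s, t, hw, hs, ht⟩ := ih (he ▸ h)
      refine ⟨x :: s, t, by simp [hw], ?_, ht⟩
      have h₃ : eps i w = dif i t + 1 := by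
        have := eps_nonneg i t
        have := dif_le_eps i t
        rw [hw, eps_append, hs, eps_cons, dif_cons]
        simp [phi] at *
        omega
      have h₄ : dif i (x :: w) = dif i (x :: s) + (dif i t + 1) := by
        rw [hw, ← List.cons_append, dif_append, dif_cons i (i + 1) t]
        simp
      rw [eps_cons, hs]
      omega

theorem exists_f_of_phi_pos {i : ℕ} {w : List ℕ} (h : 0 < phi i w) : ∃ w', NumArr i w w' := by
  suffices ∃ s t, w = s ++ i :: t ∧ NumCond i s t by
    obtain ⟨s, t, h₁, h₂⟩ := this
    exact ⟨_, s, t, h₁, rfl, h₂⟩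
  induction w with
  | nil => simp at h
  | cons x w ih =>
    have h₁ := phi_nonneg i w
    by_cases hw : phi i w = 0
    · have := phi_append i [x] w
      rw [List.singleton_append] at this
      by_cases hx : x = i
      · exact ⟨[], w, by simp [hx], by simp, hw⟩
      · exfalso
        by_cases hx' : x = i + 1 <;>
        · simp [phi, eps_cons, dif_cons, hx, hx'] at this h hw
          omega
    · obtain ⟨s, t, hw', hs, ht⟩ := ih (by omega)
      refine ⟨x :: s, t, by simp [hw'], ?_, ht⟩
      have hp : phi i (x :: w) = max (1 - dif i (x :: s)) (phi i (x :: s)) := by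
        have h0 : phi i (i :: t) = 1 := by
          have := eps_nonneg i t
          simp [phi, eps_cons, dif_cons] at *
          omega
        rw [hw', ← List.cons_append, phi_append, h0]
      rw [hp, phi, eps_cons, hs] at h
      rw [eps_cons, hs]
      have := dif_le_eps i s
      rw [hs] at this
      have h5 : dif i (x :: s) ≤ 1 := by rw [dif_cons]; split_ifs <;> omega
      omega

/-- Let `m` be the word between two admissible positions. The condition after the left one gives
`dif i m ≥ 1` if `x = i` and `dif i m ≥ 0` if `x = i + 1`; the condition before the right one gives
`dif i m ≤ 0` and `dif i m ≤ -1` respectively. -/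
theorem NumCond.unique {i x : ℕ} (hx : x = i ∨ x = i + 1) {s t s' t' : List ℕ}
    (h : NumCond i s t) (h' : NumCond i s' t') (he : s ++ x :: t = s' ++ x :: t') :
    s = s' ∧ t = t' := by
  have key : ∀ {m s t s' t' : List ℕ}, NumCond i s t → NumCond i s' t' → s' = s ++ x :: m →
      t = m ++ x :: t' → False := by
    rintro m s t s' t' ⟨-, h₂⟩ ⟨h₃, h₄⟩ rfl rfl
    have a₁ := dif_le_eps i m
    have a₂ := eps_nonneg i m
    have a₃ := eps_nonneg i t'
    have a₄ := dif_le_eps i t'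
    rw [eps_append, eps_cons, dif_cons] at h₃
    have := eps_nonneg i s
    rw [phi_append, phi, eps_cons, dif_cons] at h₂
    have := phi_nonneg i m
    rw [phi] at *
    rcases hx with rfl | rfl <;> simp at * <;> omega
  rcases List.append_eq_append_iff.mp he with ⟨m, h₁, h₂⟩ | ⟨m, h₁, h₂⟩
  · cases m with
    | nil => simp at h₁ h₂; exact ⟨h₁.symm, h₂⟩
    | cons y m =>
      simp at h₂
      obtain ⟨rfl, h₂⟩ := h₂
      exact (key h h' h₁ h₂).elim
  · cases m with
    | nil => simp at h₁ h₂; exact ⟨h₁, h₂.symm⟩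
    | cons y m =>
      simp at h₂
      obtain ⟨rfl, h₂⟩ := h₂
      exact (key h' h h₁ h₂).elim

theorem BarCond.unique {x : ℕ} (hx : x < 2) {s t s' t' : List ℕ}
    (h : BarCond s t) (h' : BarCond s' t') (he : s ++ x :: t = s' ++ x :: t') :
    s = s' ∧ t = t' := by
  rcases List.append_eq_append_iff.mp he with ⟨m, h₁, h₂⟩ | ⟨m, h₁, h₂⟩
  · cases m with
    | nil => simp at h₁ h₂; exact ⟨h₁.symm, h₂⟩
    | cons y m =>
      simp at h₂
      have := h' x (by simp [h₁, h₂.1])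
      omega
  · cases m with
    | nil => simp at h₁ h₂; exact ⟨h₁, h₂.symm⟩
    | cons y m =>
      simp at h₂
      have := h x (by simp [h₁, h₂.1])
      omega

/-- Since `y ≠ x'`, the two changes take place at different positions; the four hypotheses say that
neither side condition notices the other change. -/
theorem OneStep.comm {x y x' y' : ℕ} {P Q : List ℕ → List ℕ → Prop} (hxy : y ≠ x')
    (hP₁ : ∀ s₁ s₂ t, P (s₁ ++ x' :: s₂) t → P (s₁ ++ y' :: s₂) t)
    (hP₂ : ∀ s t₁ t₂, P s (t₁ ++ x' :: t₂) → P s (t₁ ++ y' :: t₂))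
    (hQ₁ : ∀ s₁ s₂ t, Q (s₁ ++ y :: s₂) t → Q (s₁ ++ x :: s₂) t)
    (hQ₂ : ∀ s t₁ t₂, Q s (t₁ ++ y :: t₂) → Q s (t₁ ++ x :: t₂))
    {w w₁ w₂ : List ℕ} (h₁ : OneStep x y P w w₁) (h₂ : OneStep x' y' Q w₁ w₂) :
    ∃ w', OneStep x' y' Q w w' ∧ OneStep x y P w' w₂ := by
  obtain ⟨s, t, rfl, rfl, hP⟩ := h₁
  obtain ⟨s', t', he, rfl, hQ⟩ := h₂
  rcases List.append_eq_append_iff.mp he with ⟨m, a, b⟩ | ⟨m, a, b⟩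
  · cases m with
    | nil => simp at b; exact absurd b.1 hxy
    | cons z m =>
      simp at b
      obtain ⟨rfl, rfl⟩ := b
      subst a
      exact ⟨s ++ x :: (m ++ y' :: t'), ⟨s ++ x :: m, t', by simp, by simp, hQ₁ _ _ _ hQ⟩,
        ⟨s, m ++ y' :: t', by simp, by simp, hP₂ _ _ _ hP⟩⟩
  · cases m with
    | nil => simp at b; exact absurd b.1.symm hxy
    | cons z m =>
      simp at b
      obtain ⟨rfl, rfl⟩ := b
      subst a
      exact ⟨s' ++ y' :: (m ++ x :: t), ⟨s', m ++ x :: t, by simp, by simp, hQ₂ _ _ _ hQ⟩,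
        ⟨s' ++ y' :: m, t, by simp, by simp, hP₁ _ _ _ hP⟩⟩

theorem sig_change {i x y : ℕ} (hx : x ≠ i ∧ x ≠ i + 1) (hy : y ≠ i ∧ y ≠ i + 1)
    (s t : List ℕ) : sig i (s ++ x :: t) = sig i (s ++ y :: t) := by
  simp [sig, hx, hy]

theorem NumCond.of_sig {i : ℕ} {s t s' t' : List ℕ} (h : NumCond i s t) (hs : sig i s' = sig i s)
    (ht : sig i t' = sig i t) : NumCond i s' t' := by
  rw [NumCond, ← eps_sig, ← phi_sig, hs, ht, eps_sig, phi_sig]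
  exact h

/-- For `i ≥ 2` the letters 0 and 1 are invisible in the `i`-signature, and exchanging `i` and `i +
1` keeps a letter at least 2, which is all that `BarCond` asks. The letters are left free so as to
cover all combinations of raising and lowering operators. -/
theorem numArr_barArr_comm {i x y x' y' : ℕ} (hi : 2 ≤ i) (hx : x < 2) (hy : y < 2)
    (hx' : x' = i ∨ x' = i + 1) (hy' : y' = i ∨ y' = i + 1) {w w₂ : List ℕ} :
    (∃ w₁, OneStep x y BarCond w w₁ ∧ OneStep x' y' (NumCond i) w₁ w₂) ↔
    (∃ w₁, OneStep x' y' (NumCond i) w w₁ ∧ OneStep x y BarCond w₁ w₂) := by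
  have b₁ : ∀ {x y}, 2 ≤ y → ∀ s₁ s₂ t, BarCond (s₁ ++ x :: s₂) t → BarCond (s₁ ++ y :: s₂) t := by
    intro x y hy s₁ s₂ t h z hz
    simp at hz
    rcases hz with hz | rfl | hz
    · exact h z (by simp [hz])
    · exact hy
    · exact h z (by simp [hz])
  constructor
  · rintro ⟨w₁, h₁, h₂⟩
    exact OneStep.comm (x := x) (y := y) (x' := x') (y' := y') (P := BarCond) (Q := NumCond i)
      (by omega) (b₁ (by omega)) (fun _ _ _ h => h)
      (fun s₁ s₂ t h => h.of_sig (sig_change (by omega) (by omega) _ _) rfl)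
      (fun s₁ s₂ t h => h.of_sig rfl (sig_change (by omega) (by omega) _ _)) h₁ h₂
  · rintro ⟨w₁, h₁, h₂⟩
    exact OneStep.comm (x := x') (y := y') (x' := x) (y' := y) (P := NumCond i) (Q := BarCond)
      (by omega)
      (fun s₁ s₂ t h => h.of_sig (sig_change (by omega) (by omega) _ _) rfl)
      (fun s₁ s₂ t h => h.of_sig rfl (sig_change (by omega) (by omega) _ _))
      (b₁ (by omega)) (fun _ _ _ h => h) h₁ h₂

end QueerCrystal

namespace QueerCrystal

/-! ### Hook subwords -/

/-- Reversed hook words, the empty word included: a strictly decreasing word followed by a weakly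
increasing one. -/
def RevHook (h : List ℕ) : Prop :=
  ∃ p q, h = p ++ q ∧ p.Pairwise (· > ·) ∧ q.Pairwise (· ≤ ·)

theorem RevHook.sublist {h h' : List ℕ} (hh : RevHook h) (hs : h'.Sublist h) : RevHook h' := by
  obtain ⟨p, q, rfl, hp, hq⟩ := hh
  obtain ⟨p', q', rfl, h₁, h₂⟩ := List.sublist_append_iff.mp hs
  exact ⟨p', q', rfl, hp.sublist h₁, hq.sublist h₂⟩

/-- `RevHook` does not say to which of the two parts the corner letter belongs, which makes it
stable under subwords. In a nonempty word the comparison at the junction decides which letter can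
serve as the corner. -/
theorem isHookWord_iff {n : ℕ} (u : List (Fin n)) :
    IsHookWord u ↔ u ≠ [] ∧ RevHook (u.map Fin.val).reverse := by
  constructor
  · rintro ⟨a, x, b, rfl, ha, hb⟩
    refine ⟨by simp, (b.map Fin.val).reverse, ((a ++ [x]).map Fin.val).reverse, by simp, ?_, ?_⟩
    · rw [List.pairwise_reverse, List.pairwise_map]
      exact (List.pairwise_cons.mp hb).2
    · rw [List.pairwise_reverse, List.pairwise_map]
      exact ha
  · rintro ⟨hu, p, q, he, hp, hq⟩
    obtain ⟨b, a, rfl, rfl, rfl⟩ :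
        ∃ b a : List (Fin n), u = a ++ b ∧ p = (b.map Fin.val).reverse ∧
          q = (a.map Fin.val).reverse := by
      rw [List.reverse_eq_iff, List.reverse_append] at he
      obtain ⟨a, b, rfl, h₁, h₂⟩ := List.map_eq_append_iff.mp he
      exact ⟨b, a, rfl, by rw [h₂, List.reverse_reverse], by rw [h₁, List.reverse_reverse]⟩
    rw [List.pairwise_reverse, List.pairwise_map] at hp hq
    have hp' : b.Pairwise (· < ·) := hp
    have hq' : a.Pairwise (· ≥ ·) := hq
    rcases List.eq_nil_or_concat a with rfl | ⟨a, y, rfl⟩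
    · cases b with
      | nil => simp at hu
      | cons x b => exact ⟨[], x, b, by simp, by simp, hp'⟩
    · rw [List.concat_eq_append] at *
      cases b with
      | nil => exact ⟨a, y, [], by simp, hq', by simp⟩
      | cons x b =>
        by_cases hxy : y < x
        · refine ⟨a, y, x :: b, by simp, hq', List.pairwise_cons.mpr ⟨?_, hp'⟩⟩
          intro z hz
          rcases List.mem_cons.mp hz with rfl | hz
          · exact hxy
          · exact hxy.trans ((List.pairwise_cons.mp hp').1 z hz)
        · refine ⟨a ++ [y], x, b, by simp, ?_, hp'⟩
          rw [List.pairwise_append]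
          refine ⟨hq', by simp, ?_⟩
          intro z hz w hw
          rw [List.mem_singleton] at hw
          subst hw
          rcases List.mem_append.mp hz with hz | hz
          · exact (not_lt.mp hxy).trans ((List.pairwise_append.mp hq').2.2 z hz y (by simp))
          · rw [List.mem_singleton] at hz
            subst hz
            exact not_lt.mp hxy

/-- The reading words of two adjacent blocks whose concatenation changes by one letter. -/
theorem OneStep.split {x y : ℕ} {P : List ℕ → List ℕ → Prop} {a b a' b' : List ℕ}
    (hl : a'.length = a.length)
    (h : OneStep x y P (a ++ b) (a' ++ b')) :
    (OneStep x y (fun s t => P s (t ++ b)) a a' ∧ b' = b) ∨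
      (OneStep x y (fun s t => P (a ++ s) t) b b' ∧ a' = a) := by
  obtain ⟨s, t, h₁, h₂, hP⟩ := h
  rcases List.append_eq_append_iff.mp h₁ with ⟨m, rfl, rfl⟩ | ⟨m, rfl, h₃⟩
  · right
    rw [List.append_assoc] at h₂
    obtain ⟨rfl, rfl⟩ := List.append_inj h₂ hl
    exact ⟨⟨m, t, rfl, rfl, hP⟩, rfl⟩
  · cases m with
    | nil =>
      right
      simp only [List.append_nil, List.nil_append] at *
      obtain ⟨rfl, rfl⟩ := List.append_inj h₂ hl
      exact ⟨⟨[], t, h₃.symm, rfl, by simpa using hP⟩, rfl⟩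
    | cons z m =>
      left
      rw [List.cons_append, List.cons.injEq] at h₃
      obtain ⟨rfl, rfl⟩ := h₃
      rw [← List.cons_append, ← List.append_assoc] at h₂
      obtain ⟨rfl, rfl⟩ := List.append_inj h₂ (by simpa using hl)
      exact ⟨⟨s, m, rfl, rfl, hP⟩, rfl⟩

theorem OneStep.mono {x y : ℕ} {P Q : List ℕ → List ℕ → Prop} (hPQ : ∀ s t, P s t → Q s t)
    {w w' : List ℕ} (h : OneStep x y P w w') : OneStep x y Q w w' := by
  obtain ⟨s, t, h₁, h₂, h₃⟩ := h
  exact ⟨s, t, h₁, h₂, hPQ s t h₃⟩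

theorem NumCond.left {i : ℕ} {s t b : List ℕ} (h : NumCond i s (t ++ b)) : NumCond i s t := by
  refine ⟨h.1, ?_⟩
  have := h.2
  rw [phi_append] at this
  have := phi_nonneg i t
  omega

theorem NumCond.right {i : ℕ} {a s t : List ℕ} (h : NumCond i (a ++ s) t) : NumCond i s t := by
  refine ⟨?_, h.2⟩
  have := h.1
  rw [eps_append] at this
  have := eps_nonneg i s
  omega

theorem BarCond.right {a s t : List ℕ} (h : BarCond (a ++ s) t) : BarCond s t :=
  fun x hx => h x (List.mem_append_right _ hx)

theorem mem_of_eps_eq_zero {i : ℕ} {s : List ℕ} (h : eps i ((i + 1) :: s) = 0) : i ∈ s := by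
  have h₁ := dif_le_eps i ((i + 1) :: s)
  rw [h, dif_cons, dif] at h₁
  simp at h₁
  exact List.count_pos_iff.mp (by omega)

theorem count_le_of_phi_eq_zero {i : ℕ} {s t : List ℕ} (h : phi i (s ++ t) = 0) :
    s.count i ≤ s.count (i + 1) := by
  rw [phi_append] at h
  have h₁ := phi_nonneg i t
  have h₂ : 0 ≤ dif i s := by omega
  rw [dif] at h₂
  omega

/-- The changed letter `i` of the subword can be replaced by the new `i + 1`, unless the subword
already contains an `i + 1`, necessarily just before. That `i + 1` is matched by some `i` preceding
the changed position, since `eps i s = 0`; this `i` takes the place of the changed one. -/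
theorem NumArr.decreasing {i : ℕ} {w w' p : List ℕ} (h : NumArr i w w') (hp : p.Sublist w)
    (hp' : p.Pairwise (· > ·)) :
    ∃ p' : List ℕ, p'.Sublist w' ∧ p'.Pairwise (· > ·) ∧ p'.length = p.length := by
  obtain ⟨s, t, rfl, rfl, hs, -⟩ := h
  obtain ⟨p₁, p₂, rfl, h₁, h₂⟩ := List.sublist_append_iff.mp hp
  rcases List.sublist_cons_iff.mp h₂ with h₀ | ⟨p₃, rfl, h₀⟩
  · exact ⟨_, h₁.append (h₀.cons _), hp', rfl⟩
  · rw [List.pairwise_append, List.pairwise_cons] at hp'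
    obtain ⟨a, ⟨b, c⟩, d⟩ := hp'
    by_cases hi : i + 1 ∈ p₁
    · obtain ⟨p₄, p₅, rfl⟩ := List.append_of_mem hi
      have h₅ : p₅ = [] := by
        rw [List.eq_nil_iff_forall_not_mem]
        intro z hz
        have := d z (by simp [hz]) i (by simp)
        have := (List.pairwise_cons.mp (List.pairwise_append.mp a).2.1).1 z hz
        omega
      subst h₅
      obtain ⟨s₁, s₂, rfl, h₄, h₅⟩ := List.append_sublist_iff.mp h₁
      obtain ⟨s₃, s₄, rfl, h₆, -⟩ := List.cons_sublist_iff.mp h₅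
      obtain ⟨s₅, s₆, rfl⟩ := List.append_of_mem h₆
      -- The tail of `s` starting at the chosen `i + 1` has `eps i` equal to 0 as well, so this
      -- letter is matched inside the tail.
      have hm : i ∈ s₆ ++ s₄ := by
        apply mem_of_eps_eq_zero
        have : NumCond i (s₁ ++ (s₅ ++ (i + 1) :: s₆ ++ s₄)) [] := ⟨hs, by simp⟩
        have := this.right.1
        rw [List.append_assoc] at this
        exact (NumCond.right (t := []) (⟨this, by simp⟩)).1
      refine ⟨p₄ ++ [i + 1] ++ [i] ++ p₃, ?_, ?_, by simp⟩
      · have := (((h₄.trans (List.sublist_append_left s₁ s₅)).append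
          (((List.singleton_sublist.mpr hm).cons_cons (i + 1)))).append (h₀.cons (i + 1)))
        simpa using this
      · simp only [List.append_assoc, List.singleton_append]
        rw [List.pairwise_append] at a ⊢
        refine ⟨a.1, List.pairwise_cons.mpr ⟨?_, List.pairwise_cons.mpr ⟨b, c⟩⟩, ?_⟩
        · intro z hz
          rcases List.mem_cons.mp hz with rfl | hz
          · simp
          · have := b z hz; omega
        · intro z hz y hy
          have hy : y = i + 1 ∨ y = i ∨ y ∈ p₃ := by simpa using hy
          have := a.2.2 z hz (i + 1) (by simp)
          rcases hy with rfl | rfl | hy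
          · omega
          · omega
          · have := b y hy; omega
    · refine ⟨p₁ ++ (i + 1) :: p₃, h₁.append (h₀.cons_cons _), ?_, by simp⟩
      rw [List.pairwise_append, List.pairwise_cons]
      refine ⟨a, ⟨fun z hz => ?_, c⟩, fun z hz y hy => ?_⟩
      · have := b z hz; omega
      · have := d z hz i (by simp)
        rcases List.mem_cons.mp hy with rfl | hy
        · have : z ≠ i + 1 := fun h => hi (h ▸ hz)
          omega
        · have := b y hy
          omega

/-- The only obstacle is an `i` following in the subword. As `phi i t = 0`, it is matched by an `i +
1` between it and the changed position, and that letter replaces the changed one. -/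
theorem NumArr.decreasing_symm {i : ℕ} {w w' p : List ℕ} (h : NumArr i w w') (hp : p.Sublist w')
    (hp' : p.Pairwise (· > ·)) :
    ∃ p' : List ℕ, p'.Sublist w ∧ p'.Pairwise (· > ·) ∧ p'.length = p.length := by
  obtain ⟨s, t, rfl, rfl, -, ht⟩ := h
  obtain ⟨p₁, p₂, rfl, h₁, h₂⟩ := List.sublist_append_iff.mp hp
  rcases List.sublist_cons_iff.mp h₂ with h₀ | ⟨p₃, rfl, h₀⟩
  · exact ⟨_, h₁.append (h₀.cons _), hp', rfl⟩
  · rw [List.pairwise_append, List.pairwise_cons] at hp'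
    obtain ⟨a, ⟨b, c⟩, d⟩ := hp'
    have d' : ∀ z ∈ p₁, i + 1 < z := fun z hz => d z hz (i + 1) (by simp)
    by_cases hi : i ∈ p₃
    · obtain ⟨t₁, t₂, rfl, h₄, h₅⟩ : ∃ t₁ t₂, t = t₁ ++ t₂ ∧ i + 1 ∈ t₁ ∧ p₃.Sublist t₂ := by
        obtain ⟨p₄, p₅, rfl⟩ := List.append_of_mem hi
        have h₅ : p₄ = [] := by
          rw [List.eq_nil_iff_forall_not_mem]
          intro z hz
          have := b z (by simp [hz])
          have := (List.pairwise_append.mp c).2.2 z hz i (by simp)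
          omega
        subst h₅
        obtain ⟨t₁, t₂, rfl, h₆, h₇⟩ := List.cons_sublist_iff.mp h₀
        obtain ⟨t₃, t₄, rfl⟩ := List.append_of_mem h₆
        have : t₃.count i + 1 ≤ t₃.count (i + 1) := by
          have := count_le_of_phi_eq_zero (i := i) (s := t₃ ++ [i]) (t := t₄ ++ t₂)
            (by simpa using ht)
          simpa [List.count_append, List.count_singleton] using this
        exact ⟨t₃, i :: t₄ ++ t₂, by simp, List.count_pos_iff.mp (by omega),
          by simpa using (h₇.trans (List.sublist_append_right _ _))⟩
      refine ⟨p₁ ++ (i + 1) :: p₃, ?_, ?_, by simp⟩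
      · have := (h₁.append (((List.singleton_sublist.mpr h₄).append h₅).cons i))
        simpa using this
      · rw [List.pairwise_append, List.pairwise_cons]
        exact ⟨a, ⟨b, c⟩, d⟩
    · refine ⟨p₁ ++ i :: p₃, h₁.append (h₀.cons_cons _), ?_, by simp⟩
      rw [List.pairwise_append, List.pairwise_cons]
      refine ⟨a, ⟨fun z hz => ?_, c⟩, fun z hz y hy => ?_⟩
      · have := b z hz
        have : z ≠ i := fun h => hi (h ▸ hz)
        show z < i
        omega
      · have := d' z hz
        rcases List.mem_cons.mp hy with rfl | hy
        · show y < z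
          omega
        · exact d z hz y (List.mem_cons_of_mem _ hy)

theorem sorted_split (q : List ℕ) (hq : q.Pairwise (· ≤ ·)) (i : ℕ) :
    ∃ q₁ q₂, q = q₁ ++ q₂ ∧ (∀ z ∈ q₁, z ≤ i) ∧ ∀ z ∈ q₂, i < z := by
  induction q with
  | nil => exact ⟨[], [], rfl, by simp, by simp⟩
  | cons x q ih =>
    rw [List.pairwise_cons] at hq
    by_cases hx : x ≤ i
    · obtain ⟨q₁, q₂, rfl, h₁, h₂⟩ := ih hq.2
      exact ⟨x :: q₁, q₂, rfl, by simpa [hx] using h₁, h₂⟩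
    · refine ⟨[], x :: q, rfl, by simp, fun z hz => ?_⟩
      rcases List.mem_cons.mp hz with rfl | hz
      · omega
      · have := hq.1 z hz; omega

/-- After the change, further letters `i` of the subword would come too late. They all lie in a
beginning `t₁` of `t`, and `phi i t = 0` provides at least as many letters `i + 1` in `t₁`, by which
they are replaced. -/
theorem NumArr.increasing {i : ℕ} {w w' q : List ℕ} (h : NumArr i w w') (hq : q.Sublist w)
    (hq' : q.Pairwise (· ≤ ·)) :
    ∃ q' : List ℕ, q'.Sublist w' ∧ q'.Pairwise (· ≤ ·) ∧ q'.length = q.length := by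
  obtain ⟨s, t, rfl, rfl, -, ht⟩ := h
  obtain ⟨q₁, q₂, rfl, h₁, h₂⟩ := List.sublist_append_iff.mp hq
  rcases List.sublist_cons_iff.mp h₂ with h₀ | ⟨q₃, rfl, h₀⟩
  · exact ⟨_, h₁.append (h₀.cons _), hq', rfl⟩
  · rw [List.pairwise_append, List.pairwise_cons] at hq'
    obtain ⟨a, ⟨b, c⟩, d⟩ := hq'
    have d' : ∀ z ∈ q₁, z ≤ i := fun z hz => d z hz i (by simp)
    obtain ⟨q₄, q₅, rfl, h₄, h₅⟩ := sorted_split q₃ c i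
    obtain ⟨t₁, t₂, rfl, h₆, h₇⟩ := List.append_sublist_iff.mp h₀
    have hr : q₄ = List.replicate q₄.length i := by
      rw [List.eq_replicate_iff]
      refine ⟨rfl, fun z hz => ?_⟩
      have := h₄ z hz
      have := b z (by simp [hz])
      omega
    have hc : q₄.length ≤ t₁.count (i + 1) := by
      have := h₆.count_le i
      have h₈ : q₄.count i = q₄.length := by rw [hr]; simp
      have := count_le_of_phi_eq_zero ht
      omega
    refine ⟨q₁ ++ (i + 1) :: (List.replicate q₄.length (i + 1) ++ q₅), ?_, ?_, by simp⟩
    · exact h₁.append (((List.replicate_sublist_iff.mpr hc).append h₇).cons_cons _)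
    · rw [← List.cons_append, ← List.replicate_succ, List.pairwise_append, List.pairwise_append]
      refine ⟨a, ⟨by simp [List.pairwise_replicate], (List.pairwise_append.mp c).2.1, ?_⟩, ?_⟩
      · intro z hz y hy
        have := h₅ y hy
        have := List.eq_of_mem_replicate hz
        omega
      · intro z hz y hy
        have := d' z hz
        rcases List.mem_append.mp hy with hy | hy
        · have := List.eq_of_mem_replicate hy
          omega
        · have := h₅ y hy
          omega

theorem count_le_of_eps_eq_zero {i : ℕ} {s t : List ℕ} (h : eps i (s ++ t) = 0) :
    t.count (i + 1) ≤ t.count i := by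
  have := dif_tail_le_eps i s t
  rw [h, dif] at this
  omega

/-- Dually, the letters `i + 1` of the subword that precede the changed position lie in a tail of
`s`, where `eps i s = 0` provides at least as many letters `i`. -/
theorem NumArr.increasing_symm {i : ℕ} {w w' q : List ℕ} (h : NumArr i w w') (hq : q.Sublist w')
    (hq' : q.Pairwise (· ≤ ·)) :
    ∃ q' : List ℕ, q'.Sublist w ∧ q'.Pairwise (· ≤ ·) ∧ q'.length = q.length := by
  obtain ⟨s, t, rfl, rfl, hs, -⟩ := h
  obtain ⟨q₁, q₂, rfl, h₁, h₂⟩ := List.sublist_append_iff.mp hq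
  rcases List.sublist_cons_iff.mp h₂ with h₀ | ⟨q₃, rfl, h₀⟩
  · exact ⟨_, h₁.append (h₀.cons _), hq', rfl⟩
  · rw [List.pairwise_append, List.pairwise_cons] at hq'
    obtain ⟨a, ⟨b, c⟩, d⟩ := hq'
    have d' : ∀ z ∈ q₁, z ≤ i + 1 := fun z hz => d z hz (i + 1) (by simp)
    obtain ⟨q₄, q₅, rfl, h₄, h₅⟩ := sorted_split q₁ a i
    obtain ⟨s₁, s₂, rfl, h₆, h₇⟩ := List.append_sublist_iff.mp h₁
    have hr : q₅ = List.replicate q₅.length (i + 1) := by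
      rw [List.eq_replicate_iff]
      refine ⟨rfl, fun z hz => ?_⟩
      have := h₅ z hz
      have := d' z (by simp [hz])
      omega
    have hc : q₅.length ≤ s₂.count i := by
      have := h₇.count_le (i + 1)
      have h₈ : q₅.count (i + 1) = q₅.length := by rw [hr]; simp
      have := count_le_of_eps_eq_zero hs
      omega
    refine ⟨(q₄ ++ List.replicate q₅.length i) ++ i :: q₃, ?_, ?_, by simp⟩
    · exact (h₆.append (List.replicate_sublist_iff.mpr hc)).append (h₀.cons_cons _)
    · have hle : ∀ z ∈ q₄ ++ List.replicate q₅.length i, z ≤ i := by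
        intro z hz
        rcases List.mem_append.mp hz with hz | hz
        · exact h₄ z hz
        · exact (List.eq_of_mem_replicate hz).le
      rw [List.pairwise_append, List.pairwise_append, List.pairwise_cons]
      refine ⟨⟨(List.pairwise_append.mp a).1, by simp [List.pairwise_replicate], ?_⟩,
        ⟨fun z hz => ?_, c⟩, ?_⟩
      · intro z hz y hy
        rw [List.eq_of_mem_replicate hy]
        exact h₄ z hz
      · have := b z hz; omega
      · intro z hz y hy
        have := hle z hz
        rcases List.mem_cons.mp hy with rfl | hy
        · exact this
        · have := b y hy; omega

/-- Cut the word where the hook passes from its decreasing to its increasing part. The arrow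
restricts to an arrow on one of the two factors and fixes the other, so only one half of the hook
needs repair. -/
theorem NumArr.revHook {i : ℕ} {w w' h : List ℕ} (hw : NumArr i w w') (hs : h.Sublist w)
    (hh : RevHook h) : ∃ h' : List ℕ, h'.Sublist w' ∧ RevHook h' ∧ h'.length = h.length := by
  obtain ⟨p, q, rfl, hp, hq⟩ := hh
  obtain ⟨w₁, w₂, rfl, h₁, h₂⟩ := List.append_sublist_iff.mp hs
  obtain ⟨w₁', w₂', rfl, hl⟩ : ∃ a b, w' = a ++ b ∧ a.length = w₁.length :=
    ⟨w'.take w₁.length, w'.drop w₁.length, by simp, by have := hw.length_eq; simp at this ⊢; omega⟩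
  rcases hw.split hl with ⟨hw, rfl⟩ | ⟨hw, rfl⟩
  · obtain ⟨p', a, b, c⟩ := NumArr.decreasing (hw.mono fun s t h => h.left) h₁ hp
    exact ⟨p' ++ q, a.append h₂, ⟨p', q, rfl, b, hq⟩, by simp [c]⟩
  · obtain ⟨q', a, b, c⟩ := NumArr.increasing (hw.mono fun s t h => h.right) h₂ hq
    exact ⟨p ++ q', h₁.append a, ⟨p, q', rfl, hp, b⟩, by simp [c]⟩

theorem NumArr.revHook_symm {i : ℕ} {w w' h : List ℕ} (hw : NumArr i w w') (hs : h.Sublist w')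
    (hh : RevHook h) : ∃ h' : List ℕ, h'.Sublist w ∧ RevHook h' ∧ h'.length = h.length := by
  obtain ⟨p, q, rfl, hp, hq⟩ := hh
  obtain ⟨w₁', w₂', rfl, h₁, h₂⟩ := List.append_sublist_iff.mp hs
  obtain ⟨w₁, w₂, rfl, hl⟩ : ∃ a b, w = a ++ b ∧ w₁'.length = a.length :=
    ⟨w.take w₁'.length, w.drop w₁'.length, by simp,
      by have := hw.length_eq; simp at this ⊢; omega⟩
  rcases hw.split hl with ⟨hw, rfl⟩ | ⟨hw, rfl⟩
  · obtain ⟨p', a, b, c⟩ := NumArr.decreasing_symm (hw.mono fun s t h => h.left) h₁ hp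
    exact ⟨p' ++ q, a.append h₂, ⟨p', q, rfl, b, hq⟩, by simp [c]⟩
  · obtain ⟨q', a, b, c⟩ := NumArr.increasing_symm (hw.mono fun s t h => h.right) h₂ hq
    exact ⟨p ++ q', h₁.append a, ⟨p, q', rfl, hp, b⟩, by simp [c]⟩

/-- Whatever precedes the 0 is at least 2, hence decreasing, and whatever follows it is weakly
increasing. The new 1 can therefore close the decreasing part, and letters 0 may still follow it. -/
theorem revHook_zero_to_one {s t h : List ℕ} (hs : ∀ x ∈ s, 2 ≤ x) (hsub : h.Sublist (s ++ 0 :: t))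
    (hh : RevHook h) : ∃ h' : List ℕ, h'.Sublist (s ++ 1 :: t) ∧ RevHook h' ∧ h'.length = h.length := by
  obtain ⟨h₁, h₂, rfl, hs₁, hs₂⟩ := List.sublist_append_iff.mp hsub
  rcases List.sublist_cons_iff.mp hs₂ with hs₃ | ⟨h₃, rfl, hs₃⟩
  · exact ⟨_, hs₁.append (hs₃.cons _), hh, rfl⟩
  have h2 : ∀ x ∈ h₁, 2 ≤ x := fun x hx => hs x (hs₁.subset hx)
  refine ⟨h₁ ++ 1 :: h₃, hs₁.append (hs₃.cons_cons _), ?_, by simp⟩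
  obtain ⟨p, q, he, hp, hq⟩ := hh
  have key : h₁.Pairwise (· > ·) ∧ h₃.Pairwise (· ≤ ·) := by
    rcases List.append_eq_append_iff.mp he with ⟨m, rfl, h⟩ | ⟨m, rfl, h⟩
    · cases m with
      | nil =>
        subst h
        exact ⟨by simpa using hp, (List.pairwise_cons.mp hq).2⟩
      | cons z m =>
        simp at h
        obtain ⟨rfl, rfl⟩ := h
        rw [List.pairwise_append, List.pairwise_cons] at hp
        have : m = [] := by
          rw [List.eq_nil_iff_forall_not_mem]
          intro z hz
          have := hp.2.1.1 z hz
          omega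
        subst this
        exact ⟨hp.1, hq⟩
    · have : m = [] := by
        rw [List.eq_nil_iff_forall_not_mem]
        intro z hz
        have := h2 z (by simp [hz])
        rw [h, List.pairwise_append] at hq
        have := hq.2.2 z hz 0 (by simp)
        omega
      subst this
      simp at h
      subst h
      exact ⟨by simpa using hp, (List.pairwise_cons.mp hq).2⟩
  obtain ⟨hd, hi⟩ := key
  have hd1 : (h₁ ++ [1]).Pairwise (· > ·) := by
    rw [List.pairwise_append]
    refine ⟨hd, by simp, fun x hx y hy => ?_⟩
    have := h2 x hx
    rw [List.mem_singleton] at hy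
    omega
  exact ⟨h₁ ++ [1], h₃, by simp, hd1, hi⟩

/-- The new 0 opens the increasing part. The old decreasing part may contain one 0 after the changed
1; it moves to the increasing part too. -/
theorem revHook_one_to_zero {s t h : List ℕ} (hs : ∀ x ∈ s, 2 ≤ x) (hsub : h.Sublist (s ++ 1 :: t))
    (hh : RevHook h) : ∃ h' : List ℕ, h'.Sublist (s ++ 0 :: t) ∧ RevHook h' ∧ h'.length = h.length := by
  obtain ⟨h₁, h₂, rfl, hs₁, hs₂⟩ := List.sublist_append_iff.mp hsub
  rcases List.sublist_cons_iff.mp hs₂ with hs₃ | ⟨h₃, rfl, hs₃⟩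
  · exact ⟨_, hs₁.append (hs₃.cons _), hh, rfl⟩
  have h2 : ∀ x ∈ h₁, 2 ≤ x := fun x hx => hs x (hs₁.subset hx)
  refine ⟨h₁ ++ 0 :: h₃, hs₁.append (hs₃.cons_cons _), ?_, by simp⟩
  obtain ⟨p, q, he, hp, hq⟩ := hh
  have key : h₁.Pairwise (· > ·) ∧ h₃.Pairwise (· ≤ ·) := by
    rcases List.append_eq_append_iff.mp he with ⟨m, rfl, h⟩ | ⟨m, rfl, h⟩
    · cases m with
      | nil =>
        subst h
        exact ⟨by simpa using hp, (List.pairwise_cons.mp hq).2⟩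
      | cons z m =>
        simp at h
        obtain ⟨rfl, rfl⟩ := h
        rw [List.pairwise_append, List.pairwise_cons] at hp
        refine ⟨hp.1, ?_⟩
        rw [List.pairwise_append]
        refine ⟨hp.2.1.2.imp_of_mem fun {a b} ha hb hab => ?_, hq, fun x hx y hy => ?_⟩
        · have := hp.2.1.1 a ha
          omega
        · have := hp.2.1.1 x hx
          omega
    · have : m = [] := by
        rw [List.eq_nil_iff_forall_not_mem]
        intro z hz
        have := h2 z (by simp [hz])
        rw [h, List.pairwise_append] at hq
        have := hq.2.2 z hz 1 (by simp)
        omega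
      subst this
      simp at h
      subst h
      exact ⟨by simpa using hp, (List.pairwise_cons.mp hq).2⟩
  obtain ⟨hd, hi⟩ := key
  exact ⟨h₁, 0 :: h₃, by simp, hd, List.pairwise_cons.mpr ⟨by simp, hi⟩⟩

/-- The condition on the letters before and after the one that is changed. -/
def SideCond {n : ℕ} : QIndex n → List ℕ → List ℕ → Prop
  | .num i => NumCond i.1
  | .bar => BarCond

/-- `w'` is obtained from `w` by `f_q`. -/
def Arr {n : ℕ} [n.AtLeastTwo] (q : QIndex n) (w w' : List ℕ) : Prop :=
  OneStep q.base.1 (q.base.1 + 1) (SideCond q) w w'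

theorem SideCond.left {n : ℕ} {q : QIndex n} {s t b : List ℕ} (h : SideCond q s (t ++ b)) :
    SideCond q s t := by
  cases q with
  | num i => exact NumCond.left h
  | bar => exact h

theorem SideCond.right {n : ℕ} {q : QIndex n} {a s t : List ℕ} (h : SideCond q (a ++ s) t) :
    SideCond q s t := by
  cases q with
  | num i => exact NumCond.right h
  | bar => exact BarCond.right (t := t) h

variable {n : ℕ} [n.AtLeastTwo] {q : QIndex n}

theorem SideCond.unique_lo {s t s' t' : List ℕ} (h : SideCond q s t) (h' : SideCond q s' t')
    (he : s ++ q.base.1 :: t = s' ++ q.base.1 :: t') : s = s' ∧ t = t' := by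
  cases q with
  | num i => exact NumCond.unique (Or.inl rfl) h h' he
  | bar => exact BarCond.unique (x := 0) (by omega) h h' he

theorem SideCond.unique_hi {s t s' t' : List ℕ} (h : SideCond q s t) (h' : SideCond q s' t')
    (he : s ++ (q.base.1 + 1) :: t = s' ++ (q.base.1 + 1) :: t') : s = s' ∧ t = t' := by
  cases q with
  | num i => exact NumCond.unique (Or.inr rfl) h h' he
  | bar => exact BarCond.unique (x := 1) (by omega) h h' he

theorem Arr.unique {w w₁ w₂ : List ℕ} (h₁ : Arr q w w₁) (h₂ : Arr q w w₂) : w₁ = w₂ := by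
  obtain ⟨s, t, rfl, rfl, h⟩ := h₁
  obtain ⟨s', t', he, rfl, h'⟩ := h₂
  obtain ⟨rfl, rfl⟩ := h.unique_lo h' he
  rfl

theorem Arr.unique_left {w₁ w₂ w : List ℕ} (h₁ : Arr q w₁ w) (h₂ : Arr q w₂ w) : w₁ = w₂ := by
  obtain ⟨s, t, rfl, rfl, h⟩ := h₁
  obtain ⟨s', t', rfl, he, h'⟩ := h₂
  obtain ⟨rfl, rfl⟩ := h.unique_hi h' he
  rfl

theorem Arr.revHook {w w' h : List ℕ} (hw : Arr q w w') (hs : h.Sublist w)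
    (hh : RevHook h) : ∃ h' : List ℕ, h'.Sublist w' ∧ RevHook h' ∧ h'.length = h.length := by
  cases q with
  | num i => exact NumArr.revHook hw hs hh
  | bar =>
    obtain ⟨s, t, rfl, rfl, hb⟩ := hw
    exact revHook_zero_to_one hb hs hh

theorem Arr.revHook_symm {w w' h : List ℕ} (hw : Arr q w w') (hs : h.Sublist w')
    (hh : RevHook h) : ∃ h' : List ℕ, h'.Sublist w ∧ RevHook h' ∧ h'.length = h.length := by
  cases q with
  | num i => exact NumArr.revHook_symm hw hs hh
  | bar =>
    obtain ⟨s, t, rfl, rfl, hb⟩ := hw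
    exact revHook_one_to_zero hb hs hh

/-- A change of a word is a change of, or leaves unaltered, any of its factors. -/
theorem Arr.factor {a b c a' b' c' : List ℕ} (ha : a'.length = a.length) (hb : b'.length = b.length)
    (h : Arr q (a ++ b ++ c) (a' ++ b' ++ c')) : b' = b ∨ Arr q b b' := by
  rcases OneStep.split (by simp [ha, hb]) h with ⟨h, -⟩ | ⟨-, h⟩
  · rcases OneStep.split ha h with ⟨-, h⟩ | ⟨h, -⟩
    · exact Or.inl h
    · exact Or.inr (h.mono fun s t h => h.left.right)
  · exact Or.inl (List.append_inj h ha).2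

end QueerCrystal

namespace QueerCrystal

/-! ### Connectedness of words -/

/-- Elementary changes with indices at most `m`. -/
def StepLe (m : ℕ) (w w' : List ℕ) : Prop :=
  (∃ i ≤ m, NumArr i w w' ∨ NumArr i w' w) ∨ BarArr w w' ∨ BarArr w' w

/-- Connectedness by elementary changes with indices at most `m`. -/
abbrev ConnLe (m : ℕ) : List ℕ → List ℕ → Prop := Relation.ReflTransGen (StepLe m)

theorem NumArr.append_left {i : ℕ} {p w w' : List ℕ} (hp : ∀ x ∈ p, i + 1 < x)
    (h : NumArr i w w') : NumArr i (p ++ w) (p ++ w') := by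
  obtain ⟨s, t, rfl, rfl, hs, ht⟩ := h
  refine ⟨p ++ s, t, by simp, by simp, ?_, ht⟩
  rw [eps_append, eps_of_forall_ne (w := p) (fun x hx => by have := hp x hx; omega)]
  have := dif_le_eps i s
  omega

theorem BarArr.append_left {p w w' : List ℕ} (hp : ∀ x ∈ p, 1 < x)
    (h : BarArr w w') : BarArr (p ++ w) (p ++ w') := by
  obtain ⟨s, t, rfl, rfl, hs⟩ := h
  refine ⟨p ++ s, t, by simp, by simp, fun x hx => ?_⟩
  rcases List.mem_append.mp hx with hx | hx
  · exact hp x hx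
  · exact hs x hx

theorem ConnLe.append_left {m : ℕ} {p w w' : List ℕ} (hp : ∀ x ∈ p, m + 1 < x)
    (h : ConnLe m w w') : ConnLe m (p ++ w) (p ++ w') := by
  refine Relation.ReflTransGen.lift (p := StepLe m) (p ++ ·) ?_ w w' h
  intro a b hab
  have hp' : ∀ i ≤ m, ∀ x ∈ p, i + 1 < x := fun i hi x hx => by have := hp x hx; omega
  have hp1 : ∀ x ∈ p, 1 < x := fun x hx => by have := hp x hx; omega
  rcases hab with ⟨i, hi, h | h⟩ | h | h
  · exact Or.inl ⟨i, hi, Or.inl (h.append_left (hp' i hi))⟩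
  · exact Or.inl ⟨i, hi, Or.inr (h.append_left (hp' i hi))⟩
  · exact Or.inr (Or.inl (h.append_left hp1))
  · exact Or.inr (Or.inr (h.append_left hp1))

theorem ConnLe.mono {m m' : ℕ} (hm : m ≤ m') {w w' : List ℕ} (h : ConnLe m w w') :
    ConnLe m' w w' := by
  refine Relation.ReflTransGen.mono ?_ w w' h
  rintro a b (⟨i, hi, h⟩ | h)
  · exact Or.inl ⟨i, hi.trans hm, h⟩
  · exact Or.inr h

/-- The result of applying `e_i` as often as possible. -/
def emax (i : ℕ) : List ℕ → List ℕ
  | [] => []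
  | x :: w => (if x = i + 1 ∧ phi i w = 0 then i else x) :: emax i w

/-- A letter put in front disturbs the arrow only if it is an unmatched `i + 1`; the hypothesis
provides an unmatched `i` for it. -/
theorem NumArr.cons {i x : ℕ} {w w' : List ℕ} (h : NumArr i w' w)
    (hx : x = i + 1 → 0 < phi i w) : NumArr i (x :: w') (x :: w) := by
  have hp := h.phi_eps
  obtain ⟨s, t, rfl, rfl, hs, ht⟩ := h
  refine ⟨x :: s, t, by simp, by simp, ?_, ht⟩
  rw [eps_cons, hs, dif_cons]
  have h₁ := dif_le_eps i s
  rw [hs] at h₁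
  split_ifs with h₂ h₃ h₃
  · omega
  · have := hx h₂
    have h₄ := phi_append i s ((i + 1) :: t)
    have : phi i ((i + 1) :: t) = 0 := by
      have := eps_nonneg i t
      simp [phi, eps_cons, dif_cons] at ht ⊢
      omega
    simp only [phi] at h₄ this
    rw [phi] at hx
    simp at *
    omega
  · omega
  · omega

theorem connLe_emax {i m : ℕ} (hi : i ≤ m) (w : List ℕ) : ConnLe m w (emax i w) := by
  suffices Relation.ReflTransGen (fun a b => NumArr i b a) w (emax i w) from
    Relation.ReflTransGen.mono (fun a b h => Or.inl ⟨i, hi, Or.inr h⟩) _ _ this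
  induction w with
  | nil => exact Relation.ReflTransGen.refl
  | cons x w ih =>
    have lift : ∀ y, (y = i + 1 → 0 < phi i w) →
        Relation.ReflTransGen (fun a b => NumArr i b a) (y :: w) (y :: emax i w) := by
      intro y hy
      generalize emax i w = v at ih
      induction ih using Relation.ReflTransGen.head_induction_on with
      | refl => exact Relation.ReflTransGen.refl
      | head h _ ih =>
        refine Relation.ReflTransGen.head (h.cons hy) (ih fun hy' => ?_)
        have := h.phi_eps
        have := hy hy'
        omega
    rw [emax]
    split_ifs with hx
    · refine Relation.ReflTransGen.head ?_ (lift i (by omega))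
      exact ⟨[], w, rfl, by rw [hx.1]; rfl, rfl, hx.2⟩
    · refine lift x fun h => ?_
      have := phi_nonneg i w
      omega

theorem eps_cons_eq (i x : ℕ) (w : List ℕ) :
    eps i (x :: w) = eps i w + if x = i + 1 ∧ phi i w = 0 then 1 else 0 := by
  have h₁ := dif_le_eps i w
  have : phi i w = eps i w - dif i w := rfl
  rw [eps_cons, dif_cons]
  split_ifs <;> omega

theorem count_emax_lo (i : ℕ) (w : List ℕ) :
    ((emax i w).count i : ℤ) = w.count i + eps i w := by
  induction w with
  | nil => simp [emax]
  | cons x w ih =>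
    rw [emax, eps_cons_eq, List.count_cons, List.count_cons]
    simp only [beq_iff_eq]
    push_cast
    rw [ih]
    split_ifs <;> omega

theorem count_emax_hi (i : ℕ) (w : List ℕ) :
    ((emax i w).count (i + 1) : ℤ) = w.count (i + 1) - eps i w := by
  induction w with
  | nil => simp [emax]
  | cons x w ih =>
    rw [emax, eps_cons_eq, List.count_cons, List.count_cons]
    simp only [beq_iff_eq]
    push_cast
    rw [ih]
    split_ifs <;> omega

theorem count_emax_of_ne {i j : ℕ} (h₁ : j ≠ i) (h₂ : j ≠ i + 1) (w : List ℕ) :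
    (emax i w).count j = w.count j := by
  induction w with
  | nil => rfl
  | cons x w ih =>
    rw [emax, List.count_cons, List.count_cons, ih]
    simp only [beq_iff_eq]
    split_ifs <;> omega

theorem dif_emax (i : ℕ) (w : List ℕ) : dif i (emax i w) = dif i w - 2 * eps i w := by
  rw [dif, count_emax_hi, count_emax_lo, dif]; ring

theorem dif_succ_emax (i : ℕ) (w : List ℕ) : dif (i + 1) (emax i w) = dif (i + 1) w + eps i w := by
  rw [dif, count_emax_hi, count_emax_of_ne (by omega) (by omega), dif]; ring

theorem dif_emax_succ (i : ℕ) (w : List ℕ) :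
    dif i (emax (i + 1) w) = dif i w + eps (i + 1) w := by
  rw [dif, count_emax_lo, count_emax_of_ne (by omega) (by omega), dif]; ring

theorem dif_emax_of_far {i l : ℕ} (h : l + 1 < i) (w : List ℕ) : dif l (emax i w) = dif l w := by
  rw [dif, count_emax_of_ne (by omega) (by omega), count_emax_of_ne (by omega) (by omega), dif]

theorem eps_le_eps_cons (i x : ℕ) (w : List ℕ) : eps i w ≤ eps i (x :: w) := le_max_left _ _

theorem eps_tail_le (i : ℕ) (s t : List ℕ) : eps i t ≤ eps i (s ++ t) := by
  rw [eps_append]; exact le_max_left _ _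

/-- Since `emax` treats each letter according to what follows it, it commutes with taking tails. So
`eps (i + 1) (emax i w)` is the maximum of `dif (i + 1) t + eps i t` over the tails `t` of `w`. The
next bound rests on the same principle. -/
theorem eps_succ_emax_le (i : ℕ) (w : List ℕ) :
    eps (i + 1) (emax i w) ≤ eps (i + 1) w + eps i w := by
  induction w with
  | nil => simp [emax]
  | cons x w ih =>
    have h₁ := eps_le_eps_cons i x w
    have h₂ := eps_le_eps_cons (i + 1) x w
    have h₃ := dif_succ_emax i (x :: w)
    have h₄ := dif_le_eps (i + 1) (x :: w)
    rw [emax] at h₃ ⊢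
    rw [eps_cons]
    omega

theorem dif_emax_emax (i : ℕ) (w : List ℕ) :
    dif i (emax (i + 1) (emax i w)) = dif i w - 2 * eps i w + eps (i + 1) (emax i w) := by
  rw [dif_emax_succ, dif_emax]

theorem eps_emax_emax_le (i : ℕ) (w : List ℕ) :
    eps i (emax (i + 1) (emax i w)) ≤ eps (i + 1) w := by
  induction w with
  | nil => simp [emax]
  | cons x w ih =>
    have h₁ := eps_le_eps_cons (i + 1) x w
    have h₂ := dif_emax_emax i (x :: w)
    have h₃ := eps_succ_emax_le i (x :: w)
    have h₄ := dif_le_eps i (x :: w)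
    rw [emax, emax] at h₂ ⊢
    rw [emax] at h₃
    rw [eps_cons]
    omega

theorem emax_append (i : ℕ) (s t : List ℕ) :
    ∃ s', s'.length = s.length ∧ emax i (s ++ t) = s' ++ emax i t := by
  induction s with
  | nil => exact ⟨[], rfl, rfl⟩
  | cons x s ih =>
    obtain ⟨s', h₁, h₂⟩ := ih
    refine ⟨(if x = i + 1 ∧ phi i (s ++ t) = 0 then i else x) :: s', by simp [h₁], ?_⟩
    rw [List.cons_append, emax, h₂]
    rfl

/-- Splittings of `emax i w` come from splittings of `w`. -/
theorem emax_eq_append {i : ℕ} {w s' t' : List ℕ} (h : emax i w = s' ++ t') :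
    ∃ s t, w = s ++ t ∧ t' = emax i t ∧ s'.length = s.length := by
  induction w generalizing s' with
  | nil =>
    simp [emax] at h
    exact ⟨[], [], rfl, by simp [h, emax], by simp [h]⟩
  | cons x w ih =>
    cases s' with
    | nil => exact ⟨[], x :: w, rfl, by simpa using h.symm, rfl⟩
    | cons y s' =>
      rw [emax, List.cons_append, List.cons.injEq] at h
      obtain ⟨s, t, rfl, h₁, h₂⟩ := ih h.2
      exact ⟨x :: s, t, rfl, h₁, by simp [h₂]⟩

theorem OneStep.count_eq {x y : ℕ} {P : List ℕ → List ℕ → Prop} {w w' : List ℕ}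
    (h : OneStep x y P w w') (j : ℕ) :
    w'.count j + (if j = x then 1 else 0) = w.count j + if j = y then 1 else 0 := by
  obtain ⟨s, t, rfl, rfl, -⟩ := h
  simp only [List.count_append, List.count_cons, beq_iff_eq, eq_comm (a := j)]
  omega

theorem exists_f_pow {i m : ℕ} (hi : i ≤ m) (k : ℕ) {w : List ℕ} (h : (k : ℤ) ≤ phi i w) :
    ∃ w', ConnLe m w w' ∧ (w'.count i : ℤ) = w.count i - k ∧
      (w'.count (i + 1) : ℤ) = w.count (i + 1) + k ∧
      ∀ j, j ≠ i → j ≠ i + 1 → w'.count j = w.count j := by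
  induction k generalizing w with
  | zero => exact ⟨w, Relation.ReflTransGen.refl, by simp, by simp, fun _ _ _ => rfl⟩
  | succ k ih =>
    obtain ⟨w₁, h₁⟩ := exists_f_of_phi_pos (i := i) (w := w) (by omega)
    have hp := h₁.phi_eps
    obtain ⟨w', hc, a, b, c⟩ := ih (w := w₁) (by push_cast at h; omega)
    refine ⟨w', Relation.ReflTransGen.head (Or.inl ⟨i, hi, Or.inl h₁⟩) hc, ?_, ?_, ?_⟩
    · have := h₁.count_eq i
      simp at this
      push_cast
      omega
    · have := h₁.count_eq (i + 1)
      simp at this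
      push_cast
      omega
    · intro j hj hj'
      have := h₁.count_eq j
      rw [if_neg hj, if_neg hj'] at this
      rw [c j hj hj']
      omega

/-- For every proper beginning of `w` that contains a letter `l` or `l + 1`, the letters `l + 1`
outnumber the letters `l`. -/
def StrictLattice (l : ℕ) (w : List ℕ) : Prop :=
  ∀ s t, w = s ++ t → (l ∈ s ∨ l + 1 ∈ s) → dif l t + 1 ≤ dif l w

/-- The value `eps l t` is attained at a tail of `t`, and the beginning cut off by that tail still
contains `s`. -/
theorem StrictLattice.eps_lt {l : ℕ} {w : List ℕ} (h : StrictLattice l w) {s t : List ℕ}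
    (hw : w = s ++ t) (hl : l ∈ s ∨ l + 1 ∈ s) : eps l t + 1 ≤ dif l w := by
  obtain ⟨t₁, t₂, rfl, ht⟩ := exists_tail_dif_eq_eps l t
  rw [← ht]
  refine h (s ++ t₁) t₂ (by simp [hw]) ?_
  rcases hl with hl | hl <;> simp [hl]

theorem dif_eq_zero_of_not_mem {l : ℕ} {s : List ℕ} (h₁ : l ∉ s) (h₂ : l + 1 ∉ s) :
    dif l s = 0 := by
  rw [dif, List.count_eq_zero.mpr h₁, List.count_eq_zero.mpr h₂]; simp

theorem StrictLattice.phi_eq_zero {l : ℕ} {w : List ℕ} (h : StrictLattice l w) : phi l w = 0 := by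
  obtain ⟨s, t, rfl, ht⟩ := exists_tail_dif_eq_eps l w
  by_cases hl : l ∈ s ∨ l + 1 ∈ s
  · have := h s t rfl hl
    have := phi_nonneg l (s ++ t)
    rw [phi] at *
    omega
  · push Not at hl
    have := dif_append l s t
    rw [dif_eq_zero_of_not_mem hl.1 hl.2] at this
    rw [phi]
    omega

/-- Between a tail and the whole word there is a tail without unmatched letters `i` that has the
same number of unmatched letters `i + 1`. -/
theorem exists_tail_phi_eq_zero {i : ℕ} (s t : List ℕ) (h : phi i (s ++ t) = 0) :
    ∃ s₁ s₂, s = s₁ ++ s₂ ∧ phi i (s₂ ++ t) = 0 ∧ eps i (s₂ ++ t) = eps i t := by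
  induction s using List.reverseRecOn generalizing t with
  | nil => exact ⟨[], [], rfl, h, rfl⟩
  | append_singleton s x ih =>
    by_cases ht : phi i t = 0
    · exact ⟨s ++ [x], [], by simp, ht, rfl⟩
    · obtain ⟨s₁, s₂, rfl, h₁, h₂⟩ := ih (x :: t) (by simpa using h)
      refine ⟨s₁, s₂ ++ [x], by simp, by simpa using h₁, ?_⟩
      rw [List.append_assoc, List.singleton_append, h₂, eps_cons_eq, if_neg (by tauto), add_zero]

/-- A word `i + 1, y₁, y₂, …` whose first letter is matched with a letter `i`, while the pairs of
smaller letters are strictly ordered, is connected to a word of lower weight. -/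
theorem exists_lower (i : ℕ) : ∀ ys : List ℕ, phi i ((i + 1) :: ys) = 0 → 0 < phi i ys →
    (∀ l < i, StrictLattice l ((i + 1) :: ys)) →
    ∃ r, ConnLe i ((i + 1) :: ys) r ∧
      (r.count i : ℤ) = ((i + 1) :: ys).count i - 1 ∧
      (r.count (i + 1) : ℤ) = ((i + 1) :: ys).count (i + 1) + 1 ∧
      ∀ j, j ≠ i → j ≠ i + 1 → r.count j = ((i + 1) :: ys).count j := by
  induction i with
  | zero =>
    intro ys h₁ h₂ _
    -- Being matched, the first letter 1 survives `emax 0`, and it is then the letter on which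
    -- `e_1̄` acts.
    have hc := connLe_emax (i := 0) (m := 0) le_rfl (1 :: ys)
    have e₁ := count_emax_lo 0 (1 :: ys)
    have e₂ := count_emax_hi 0 (1 :: ys)
    have e₃ := fun j h h' => count_emax_of_ne (i := 0) (j := j) h h' (1 :: ys)
    have hE : emax 0 (1 :: ys) = 1 :: emax 0 ys := by
      rw [emax, if_neg]
      omega
    simp only [zero_add] at *
    rw [hE] at hc e₁ e₂ e₃
    have hb : BarArr (0 :: emax 0 ys) (1 :: emax 0 ys) := ⟨[], _, rfl, rfl, by simp [BarCond]⟩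
    have hd : dif 0 (0 :: emax 0 ys) ≤ eps 0 (0 :: emax 0 ys) := dif_le_eps _ _
    have hp : phi 0 (0 :: emax 0 ys) = eps 0 (0 :: emax 0 ys) - dif 0 (0 :: emax 0 ys) := rfl
    have hn := eps_nonneg 0 (0 :: emax 0 ys)
    have b₀ := fun j => hb.count_eq j
    have b₁ := b₀ 0
    have b₂ := b₀ 1
    simp only [if_true, zero_ne_one, one_ne_zero, if_false] at b₁ b₂
    have hd' : dif 0 (0 :: emax 0 ys) =
      ((0 :: emax 0 ys).count 1 : ℤ) - (0 :: emax 0 ys).count 0 := rfl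
    have hd₀ : dif 0 (1 :: ys) = ((1 :: ys).count 1 : ℤ) - (1 :: ys).count 0 := rfl
    have h₃ : phi 0 (1 :: ys) = eps 0 (1 :: ys) - dif 0 (1 :: ys) := rfl
    have h₄ := eps_nonneg 0 (1 :: ys)
    -- As `phi` vanishes, `emax 0` has exchanged the numbers of letters 0 and 1, and `e_1̄` has then
    -- turned a 1 into a 0. The exponent `dif + 2` exchanges them back and lowers the weight by one
    -- root more.
    obtain ⟨r, hr, r₁, r₂, r₃⟩ := exists_f_pow (i := 0) (m := 0) le_rfl
      (dif 0 (1 :: ys) + 2).toNat (w := 0 :: emax 0 ys) (by omega)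
    refine ⟨r, hc.trans (Relation.ReflTransGen.head (Or.inr (Or.inr hb)) hr), by omega,
      by simp only [zero_add] at r₂; omega, fun j hj hj' => ?_⟩
    rw [r₃ j hj hj']
    have := b₀ j
    have := e₃ j hj hj'
    simp only [hj, hj', if_false] at *
    omega
  | succ i ih =>
    intro ys h₁ h₂ h₃
    -- Let `r` contain `a`, `b`, `c` letters `i`, `i + 1`, `i + 2`. Applying `emax i` and `emax (i +
    -- 1)` yields `b`, `c`, `a` and turns the first letter into `i + 1`. The induction hypothesis
    -- leads to `b - 1`, `c + 1`, `a`; then `c - a + 1` times `f_{i+1}` and `b - a - 1` times `f_i`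
    -- lead to `a`, `b - 1`, `c + 1`.
    have hS := h₃ i (by omega)
    have hphi := hS.phi_eq_zero
    set r := (i + 1 + 1) :: ys with hr
    have hdr : dif i r = dif i ys := by rw [hr, dif_cons, if_neg (by omega), if_neg (by omega)]; ring
    have her : eps i r = eps i ys := by
      rw [hr, eps_cons_eq, if_neg (by omega), add_zero]
    have hdr' : dif (i + 1) r = dif (i + 1) ys + 1 := by rw [hr, dif_cons]; simp
    have ph : ∀ j w, phi j w = eps j w - dif j w := fun _ _ => rfl
    have hE₁ : emax i r = (i + 1 + 1) :: emax i ys := by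
      rw [hr, emax, if_neg (by omega)]
    -- This makes the first letter unmatched after `emax i`. For a tail `t` of `ys`, the lattice
    -- property of `r` only gives a bound that is too weak by one, because `r` has one more `i + 2`
    -- than `ys`. If the bound is attained, an `i + 1` is cut off, and strictness at `i` gains the
    -- missing one.
    have hpE : phi (i + 1) (emax i ys) = 0 := by
      have hle : eps (i + 1) (emax i ys) ≤ dif (i + 1) (emax i ys) := by
        obtain ⟨s', t', hst, ht⟩ := exists_tail_dif_eq_eps (i + 1) (emax i ys)
        obtain ⟨s, t, rfl, rfl, -⟩ := emax_eq_append hst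
        rw [← ht, dif_succ_emax, dif_succ_emax]
        have a₁ := dif_tail_le_eps (i + 1) ((i + 1 + 1) :: s) t
        have a₂ := eps_tail_le i s t
        have a₃ := dif_append (i + 1) s t
        by_cases hs : dif (i + 1) s = -1
        · have hm : i + 1 ∈ s := by
            by_contra hm
            rw [dif, List.count_eq_zero.mpr hm] at hs
            omega
          have := hS.eps_lt (s := (i + 1 + 1) :: s) (t := t) (by simp [hr])
            (Or.inr (List.mem_cons_of_mem _ hm))
          have := ph i r
          rw [List.cons_append, ← hr] at a₁
          have := ph (i + 1) r
          omega
        · rw [List.cons_append, ← hr] at a₁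
          have := ph (i + 1) r
          omega
      have := phi_nonneg (i + 1) (emax i ys)
      have := ph (i + 1) (emax i ys)
      omega
    have hE₂ : emax (i + 1) (emax i r) = (i + 1) :: emax (i + 1) (emax i ys) := by
      rw [hE₁, emax, if_pos ⟨rfl, hpE⟩]
    have hp₁ : phi (i + 1) (emax i r) = 0 := by
      have a₁ := eps_succ_emax_le i r
      have a₂ := dif_succ_emax i r
      have a₃ := phi_nonneg (i + 1) (emax i r)
      have := ph (i + 1) (emax i r)
      have := ph (i + 1) r
      omega
    -- Both `phi i` and `phi (i + 1)` vanish on `r`, so the total excess after both reflections is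
    -- `dif (i + 1) r = eps (i + 1) r`, which is the upper bound for `eps i` there.
    have hp₂ : phi i (emax (i + 1) (emax i r)) = 0 := by
      have a₁ := eps_emax_emax_le i r
      have a₂ := dif_emax_emax i r
      have a₃ := phi_nonneg i (emax (i + 1) (emax i r))
      have a₄ := dif_succ_emax i r
      have := ph (i + 1) (emax i r)
      have := ph (i + 1) r
      have := ph i r
      have := ph i (emax (i + 1) (emax i r))
      omega
    -- The total excess of letters `i + 1` over `i` has become `dif (i + 1) ys`. A tail with excess
    -- at least `eps (i + 1) ys` comes from a tail `t` attaining that value, enlarged so that `phi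
    -- i` vanishes while `eps i` is unchanged. Hence `phi i` is at least the old `phi (i + 1) ys`.
    have hp₃ : 0 < phi i (emax (i + 1) (emax i ys)) := by
      obtain ⟨s, t, hst, ht⟩ := exists_tail_dif_eq_eps (i + 1) ys
      obtain ⟨s₁, s₂, rfl, hs₁, hs₂⟩ := exists_tail_phi_eq_zero (i := i) s t (by
        rw [← hst]; rw [ph] at hphi ⊢; omega)
      have a₁ : dif i (emax (i + 1) (emax i (s₂ ++ t))) ≤ eps i (emax (i + 1) (emax i ys)) := by
        rw [hst, List.append_assoc]
        obtain ⟨u, -, hu⟩ := emax_append i s₁ (s₂ ++ t)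
        rw [hu]
        obtain ⟨v, -, hv⟩ := emax_append (i + 1) u (emax i (s₂ ++ t))
        rw [hv]
        exact dif_tail_le_eps _ _ _
      have a₂ := dif_emax_emax i (s₂ ++ t)
      have a₃ : dif (i + 1) t + eps i t ≤ eps (i + 1) (emax i (s₂ ++ t)) := by
        rw [← dif_succ_emax]
        obtain ⟨u, -, hu⟩ := emax_append i s₂ t
        rw [hu]
        exact dif_tail_le_eps _ _ _
      have a₄ := dif_emax_emax i ys
      have a₅ := ph (i + 1) (emax i ys)
      have a₆ := dif_succ_emax i ys
      have := ph i (s₂ ++ t)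
      have := ph i r
      have := ph (i + 1) ys
      have := ph i (emax (i + 1) (emax i ys))
      omega
    -- Only `l = i - 1` is affected by the reflections: the excess of a tail `t` increases by `eps i
    -- t`.
    have hp₄ : ∀ l < i, StrictLattice l ((i + 1) :: emax (i + 1) (emax i ys)) := by
      rw [← hE₂]
      intro l hl s' t' hst hm
      obtain ⟨s₁, t₁, hst₁, rfl, hl₁⟩ := emax_eq_append hst
      obtain ⟨s, t, hst₂, rfl, hl₂⟩ := emax_eq_append hst₁
      rw [dif_emax_of_far (by omega) (emax i t), dif_emax_of_far (by omega) (emax i r)]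
      have cnt : ∀ j, j < i + 1 → (s'.count j : ℤ) =
          s.count j + if j = i then eps i r - eps i t else 0 := by
        intro j hj
        have c₁ : (emax (i + 1) (emax i r)).count j = (emax i r).count j :=
          count_emax_of_ne (by omega) (by omega) _
        have c₂ : (emax (i + 1) (emax i t)).count j = (emax i t).count j :=
          count_emax_of_ne (by omega) (by omega) _
        have c₃ := congrArg (List.count j) hst
        have c₄ := congrArg (List.count j) hst₂
        rw [List.count_append] at c₃ c₄
        by_cases hji : j = i
        · subst hji
          have c₅ := count_emax_lo j r
          have c₆ := count_emax_lo j t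
          rw [if_pos rfl]
          omega
        · have c₅ := count_emax_of_ne (i := i) hji (by omega) r
          have c₆ := count_emax_of_ne (i := i) hji (by omega) t
          rw [if_neg hji]
          omega
      have hmono : eps i t ≤ eps i r := by rw [hst₂]; exact eps_tail_le _ _ _
      have hrr := ph i r
      by_cases hli : l + 1 = i
      · subst hli
        rw [dif_emax_succ, dif_emax_succ]
        by_cases hs : l ∈ s ∨ l + 1 ∈ s
        · have := h₃ l (by omega) s t hst₂ hs
          omega
        · push Not at hs
          have d₀ := dif_append l s t
          rw [← hst₂, dif_eq_zero_of_not_mem hs.1 hs.2] at d₀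
          -- If the old beginning has neither `l` nor `l + 1` but the new one does, the new letter
          -- arose from an `l + 2`; strictness at `l + 1` then gives the strict inequality.
          have hs2 : l + 1 + 1 ∈ s := by
            by_contra hs2
            have c₁ := cnt l (by omega)
            have c₂ := cnt (l + 1) (by omega)
            rw [List.count_eq_zero.mpr hs.1] at c₁
            rw [List.count_eq_zero.mpr hs.2] at c₂
            simp at c₁ c₂
            have e₁ : eps (l + 1) r = eps (l + 1) t := by
              rw [hst₂, eps_append, eps_of_forall_ne (i := l + 1) (w := s)
                (fun x hx => ⟨fun h => hs.2 (h ▸ hx), fun h => hs2 (h ▸ hx)⟩)]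
              have := dif_le_eps (l + 1) t
              omega
            rw [e₁] at c₂
            rcases hm with hm | hm
            · have := List.count_pos_iff.mpr hm
              omega
            · have := List.count_pos_iff.mpr hm
              omega
          have := hS.eps_lt hst₂ (Or.inr hs2)
          omega
      · rw [dif_emax_of_far (by omega), dif_emax_of_far (by omega)]
        refine h₃ l (by omega) s t hst₂ ?_
        have c₁ := cnt l (by omega)
        have c₂ := cnt (l + 1) (by omega)
        rw [if_neg (by omega), add_zero] at c₁ c₂
        rcases hm with hm | hm
        · left
          have := List.count_pos_iff.mpr hm
          exact List.count_pos_iff.mp (by omega)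
        · right
          have := List.count_pos_iff.mpr hm
          exact List.count_pos_iff.mp (by omega)
    obtain ⟨r₃, hc, q₁, q₂, q₃⟩ := ih _ (by rw [← hE₂]; exact hp₂) hp₃ hp₄
    rw [← hE₂] at hc q₁ q₂ q₃
    have q₄ := q₃ (i + 1 + 1) (by omega) (by omega)
    have k₁ := count_emax_lo i r
    have k₂ := count_emax_hi i r
    have k₃ := count_emax_of_ne (i := i) (j := i + 1 + 1) (by omega) (by omega) r
    have k₄ := count_emax_lo (i + 1) (emax i r)
    have k₅ := count_emax_hi (i + 1) (emax i r)
    have k₆ := count_emax_of_ne (i := i + 1) (j := i) (by omega) (by omega) (emax i r)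
    have df : ∀ j w, dif j w = (w.count (j + 1) : ℤ) - w.count j := fun _ _ => rfl
    have d₁ := df i r
    have d₂ := df (i + 1) r
    have d₃ := df (i + 1) (emax i r)
    have d₄ := ph i r
    have d₅ := ph (i + 1) r
    have d₆ := ph (i + 1) (emax i r)
    have d₇ := df (i + 1) r₃
    have d₈ := ph (i + 1) r₃
    have n₁ := eps_nonneg i r
    have n₂ := eps_nonneg (i + 1) r
    have n₃ := eps_nonneg (i + 1) r₃
    obtain ⟨r₄, hc₄, u₁, u₂, u₃⟩ := exists_f_pow (i := i + 1) (m := i + 1) le_rfl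
      (dif i r + dif (i + 1) r + 1).toNat (w := r₃) (by omega)
    have u₄ := u₃ i (by omega) (by omega)
    have d₉ := df i r₄
    have d₁₀ := ph i r₄
    have n₄ := eps_nonneg i r₄
    -- The leading `i + 2` is matched, so some `i + 1` occurs, and strictness at `i` applies to the
    -- whole word. This makes the last exponent `dif i r - 1` nonnegative.
    have n₅ : 1 ≤ dif i r := by
      have : i + 1 ∈ ys := by
        by_contra hm
        have hle : eps (i + 1) ys ≤ dif (i + 1) ys := by
          obtain ⟨s, t, rfl, ht⟩ := exists_tail_dif_eq_eps (i + 1) ys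
          rw [← ht, dif_append, df (i + 1) s]
          simp only [List.mem_append, not_or] at hm
          rw [List.count_eq_zero.mpr hm.1]
          omega
        have := ph (i + 1) ys
        omega
      have := hS.eps_lt (s := r) (t := []) (by simp) (Or.inr (List.mem_cons_of_mem _ this))
      simpa using this
    obtain ⟨r₅, hc₅, v₁, v₂, v₃⟩ := exists_f_pow (i := i) (m := i + 1) (by omega)
      (dif i r - 1).toNat (w := r₄) (by omega)
    have v₄ := v₃ (i + 1 + 1) (by omega) (by omega)
    refine ⟨r₅, ?_, by omega, by omega, fun j hj hj' => ?_⟩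
    · exact (connLe_emax (by omega) r).trans ((connLe_emax le_rfl _).trans
        ((hc.mono (by omega)).trans (hc₄.trans hc₅)))
    · by_cases hji : j = i
      · subst hji
        omega
      · rw [v₃ j hji hj, u₃ j hj hj', q₃ j hji hj, count_emax_of_ne hj hj',
          count_emax_of_ne hji hj]

end QueerCrystal

namespace QueerCrystal

/-! ### Reading words of tableaux -/

/-- The values of the letters of a list of boxes. -/
def letters {n : ℕ} (B : List (Box n)) : List ℕ := B.map fun x => x.letter.val

/-- The reading word of a tableau. -/
def word {n : ℕ} (T : Tableau n) : List ℕ := letters (reading T)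

/-- The reading word of a row. -/
def rowWord {n : ℕ} (u : List (Fin n)) : List ℕ := (u.map Fin.val).reverse

/-- The reading word of the rows above `k`. -/
def upWord {n : ℕ} (T : Tableau n) (k : Fin n) : List ℕ :=
  ((List.finRange n).take k).flatMap fun j => rowWord (T j)

/-- The reading word of the rows below `k`. -/
def lowWord {n : ℕ} (T : Tableau n) (k : Fin n) : List ℕ :=
  ((List.finRange n).drop (k + 1)).flatMap fun j => rowWord (T j)

/-- Two tableaux have the same row lengths. -/
def SameShape {n : ℕ} (T T' : Tableau n) : Prop := ∀ k, (T' k).length = (T k).length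

variable {n : ℕ}

@[simp] theorem letters_append (A B : List (Box n)) : letters (A ++ B) = letters A ++ letters B := by
  simp [letters]

@[simp] theorem letters_cons (x : Box n) (B : List (Box n)) :
    letters (x :: B) = x.letter.val :: letters B := rfl

@[simp] theorem letters_nil : letters ([] : List (Box n)) = [] := rfl

@[simp] theorem rowWord_append (u v : List (Fin n)) : rowWord (u ++ v) = rowWord v ++ rowWord u := by
  simp [rowWord]

@[simp] theorem rowWord_cons (a : Fin n) (v : List (Fin n)) :
    rowWord (a :: v) = rowWord v ++ [a.val] := by
  simp [rowWord]

@[simp] theorem rowWord_nil : rowWord ([] : List (Fin n)) = [] := rfl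

@[simp] theorem rowWord_length (u : List (Fin n)) : (rowWord u).length = u.length := by
  simp [rowWord]

theorem mem_rowWord {u : List (Fin n)} {x : ℕ} : x ∈ rowWord u ↔ ∃ a ∈ u, a.val = x := by
  simp [rowWord]

theorem letters_row (k : Fin n) (u : List (Fin n)) :
    letters (u.zipIdx.reverse.map fun p => (⟨k, p.2, p.1⟩ : Box n)) = rowWord u := by
  rw [letters, rowWord, List.map_map, List.map_reverse]
  congr 1
  conv_rhs => rw [← List.zipIdx_map_fst 0 u]
  rw [List.map_map]
  rfl

theorem word_eq_flatMap (T : Tableau n) :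
    word T = (List.finRange n).flatMap fun j => rowWord (T j) := by
  rw [word, letters, reading, List.map_flatMap]
  congr 1
  funext k
  exact letters_row k (T k)

theorem finRange_eq (k : Fin n) : List.finRange n =
    (List.finRange n).take k ++ k :: (List.finRange n).drop (k + 1) := by
  conv_lhs => rw [← List.take_append_drop k (List.finRange n)]
  rw [List.drop_eq_getElem_cons (by simp)]
  simp

theorem word_eq (T : Tableau n) (k : Fin n) :
    word T = upWord T k ++ rowWord (T k) ++ lowWord T k := by
  rw [word_eq_flatMap, finRange_eq k, upWord, lowWord]
  simp

theorem mem_take_finRange {k j : Fin n} : j ∈ (List.finRange n).take k ↔ j < k := by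
  rw [List.mem_take_iff_getElem]
  simp only [List.getElem_finRange, List.length_finRange]
  constructor
  · rintro ⟨i, hi, rfl⟩
    rw [Fin.lt_def]
    simp
    omega
  · intro h
    exact ⟨j, by rw [Fin.lt_def] at h; omega, by simp⟩

theorem mem_drop_finRange {k j : Fin n} : j ∈ (List.finRange n).drop (k + 1) ↔ k < j := by
  rw [List.mem_drop_iff_getElem]
  simp only [List.getElem_finRange, List.length_finRange]
  constructor
  · rintro ⟨i, hi, rfl⟩
    rw [Fin.lt_def]
    simp
    omega
  · intro h
    rw [Fin.lt_def] at h
    refine ⟨j - (k + 1), by omega, ?_⟩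
    ext
    simp
    omega

theorem upWord_congr {T T' : Tableau n} {k : Fin n} (h : ∀ j < k, rowWord (T' j) = rowWord (T j)) :
    upWord T' k = upWord T k :=
  List.flatMap_congr fun j hj => h j (mem_take_finRange.mp hj)

theorem lowWord_congr {T T' : Tableau n} {k : Fin n} (h : ∀ j, k < j → T' j = T j) :
    lowWord T' k = lowWord T k :=
  List.flatMap_congr fun j hj => by rw [h j (mem_drop_finRange.mp hj)]

theorem word_update (T : Tableau n) (k : Fin n) (u : List (Fin n)) :
    word (Function.update T k u) = upWord T k ++ rowWord u ++ lowWord T k := by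
  rw [word_eq _ k, Function.update_self,
    upWord_congr (T := T) fun j hj => by rw [Function.update_of_ne hj.ne],
    lowWord_congr (T := T) fun j hj => Function.update_of_ne hj.ne' _ _]

theorem lowWord_eq (T : Tableau n) {k k' : Fin n} (h : k'.val = k.val + 1) :
    lowWord T k = rowWord (T k') ++ lowWord T k' := by
  rw [lowWord, lowWord, List.drop_eq_getElem_cons (by simp; omega), List.flatMap_cons]
  congr 2
  · congr 1
    ext
    simp [h]
  · rw [h]

theorem flatMap_eq_append_cons {α β : Type*} {l : List α} {f : α → List β} {s t : List β} {x : β}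
    (h : l.flatMap f = s ++ x :: t) : ∃ l₁ k l₂ p q, l = l₁ ++ k :: l₂ ∧ f k = p ++ x :: q ∧
      s = l₁.flatMap f ++ p ∧ t = q ++ l₂.flatMap f := by
  induction l generalizing s with
  | nil => simp at h
  | cons a l ih =>
    rw [List.flatMap_cons] at h
    rcases List.append_eq_append_iff.mp h with ⟨m, rfl, h₂⟩ | ⟨m, h₁, h₂⟩
    · obtain ⟨l₁, k, l₂, p, q, rfl, h₃, rfl, rfl⟩ := ih h₂
      exact ⟨a :: l₁, k, l₂, p, q, rfl, h₃, by simp, rfl⟩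
    · cases m with
      | nil =>
        simp only [List.append_nil, List.nil_append] at h₁ h₂
        obtain ⟨l₁, k, l₂, p, q, rfl, h₃, h₄, rfl⟩ := ih (s := []) h₂.symm
        refine ⟨a :: l₁, k, l₂, p, q, rfl, h₃, ?_, rfl⟩
        rw [List.flatMap_cons, List.append_assoc, ← h₄, h₁, List.append_nil]
      | cons y m =>
        rw [List.cons_append, List.cons.injEq] at h₂
        obtain ⟨rfl, rfl⟩ := h₂
        exact ⟨[], a, l, s, m, rfl, h₁, by simp, rfl⟩

/-- Rows are read from right to left, so the part `c` to the right of a box precedes it in the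
reading word and the part `b` to its left follows it. -/
theorem reading_split {T : Tableau n} {S R : List (Box n)} {x : Box n}
    (h : reading T = S ++ x :: R) : ∃ b c, T x.row = b ++ x.letter :: c ∧ x.col = b.length ∧
      letters S = upWord T x.row ++ rowWord c ∧ letters R = rowWord b ++ lowWord T x.row := by
  obtain ⟨l₁, k, l₂, p, q, hl, hk, rfl, rfl⟩ := flatMap_eq_append_cons h
  have hlen : l₁.length = k.val := by
    have : (List.finRange n)[l₁.length]'(by rw [hl]; simp) = k := by simp [hl]
    rw [← this]
    simp
  have hl₁ : (List.finRange n).take k = l₁ := by rw [hl, ← hlen]; simp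
  have hl₂ : (List.finRange n).drop (k + 1) = l₂ := by rw [hl, ← hlen]; simp
  rw [List.map_reverse, List.reverse_eq_iff] at hk
  simp only [List.reverse_append, List.reverse_cons, List.append_assoc, List.singleton_append] at hk
  have hrow : x.row = k := by
    have : x ∈ (T k).zipIdx.map fun p => (⟨k, p.2, p.1⟩ : Box n) := by rw [hk]; simp
    rw [List.mem_map] at this
    obtain ⟨_, -, rfl⟩ := this
    rfl
  have hlet : T k = q.reverse.map (·.letter) ++ x.letter :: p.reverse.map (·.letter) := by
    have := congrArg (List.map (·.letter)) hk
    rw [List.map_map, List.map_append, List.map_cons] at this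
    rw [← this]
    conv_lhs => rw [← List.zipIdx_map_fst 0 (T k)]
    rfl
  have hcol : x.col = q.length := by
    have h₁ := congrArg (fun l => l[q.length]?) hk
    simp only [List.getElem?_map, List.getElem?_zipIdx] at h₁
    rw [List.getElem?_append_right (by simp)] at h₁
    simp at h₁
    obtain ⟨a, -, rfl⟩ := h₁
    rfl
  have hf : ∀ l : List (Fin n), letters (l.flatMap fun k => (T k).zipIdx.reverse.map
      fun p => (⟨k, p.2, p.1⟩ : Box n)) = l.flatMap fun j => rowWord (T j) := by
    intro l
    rw [letters, List.map_flatMap]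
    congr 1
    funext k
    exact letters_row k (T k)
  refine ⟨q.reverse.map (·.letter), p.reverse.map (·.letter), by rw [hrow, hlet], by simp [hcol],
    ?_, ?_⟩
  · rw [letters_append, hf, hrow, upWord, hl₁]
    simp [rowWord, letters]
  · rw [letters_append, hf, hrow, lowWord, hl₂]
    simp [rowWord, letters]

theorem word_split {T : Tableau n} {s t : List ℕ} {x : ℕ} (h : word T = s ++ x :: t) :
    ∃ k b a c, T k = b ++ a :: c ∧ a.val = x ∧ s = upWord T k ++ rowWord c ∧
      t = rowWord b ++ lowWord T k := by
  obtain ⟨S, R', h₁, rfl, h₂⟩ := List.map_eq_append_iff.mp h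
  obtain ⟨y, R, rfl, h₃, rfl⟩ := List.map_eq_cons_iff.mp h₂
  obtain ⟨b, c, e₁, -, e₂, e₃⟩ := reading_split h₁
  exact ⟨y.row, b, y.letter, c, e₁, h₃, e₂, e₃⟩

theorem change_spec {T : Tableau n} {S R : List (Box n)} {x : Box n}
    (h : reading T = S ++ x :: R) (a : Fin n) :
    SameShape T (change T x a) ∧ word (change T x a) = letters S ++ a.val :: letters R := by
  obtain ⟨b, c, h₁, h₂, h₃, h₄⟩ := reading_split h
  have hc : change T x a = Function.update T x.row (b ++ a :: c) := by
    rw [change, h₁, h₂]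
    simp
  rw [hc]
  refine ⟨fun k => ?_, ?_⟩
  · by_cases hk : k = x.row
    · subst hk
      rw [Function.update_self, h₁]
      simp
    · rw [Function.update_of_ne hk]
  · rw [word_update, h₃, h₄]
    simp

theorem SameShape.symm {T T' : Tableau n} (h : SameShape T T') : SameShape T' T :=
  fun k => (h k).symm

theorem word_injective {T T' : Tableau n} (hs : SameShape T T') (h : word T' = word T) :
    T' = T := by
  rw [word_eq_flatMap, word_eq_flatMap] at h
  have key : ∀ l : List (Fin n), (l.flatMap fun j => rowWord (T' j)) =
      (l.flatMap fun j => rowWord (T j)) → ∀ k ∈ l, T' k = T k := by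
    intro l
    induction l with
    | nil => simp
    | cons a l ih =>
      intro h k hk
      rw [List.flatMap_cons, List.flatMap_cons] at h
      obtain ⟨h₁, h₂⟩ := List.append_inj h (by simp [hs a])
      rcases List.mem_cons.mp hk with rfl | hk
      · rw [rowWord, rowWord, List.reverse_inj] at h₁
        exact List.map_injective_iff.mpr Fin.val_injective h₁
      · exact ih h₂ k hk
  funext k
  exact key _ h k (List.mem_finRange k)

/-! ### The operators in terms of reading words -/

theorem letter_eq_hi {i : I0 n} {a : Fin n} : a = i.hi ↔ a.val = i.1 + 1 := by
  rw [Fin.ext_iff]; rfl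

theorem letter_eq_lo {i : I0 n} {a : Fin n} : a = i.lo ↔ a.val = i.1 := by
  rw [Fin.ext_iff]; rfl

/-- `redStep` works on a stack whose top is the letter read last: unmatched letters `i + 1` above
unmatched letters `i`. Thus the last entry of `his` is the leftmost unmatched `i + 1`, and the head
of `los` the rightmost unmatched `i`. These are the letters that `e_i` and `f_i` change, and the
invariant carries `NumCond` for both. -/
theorem foldl_redStep (i : I0 n) (R : List (Box n)) :
    ∃ his los, R.foldl (redStep i) [] = his ++ los ∧
      (∀ x ∈ his, x.letter = i.hi) ∧ (∀ x ∈ los, x.letter = i.lo) ∧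
      (his.length : ℤ) = eps i.1 (letters R) ∧ (los.length : ℤ) = phi i.1 (letters R) ∧
      (∀ x ∈ his.getLast?, ∃ S R', R = S ++ x :: R' ∧ NumCond i.1 (letters S) (letters R')) ∧
      ∀ x ∈ los.head?, ∃ S R', R = S ++ x :: R' ∧ NumCond i.1 (letters S) (letters R') := by
  induction R using List.reverseRecOn with
  | nil => exact ⟨[], [], by simp [letters]⟩
  | append_singleton R y ih =>
    obtain ⟨his, los, h₁, h₂, h₃, h₄, h₅, h₆, h₇⟩ := ih
    rw [List.foldl_append, h₁, List.foldl_cons, List.foldl_nil]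
    have e₁ := eps_append i.1 (letters R) (letters [y])
    have e₂ := phi_append i.1 (letters R) (letters [y])
    rw [← letters_append] at e₁ e₂
    have e₃ : phi i.1 (letters R) = eps i.1 (letters R) - dif i.1 (letters R) := rfl
    have e₄ := phi_nonneg i.1 (letters R)
    have e₅ := eps_nonneg i.1 (letters R)
    -- A recorded position survives the next letter `y` if an unmatched `i` in `[y]` is absorbed by
    -- the excess of letters `i + 1` after that position.
    have ext : ∀ x S R', R = S ++ x :: R' → NumCond i.1 (letters S) (letters R') →
        phi i.1 (letters [y]) ≤ dif i.1 (letters R') →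
        ∃ S R', R ++ [y] = S ++ x :: R' ∧ NumCond i.1 (letters S) (letters R') := by
      intro x S R' hR hN hy
      refine ⟨S, R' ++ [y], by simp [hR], hN.1, ?_⟩
      rw [letters_append, phi_append]
      have := hN.2
      omega
    have dnn : ∀ {S R' : List (Box n)}, NumCond i.1 (letters S) (letters R') →
        0 ≤ dif i.1 (letters R') := by
      intro S R' h
      have := h.2
      rw [phi] at this
      have := eps_nonneg i.1 (letters R')
      omega
    by_cases hhi : y.letter = i.hi
    · have hy := letter_eq_hi.mp hhi
      have d₁ : dif i.1 (letters [y]) = 1 := by simp [dif_cons, hy]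
      have d₂ : eps i.1 (letters [y]) = 1 := by simp [eps_cons, dif_cons, hy]
      have d₃ : phi i.1 (letters [y]) = 0 := by rw [phi, d₁, d₂]; rfl
      refine ⟨y :: his, los, by simp [redStep, hhi], ?_, h₃, ?_, ?_, ?_, ?_⟩
      · intro x hx
        rcases List.mem_cons.mp hx with rfl | hx
        · exact hhi
        · exact h₂ x hx
      · rw [List.length_cons]
        push_cast
        omega
      · omega
      · intro x hx
        cases his with
        | nil =>
          simp at hx
          subst hx
          exact ⟨R, [], rfl, by simpa using h₄.symm, by simp⟩
        | cons z his =>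
          rw [List.getLast?_cons_cons] at hx
          obtain ⟨S, R', hR, hN⟩ := h₆ x hx
          exact ext x S R' hR hN (by rw [d₃]; exact dnn hN)
      · intro x hx
        obtain ⟨S, R', hR, hN⟩ := h₇ x hx
        exact ext x S R' hR hN (by rw [d₃]; exact dnn hN)
    · by_cases hlo : y.letter = i.lo
      · have hy := letter_eq_lo.mp hlo
        have d₁ : dif i.1 (letters [y]) = -1 := by simp [dif_cons, hy]
        have d₂ : eps i.1 (letters [y]) = 0 := by simp [eps_cons, dif_cons, hy]
        have d₃ : phi i.1 (letters [y]) = 1 := by rw [phi, d₁, d₂]; rfl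
        cases his with
        | nil =>
          refine ⟨[], y :: los, ?_, by simp, ?_, ?_, ?_, by simp, ?_⟩
          · unfold redStep
            rw [if_neg hhi, if_pos hlo]
            cases los with
            | nil => rfl
            | cons z los =>
              have : z.letter ≠ i.hi := by
                rw [h₃ z (by simp), Ne, letter_eq_hi]
                simp [I0.lo]
              simp [this]
          · intro x hx
            rcases List.mem_cons.mp hx with rfl | hx
            · exact hlo
            · exact h₃ x hx
          · simp only [List.length_nil, Nat.cast_zero] at h₄ ⊢
            omega
          · rw [List.length_cons]
            simp at h₄
            push_cast
            omega
          · intro x hx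
            simp at hx
            subst hx
            exact ⟨R, [], rfl, by simpa using h₄.symm, by simp⟩
        | cons z his =>
          rw [List.length_cons] at h₄
          push_cast at h₄
          refine ⟨his, los, ?_, fun x hx => h₂ x (List.mem_cons_of_mem _ hx), h₃, by omega,
            by omega, ?_, ?_⟩
          · unfold redStep
            rw [if_neg hhi, if_pos hlo]
            simp [h₂ z (by simp)]
          · intro x hx
            cases his with
            | nil => simp at hx
            | cons z' his =>
              obtain ⟨S, R', hR, hN⟩ := h₆ x (by rw [List.getLast?_cons_cons]; exact hx)
              refine ext x S R' hR hN ?_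
              have hxl : x.letter.val = i.1 + 1 := letter_eq_hi.mp (h₂ x
                (List.mem_cons_of_mem _ (List.mem_of_getLast? hx)))
              rw [d₃]
              rw [hR, letters_append, letters_cons, eps_append, eps_cons, hxl, dif_cons, hN.1] at h₄
              have := hN.2
              rw [phi] at this
              simp at h₄
              omega
          · intro x hx
            obtain ⟨S, R', hR, hN⟩ := h₇ x hx
            refine ext x S R' hR hN ?_
            have hxl : x.letter.val = i.1 := letter_eq_lo.mp (h₃ x (List.mem_of_head? hx))
            rw [d₃]
            rw [hR, letters_append, letters_cons, eps_append, eps_cons, hxl, dif_cons, hN.1] at h₄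
            have := hN.2
            rw [phi] at this
            simp at h₄
            omega
      · have hy₁ : y.letter.val ≠ i.1 + 1 := fun h => hhi (letter_eq_hi.mpr h)
        have hy₂ : y.letter.val ≠ i.1 := fun h => hlo (letter_eq_lo.mpr h)
        have d₁ : dif i.1 (letters [y]) = 0 := by simp [dif_cons, hy₁, hy₂]
        have d₂ : eps i.1 (letters [y]) = 0 := by simp [eps_cons, dif_cons, hy₁, hy₂]
        have d₃ : phi i.1 (letters [y]) = 0 := by rw [phi, d₁, d₂]; rfl
        refine ⟨his, los, by simp [redStep, hhi, hlo], h₂, h₃, by omega, by omega, ?_, ?_⟩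
        · intro x hx
          obtain ⟨S, R', hR, hN⟩ := h₆ x hx
          exact ext x S R' hR hN (by rw [d₃]; exact dnn hN)
        · intro x hx
          obtain ⟨S, R', hR, hN⟩ := h₇ x hx
          exact ext x S R' hR hN (by rw [d₃]; exact dnn hN)

theorem lo_ne_hi (i : I0 n) : i.lo ≠ i.hi := by
  rw [Ne, letter_eq_hi]; simp [I0.lo]

theorem redHi_eq (i : I0 n) (T : Tableau n) : redHi i T = eps i.1 (word T) := by
  obtain ⟨his, los, h₁, h₂, h₃, h₄, -⟩ := foldl_redStep i (reading T)
  have a : his.countP (fun x => x.letter = i.hi) = his.length :=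
    List.countP_eq_length.mpr fun x hx => by simpa using h₂ x hx
  have b : los.countP (fun x => x.letter = i.hi) = 0 :=
    List.countP_eq_zero.mpr fun x hx => by simpa [h₃ x hx] using lo_ne_hi i
  rw [redHi, red, h₁, List.countP_reverse, List.countP_append, a, b, word, ← h₄]
  simp

theorem redLo_eq (i : I0 n) (T : Tableau n) : redLo i T = phi i.1 (word T) := by
  obtain ⟨his, los, h₁, h₂, h₃, -, h₅, -⟩ := foldl_redStep i (reading T)
  have a : his.countP (fun x => x.letter = i.lo) = 0 :=
    List.countP_eq_zero.mpr fun x hx => by simpa [h₂ x hx] using (lo_ne_hi i).symm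
  have b : los.countP (fun x => x.letter = i.lo) = los.length :=
    List.countP_eq_length.mpr fun x hx => by simpa using h₃ x hx
  rw [redLo, red, h₁, List.countP_reverse, List.countP_append, a, b, word, ← h₅]
  simp

theorem find?_hi (i : I0 n) (T : Tableau n) :
    (∃ x S R, (red i T).find? (fun x => x.letter = i.hi) = some x ∧ x.letter = i.hi ∧
      reading T = S ++ x :: R ∧ NumCond i.1 (letters S) (letters R)) ∨
    ((red i T).find? (fun x => x.letter = i.hi) = none ∧ eps i.1 (word T) = 0) := by
  obtain ⟨his, los, h₁, h₂, h₃, h₄, -, h₆, -⟩ := foldl_redStep i (reading T)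
  have hl : los.reverse.find? (fun x => x.letter = i.hi) = none :=
    List.find?_eq_none.mpr fun x hx => by
      simpa [h₃ x (List.mem_reverse.mp hx)] using lo_ne_hi i
  rcases List.eq_nil_or_concat his with rfl | ⟨his, x, rfl⟩
  · right
    exact ⟨by rw [red, h₁]; simpa using hl, by rw [word, ← h₄]; simp⟩
  · left
    obtain ⟨S, R, hR, hN⟩ := h₆ x (by simp)
    have hx := h₂ x (by simp)
    refine ⟨x, S, R, ?_, hx, hR, hN⟩
    rw [red, h₁, List.reverse_append, List.find?_append, hl]
    simp [hx]

theorem find?_lo (i : I0 n) (T : Tableau n) :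
    (∃ x S R, (red i T).reverse.find? (fun x => x.letter = i.lo) = some x ∧ x.letter = i.lo ∧
      reading T = S ++ x :: R ∧ NumCond i.1 (letters S) (letters R)) ∨
    ((red i T).reverse.find? (fun x => x.letter = i.lo) = none ∧ phi i.1 (word T) = 0) := by
  obtain ⟨his, los, h₁, h₂, h₃, -, h₅, -, h₇⟩ := foldl_redStep i (reading T)
  have hl : his.find? (fun x => x.letter = i.lo) = none :=
    List.find?_eq_none.mpr fun x hx => by
      simpa [h₂ x hx] using (lo_ne_hi i).symm
  cases los with
  | nil =>
    right
    exact ⟨by rw [red, h₁]; simpa using hl, by rw [word, ← h₅]; simp⟩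
  | cons x los =>
    left
    obtain ⟨S, R, hR, hN⟩ := h₇ x (by simp)
    have hx := h₃ x (by simp)
    refine ⟨x, S, R, ?_, hx, hR, hN⟩
    rw [red, h₁, List.reverse_reverse, List.find?_append, hl]
    simp [hx]

variable [n.AtLeastTwo]

theorem readingOne_head? (T : Tableau n) :
    (∃ x S R, (readingOne T).head? = some x ∧ x.letter.val < 2 ∧
      reading T = S ++ x :: R ∧ BarCond (letters S) (letters R)) ∨
    ((readingOne T).head? = none ∧ ∀ a ∈ word T, 2 ≤ a) := by
  have hp : ∀ x : Box n, (x.letter = (I0.first n).lo ∨ x.letter = (I0.first n).hi) ↔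
      x.letter.val < 2 := by
    intro x
    rw [letter_eq_lo, letter_eq_hi]
    show x.letter.val = 0 ∨ x.letter.val = 0 + 1 ↔ _
    omega
  rw [readingOne, List.head?_filter]
  cases h : (reading T).find? fun x => x.letter = (I0.first n).lo ∨ x.letter = (I0.first n).hi with
  | some x =>
    left
    obtain ⟨hx, S, R, hR, hS⟩ := List.find?_eq_some_iff_append.mp h
    refine ⟨x, S, R, rfl, (hp x).mp (by simpa using hx), hR, ?_⟩
    intro a ha
    obtain ⟨y, hy, rfl⟩ := List.mem_map.mp ha
    have := hS y hy
    simp only [hp, Bool.not_eq_true', decide_eq_false_iff_not] at this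
    omega
  | none =>
    right
    refine ⟨rfl, fun a ha => ?_⟩
    obtain ⟨y, hy, rfl⟩ := List.mem_map.mp ha
    have := List.find?_eq_none.mp h y hy
    simp only [hp, decide_eq_true_eq] at this
    omega

theorem changeE_spec (T : Tableau n) (q : QIndex n) :
    (∃ T', changeE T q = some T' ∧ SameShape T T' ∧ Arr q (word T') (word T)) ∨
      (changeE T q = none ∧ ∀ w, ¬ Arr q w (word T)) := by
  cases q with
  | num i =>
    rcases find?_hi i T with ⟨x, S, R, h₁, h₂, h₃, h₄⟩ | ⟨h₁, h₂⟩
    · left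
      refine ⟨change T x i.lo, by rw [changeE, h₁]; rfl, (change_spec h₃ _).1,
        letters S, letters R, (change_spec h₃ _).2, ?_, h₄⟩
      rw [word, h₃, letters_append, letters_cons, h₂]
      rfl
    · right
      refine ⟨by rw [changeE, h₁]; rfl, fun w hw => ?_⟩
      have := (NumArr.phi_eps (i := i.1) hw).2
      have := eps_nonneg i.1 w
      omega
  | bar =>
    rcases readingOne_head? T with ⟨x, S, R, h₁, h₂, h₃, h₄⟩ | ⟨h₁, h₂⟩
    · have hw : word T = letters S ++ x.letter.val :: letters R := by rw [word, h₃]; simp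
      by_cases hx : x.letter = (I0.first n).hi
      · left
        refine ⟨change T x (I0.first n).lo, by rw [changeE, h₁]; simp [hx],
          (change_spec h₃ _).1, letters S, letters R, (change_spec h₃ _).2, ?_, h₄⟩
        rw [hw, hx]
        rfl
      · right
        refine ⟨by rw [changeE, h₁]; simp [hx], ?_⟩
        rintro w ⟨s, t, rfl, he, hb⟩
        rw [letter_eq_hi] at hx
        change x.letter.val ≠ 0 + 1 at hx
        change word T = s ++ (0 + 1) :: t at he
        rw [hw] at he
        rcases List.append_eq_append_iff.mp he with ⟨m, a, b⟩ | ⟨m, a, b⟩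
        · cases m with
          | nil => simp only [List.nil_append, List.cons.injEq] at b; omega
          | cons z m =>
            simp at b
            have := hb z (by simp [a])
            omega
        · cases m with
          | nil => simp only [List.nil_append, List.cons.injEq] at b; omega
          | cons z m =>
            simp at b
            have := h₄ z (by simp [a])
            omega
    · right
      refine ⟨by rw [changeE, h₁]; rfl, ?_⟩
      rintro w ⟨s, t, rfl, he, hb⟩
      have := h₂ (0 + 1) (by rw [he]; simp [QIndex.base, I0.first])
      omega

theorem changeF_spec (T : Tableau n) (q : QIndex n) :
    (∃ T', changeF T q = some T' ∧ SameShape T T' ∧ Arr q (word T) (word T')) ∨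
      (changeF T q = none ∧ ∀ w, ¬ Arr q (word T) w) := by
  cases q with
  | num i =>
    rcases find?_lo i T with ⟨x, S, R, h₁, h₂, h₃, h₄⟩ | ⟨h₁, h₂⟩
    · left
      refine ⟨change T x i.hi, by rw [changeF, h₁]; rfl, (change_spec h₃ _).1,
        letters S, letters R, ?_, (change_spec h₃ _).2, h₄⟩
      rw [word, h₃, letters_append, letters_cons, h₂]
      rfl
    · right
      refine ⟨by rw [changeF, h₁]; rfl, fun w hw => ?_⟩
      have := (NumArr.phi_eps (i := i.1) hw).1
      have := phi_nonneg i.1 w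
      omega
  | bar =>
    rcases readingOne_head? T with ⟨x, S, R, h₁, h₂, h₃, h₄⟩ | ⟨h₁, h₂⟩
    · have hw : word T = letters S ++ x.letter.val :: letters R := by rw [word, h₃]; simp
      by_cases hx : x.letter = (I0.first n).lo
      · left
        refine ⟨change T x (I0.first n).hi, by rw [changeF, h₁]; simp [hx],
          (change_spec h₃ _).1, letters S, letters R, ?_, (change_spec h₃ _).2, h₄⟩
        rw [hw, hx]
        rfl
      · right
        refine ⟨by rw [changeF, h₁]; simp [hx], ?_⟩
        rintro w ⟨s, t, he, rfl, hb⟩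
        rw [letter_eq_lo] at hx
        change x.letter.val ≠ 0 at hx
        change word T = s ++ 0 :: t at he
        rw [hw] at he
        rcases List.append_eq_append_iff.mp he with ⟨m, a, b⟩ | ⟨m, a, b⟩
        · cases m with
          | nil => simp only [List.nil_append, List.cons.injEq] at b; omega
          | cons z m =>
            simp at b
            have := hb z (by simp [a])
            omega
        · cases m with
          | nil => simp only [List.nil_append, List.cons.injEq] at b; omega
          | cons z m =>
            simp at b
            have := h₄ z (by simp [a])
            omega
    · right
      refine ⟨by rw [changeF, h₁]; rfl, ?_⟩
      rintro w ⟨s, t, he, rfl, hb⟩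
      have := h₂ 0 (by rw [he]; simp [QIndex.base, I0.first])
      omega

/-- From here on the operators are relations between words of tableaux of one shape, with `e` the
converse of `f`. -/
theorem changeE_eq_some_iff {T T' : Tableau n} {q : QIndex n} :
    changeE T q = some T' ↔ SameShape T T' ∧ Arr q (word T') (word T) := by
  rcases changeE_spec T q with ⟨T₁, h₁, h₂, h₃⟩ | ⟨h₁, h₂⟩
  · rw [h₁, Option.some_inj]
    constructor
    · rintro rfl
      exact ⟨h₂, h₃⟩
    · rintro ⟨h₄, h₅⟩
      exact word_injective (fun k => by rw [h₂ k, h₄ k]) (h₃.unique_left h₅)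
  · rw [h₁]
    simp only [reduceCtorEq, false_iff, not_and]
    exact fun _ => h₂ _

theorem changeF_eq_some_iff {T T' : Tableau n} {q : QIndex n} :
    changeF T q = some T' ↔ SameShape T T' ∧ Arr q (word T) (word T') := by
  rcases changeF_spec T q with ⟨T₁, h₁, h₂, h₃⟩ | ⟨h₁, h₂⟩
  · rw [h₁, Option.some_inj]
    constructor
    · rintro rfl
      exact ⟨h₂, h₃⟩
    · rintro ⟨h₄, h₅⟩
      exact word_injective (fun k => by rw [h₂ k, h₄ k]) (h₃.unique h₅)
  · rw [h₁]
    simp only [reduceCtorEq, false_iff, not_and]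
    exact fun _ => h₂ _

end QueerCrystal

namespace QueerCrystal

/-! ### The crystal of semistandard decomposition tableaux -/

theorem isDecomposition_iff {n : ℕ} (T : Tableau n) : IsDecomposition T ↔
    (∀ k, RevHook (rowWord (T k))) ∧ ∀ k k' : Fin n, k'.1 = k.1 + 1 → ∀ h : List ℕ,
      h.Sublist (rowWord (T k) ++ rowWord (T k')) → RevHook h → h.length ≤ (T k).length := by
  constructor
  · rintro ⟨h₁, h₂⟩
    refine ⟨fun k => ?_, fun k k' hk h hs hh => ?_⟩
    · by_cases hT : T k = []
      · rw [hT]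
        exact ⟨[], [], rfl, by simp, by simp⟩
      · exact ((isHookWord_iff _).mp (h₁ k hT)).2
    · rw [← rowWord_append, rowWord, ← List.map_reverse, List.sublist_map_iff] at hs
      obtain ⟨w, hw, rfl⟩ := hs
      by_cases hw' : w = []
      · simp [hw']
      · have := h₂ k k' hk w.reverse (by rw [← List.reverse_sublist]; simpa using hw)
          ((isHookWord_iff _).mpr ⟨by simpa using hw', by simpa using hh⟩)
        simpa using this
  · rintro ⟨h₁, h₂⟩
    refine ⟨fun k hk => (isHookWord_iff _).mpr ⟨hk, h₁ k⟩, fun k k' hk w hw hh => ?_⟩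
    have := h₂ k k' hk (rowWord w)
      (by rw [← rowWord_append]; exact List.reverse_sublist.mpr (hw.map _))
      ((isHookWord_iff _).mp hh).2
    simpa using this

variable {n : ℕ} [n.AtLeastTwo]

/-- Both conditions concern factors of the reading word: one row, or two adjacent rows. On a factor
an arrow restricts to an arrow or to the identity, and arrows carry hook subwords over in both
directions without changing their length. -/
theorem Arr.isDecomposition {T T' : Tableau n} {q : QIndex n} (hs : SameShape T T')
    (h : Arr q (word T) (word T')) : IsDecomposition T ↔ IsDecomposition T' := by
  rw [isDecomposition_iff, isDecomposition_iff]
  have row : ∀ k, rowWord (T' k) = rowWord (T k) ∨ Arr q (rowWord (T k)) (rowWord (T' k)) := by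
    intro k
    rw [word_eq T k, word_eq T' k] at h
    refine Arr.factor ?_ (by simp [hs k]) h
    simp only [upWord, List.length_flatMap, rowWord_length, hs _]
  have pair : ∀ k k' : Fin n, k'.1 = k.1 + 1 →
      rowWord (T' k) ++ rowWord (T' k') = rowWord (T k) ++ rowWord (T k') ∨
      Arr q (rowWord (T k) ++ rowWord (T k')) (rowWord (T' k) ++ rowWord (T' k')) := by
    intro k k' hk
    rw [word_eq T k, word_eq T' k, lowWord_eq T hk, lowWord_eq T' hk, ← List.append_assoc,
      ← List.append_assoc, List.append_assoc (upWord T k), List.append_assoc (upWord T' k)] at h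
    refine Arr.factor ?_ (by simp [hs k, hs k']) h
    simp only [upWord, List.length_flatMap, rowWord_length, hs _]
  constructor
  · rintro ⟨h₁, h₂⟩
    refine ⟨fun k => ?_, fun k k' hk w hw hh => ?_⟩
    · rcases row k with h | h
      · rw [h]; exact h₁ k
      · obtain ⟨w, a, b, c⟩ := h.revHook (List.Sublist.refl _) (h₁ k)
        -- A hook subword as long as the row is the whole row.
        rwa [a.eq_of_length (by rw [c, OneStep.length_eq h])] at b
    · rw [hs k]
      rcases pair k k' hk with h | h
      · exact h₂ k k' hk w (h ▸ hw) hh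
      · obtain ⟨w', a, b, c⟩ := h.revHook_symm hw hh
        rw [← c]
        exact h₂ k k' hk w' a b
  · rintro ⟨h₁, h₂⟩
    refine ⟨fun k => ?_, fun k k' hk w hw hh => ?_⟩
    · rcases row k with h | h
      · rw [← h]; exact h₁ k
      · obtain ⟨w, a, b, c⟩ := h.revHook_symm (List.Sublist.refl _) (h₁ k)
        rwa [a.eq_of_length (by rw [c, OneStep.length_eq h])] at b
    · rw [← hs k]
      rcases pair k k' hk with h | h
      · exact h₂ k k' hk w (h.symm ▸ hw) hh
      · obtain ⟨w', a, b, c⟩ := h.revHook hw hh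
        rw [← c]
        exact h₂ k k' hk w' a b

theorem count_rowWord {n : ℕ} (u : List (Fin n)) (j : Fin n) : (rowWord u).count j.1 = u.count j := by
  rw [rowWord, List.count_reverse, List.count_map_of_injective _ _ Fin.val_injective]

theorem content_eq {n : ℕ} (T : Tableau n) (j : Fin n) : content T j = ((word T).count j.1 : ℕ) := by
  rw [content, word_eq_flatMap, List.count_flatMap, Fin.sum_univ_def]
  push_cast
  rw [List.map_map]
  congr 2
  funext k
  simp [count_rowWord]

theorem wtI_content {n : ℕ} (i : I0 n) (T : Tableau n) : wtI i (content T) = -dif i.1 (word T) := by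
  rw [wtI, content_eq, content_eq, dif]
  simp [I0.lo, I0.hi]

theorem sdtCrystal_e {lam : Fin n → ℕ} {S S' : SDT lam} {q : QIndex n} :
    (sdtCrystal lam).e q S = some S' ↔ Arr q (word S'.1) (word S.1) := by
  simp only [sdtCrystal, Option.bind_eq_some_iff]
  constructor
  · rintro ⟨T', h₁, h₂⟩
    split_ifs at h₂ with h
    obtain rfl := Option.some.inj h₂
    exact (changeE_eq_some_iff.mp h₁).2
  · intro h
    refine ⟨S'.1, changeE_eq_some_iff.mpr ⟨fun k => by rw [S.2.2, S'.2.2], h⟩, ?_⟩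
    rw [dif_pos S'.2]
    rfl

theorem sdtCrystal_f {lam : Fin n → ℕ} {S S' : SDT lam} {q : QIndex n} :
    (sdtCrystal lam).f q S = some S' ↔ Arr q (word S.1) (word S'.1) := by
  simp only [sdtCrystal, Option.bind_eq_some_iff]
  constructor
  · rintro ⟨T', h₁, h₂⟩
    split_ifs at h₂ with h
    obtain rfl := Option.some.inj h₂
    exact (changeF_eq_some_iff.mp h₁).2
  · intro h
    refine ⟨S'.1, changeF_eq_some_iff.mpr ⟨fun k => by rw [S.2.2, S'.2.2], h⟩, ?_⟩
    rw [dif_pos S'.2]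
    rfl

theorem exists_sdt_f {lam : Fin n → ℕ} {S : SDT lam} {q : QIndex n} {w : List ℕ}
    (h : Arr q (word S.1) w) : ∃ S' : SDT lam, word S'.1 = w := by
  rcases changeF_spec S.1 q with ⟨T', -, h₂, h₃⟩ | ⟨-, h₂⟩
  · exact ⟨⟨T', (h₃.isDecomposition h₂).mp S.2.1, fun k => by rw [h₂ k, S.2.2]⟩, h₃.unique h⟩
  · exact absurd h (h₂ w)

theorem exists_sdt_e {lam : Fin n → ℕ} {S : SDT lam} {q : QIndex n} {w : List ℕ}
    (h : Arr q w (word S.1)) : ∃ S' : SDT lam, word S'.1 = w := by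
  rcases changeE_spec S.1 q with ⟨T', -, h₂, h₃⟩ | ⟨-, h₂⟩
  · exact ⟨⟨T', (h₃.isDecomposition h₂.symm).mpr S.2.1, fun k => by rw [h₂ k, S.2.2]⟩,
      h₃.unique_left h⟩
  · exact absurd h (h₂ w)

theorem Arr.content_sub {T T' : Tableau n} {q : QIndex n} (h : Arr q (word T) (word T')) :
    content T' = content T - simpleRoot q.base := by
  funext j
  have := OneStep.count_eq h j.1
  rw [Pi.sub_apply, content_eq, content_eq, simpleRoot, Pi.sub_apply, Pi.single_apply,
    Pi.single_apply]
  simp only [letter_eq_hi, letter_eq_lo]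
  split_ifs at this ⊢ <;> omega

/-- Operators with disjoint sets of letters commute. -/
theorem sdtCrystal_comm {n : ℕ} {lam : Fin n → ℕ} {X Y : QIndex n → SDT lam → Option (SDT lam)}
    {R R' : List ℕ → List ℕ → Prop} {q q' : QIndex n} (S : SDT lam)
    (hX : ∀ S S', X q S = some S' ↔ R (word S.1) (word S'.1))
    (hY : ∀ S S', Y q' S = some S' ↔ R' (word S.1) (word S'.1))
    (hX' : ∀ S : SDT lam, ∀ w, R (word S.1) w → ∃ S' : SDT lam, word S'.1 = w)
    (hY' : ∀ S : SDT lam, ∀ w, R' (word S.1) w → ∃ S' : SDT lam, word S'.1 = w)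
    (hc : ∀ w w₂, (∃ w₁, R w w₁ ∧ R' w₁ w₂) ↔ ∃ w₁, R' w w₁ ∧ R w₁ w₂) :
    (X q S).bind (Y q') = (Y q' S).bind (X q) := by
  ext S₂
  simp only [Option.bind_eq_some_iff, hX, hY]
  constructor
  · rintro ⟨S₁, h₁, h₂⟩
    obtain ⟨w, h₃, h₄⟩ := (hc _ _).mp ⟨_, h₁, h₂⟩
    obtain ⟨S', rfl⟩ := hY' S w h₃
    exact ⟨S', h₃, h₄⟩
  · rintro ⟨S₁, h₁, h₂⟩
    obtain ⟨w, h₃, h₄⟩ := (hc _ _).mpr ⟨_, h₁, h₂⟩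
    obtain ⟨S', rfl⟩ := hX' S w h₃
    exact ⟨S', h₃, h₄⟩

theorem isQCrystal_sdtCrystal (lam : Fin n → ℕ) : IsQCrystal (sdtCrystal lam) where
  wt_e i b b' h := by
    have := (sdtCrystal_e.mp h).content_sub
    change content b'.1 = content b.1 + simpleRoot i.base
    rw [this]
    simp
  wt_f i b b' h := (sdtCrystal_f.mp h).content_sub
  φ_eq i b := by
    change ((redLo i b.1 : ℤ) : WithBot ℤ) = (redHi i b.1 : ℤ) + ((wtI i (content b.1) : ℤ) : WithBot ℤ)
    rw [redLo_eq, redHi_eq, wtI_content, phi, ← WithBot.coe_add, sub_eq_add_neg]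
  f_iff_e i b b' := by rw [sdtCrystal_f, sdtCrystal_e]
  string_e i b b' h := by
    have := NumArr.phi_eps (i := i.1) (sdtCrystal_e.mp h)
    change ((redHi i b'.1 : ℤ) : WithBot ℤ) + ((1 : ℤ) : WithBot ℤ) = (redHi i b.1 : ℤ) ∧
      ((redLo i b'.1 : ℤ) : WithBot ℤ) = (redLo i b.1 : ℤ) + ((1 : ℤ) : WithBot ℤ)
    rw [redHi_eq, redHi_eq, redLo_eq, redLo_eq, this.1, this.2]
    simp
  string_f i b b' h := by
    have := NumArr.phi_eps (i := i.1) (sdtCrystal_f.mp h)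
    change ((redHi i b'.1 : ℤ) : WithBot ℤ) = (redHi i b.1 : ℤ) + ((1 : ℤ) : WithBot ℤ) ∧
      ((redLo i b'.1 : ℤ) : WithBot ℤ) + ((1 : ℤ) : WithBot ℤ) = (redLo i b.1 : ℤ)
    rw [redHi_eq, redHi_eq, redLo_eq, redLo_eq, this.1, this.2]
    simp
  φ_bot i b h := absurd h (WithBot.coe_ne_bot)
  comm i hi b := by
    refine ⟨sdtCrystal_comm (R := fun a c => Arr QIndex.bar c a) (R' := fun a c => Arr (QIndex.num i) c a) b
        (fun _ _ => sdtCrystal_e) (fun _ _ => sdtCrystal_e) (fun _ _ h => exists_sdt_e h)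
        (fun _ _ h => exists_sdt_e h) fun w w₂ => ?_,
      sdtCrystal_comm (R := fun a c => Arr QIndex.bar c a) (R' := fun a c => Arr (QIndex.num i) a c) b
        (fun _ _ => sdtCrystal_e) (fun _ _ => sdtCrystal_f) (fun _ _ h => exists_sdt_e h)
        (fun _ _ h => exists_sdt_f h) fun w w₂ => ?_,
      sdtCrystal_comm (R := fun a c => Arr QIndex.bar a c) (R' := fun a c => Arr (QIndex.num i) c a) b
        (fun _ _ => sdtCrystal_f) (fun _ _ => sdtCrystal_e) (fun _ _ h => exists_sdt_f h)
        (fun _ _ h => exists_sdt_e h) fun w w₂ => ?_,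
      sdtCrystal_comm (R := fun a c => Arr QIndex.bar a c) (R' := fun a c => Arr (QIndex.num i) a c) b
        (fun _ _ => sdtCrystal_f) (fun _ _ => sdtCrystal_f) (fun _ _ h => exists_sdt_f h)
        (fun _ _ h => exists_sdt_f h) fun w w₂ => ?_⟩
    · have := numArr_barArr_comm (x := 1) (y := 0) (x' := i.1 + 1) (y' := i.1) hi (by omega)
        (by omega) (by omega) (by omega) (w := w) (w₂ := w₂)
      constructor
      · rintro ⟨w₁, h₁, h₂⟩
        obtain ⟨w₁, h₁, h₂⟩ := this.mp ⟨w₁, OneStep.symm h₁, OneStep.symm h₂⟩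
        exact ⟨w₁, OneStep.symm h₁, OneStep.symm h₂⟩
      · rintro ⟨w₁, h₁, h₂⟩
        obtain ⟨w₁, h₁, h₂⟩ := this.mpr ⟨w₁, OneStep.symm h₁, OneStep.symm h₂⟩
        exact ⟨w₁, OneStep.symm h₁, OneStep.symm h₂⟩
    · have := numArr_barArr_comm (x := 1) (y := 0) (x' := i.1) (y' := i.1 + 1) hi (by omega)
        (by omega) (by omega) (by omega) (w := w) (w₂ := w₂)
      constructor
      · rintro ⟨w₁, h₁, h₂⟩
        obtain ⟨w₁, h₁, h₂⟩ := this.mp ⟨w₁, OneStep.symm h₁, h₂⟩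
        exact ⟨w₁, h₁, OneStep.symm h₂⟩
      · rintro ⟨w₁, h₁, h₂⟩
        obtain ⟨w₁, h₁, h₂⟩ := this.mpr ⟨w₁, h₁, OneStep.symm h₂⟩
        exact ⟨w₁, OneStep.symm h₁, h₂⟩
    · have := numArr_barArr_comm (x := 0) (y := 1) (x' := i.1 + 1) (y' := i.1) hi (by omega)
        (by omega) (by omega) (by omega) (w := w) (w₂ := w₂)
      constructor
      · rintro ⟨w₁, h₁, h₂⟩
        obtain ⟨w₁, h₁, h₂⟩ := this.mp ⟨w₁, h₁, OneStep.symm h₂⟩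
        exact ⟨w₁, OneStep.symm h₁, h₂⟩
      · rintro ⟨w₁, h₁, h₂⟩
        obtain ⟨w₁, h₁, h₂⟩ := this.mpr ⟨w₁, OneStep.symm h₁, h₂⟩
        exact ⟨w₁, h₁, OneStep.symm h₂⟩
    · exact numArr_barArr_comm (x := 0) (y := 1) (x' := i.1) (y' := i.1 + 1) hi (by omega)
        (by omega) (by omega) (by omega) (w := w) (w₂ := w₂)
  string_bar i hi b b' h := by
    change ((redHi i b'.1 : ℤ) : WithBot ℤ) = (redHi i b.1 : ℤ) ∧
      ((redLo i b'.1 : ℤ) : WithBot ℤ) = (redLo i b.1 : ℤ)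
    obtain ⟨s, t, h₁, h₂, -⟩ := sdtCrystal_e.mp h
    have : sig i.1 (word b'.1) = sig i.1 (word b.1) := by
      rw [h₁, h₂]
      exact sig_change (x := 0) (y := 1) (by omega) (by omega) s t
    rw [redHi_eq, redHi_eq, redLo_eq, redLo_eq, ← eps_sig, ← phi_sig, this, eps_sig, phi_sig]
    exact ⟨rfl, rfl⟩

/-- In the axioms weights occur only through differences of two weights or of two coordinates, and
neither sees a translation by a multiple of (1, …, 1). -/
theorem isQCrystal_of_isShiftedIso {B C : Type*} {X : CrystalData n B} {Y : CrystalData n C}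
    {c : ℤ} {ψ : B ≃ C} (h : IsShiftedIso X Y c ψ) (hY : IsQCrystal Y) : IsQCrystal X := by
  have he : ∀ i b b', X.e i b = some b' ↔ Y.e i (ψ b) = some (ψ b') := by
    intro i b b'
    rw [h.e]
    cases X.e i b <;> simp
  have hf : ∀ i b b', X.f i b = some b' ↔ Y.f i (ψ b) = some (ψ b') := by
    intro i b b'
    rw [h.f]
    cases X.f i b <;> simp
  have hinj : Function.Injective (Option.map ψ) := Option.map_injective ψ.injective
  have bind : ∀ (F G : B → Option B) (F' G' : C → Option C), (∀ b, F' (ψ b) = (F b).map ψ) →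
      (∀ b, G' (ψ b) = (G b).map ψ) → ∀ b, ((F b).bind G).map ψ = (F' (ψ b)).bind G' := by
    intro F G F' G' hF hG b
    rw [hF]
    cases F b with
    | none => rfl
    | some x => simp [hG]
  constructor
  · intro i b b' hb
    have := hY.wt_e i _ _ ((he i b b').mp hb)
    funext j
    have := congrFun this j
    rw [Pi.add_apply, h.wt, h.wt] at this
    rw [Pi.add_apply]
    omega
  · intro i b b' hb
    have := hY.wt_f i _ _ ((hf i b b').mp hb)
    funext j
    have := congrFun this j
    rw [Pi.sub_apply, h.wt, h.wt] at this
    rw [Pi.sub_apply]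
    omega
  · intro i b
    have := hY.φ_eq i (ψ b)
    rw [h.φ, h.ε] at this
    rw [this, wtI, wtI, h.wt, h.wt]
    congr 2
    ring
  · intro i b b'
    rw [hf, he, hY.f_iff_e]
  · intro i b b' hb
    rw [← h.ε, ← h.ε, ← h.φ, ← h.φ]
    exact hY.string_e i _ _ ((he _ b b').mp hb)
  · intro i b b' hb
    rw [← h.ε, ← h.ε, ← h.φ, ← h.φ]
    exact hY.string_f i _ _ ((hf _ b b').mp hb)
  · intro i b hb
    rw [← h.φ] at hb
    have := hY.φ_bot i _ hb
    rw [h.e, h.f, Option.map_eq_none_iff, Option.map_eq_none_iff] at this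
    exact this
  · intro i hi b
    obtain ⟨h₁, h₂, h₃, h₄⟩ := hY.comm i hi (ψ b)
    refine ⟨hinj ?_, hinj ?_, hinj ?_, hinj ?_⟩
    · rw [bind _ _ _ _ (h.e _) (h.e _), bind _ _ _ _ (h.e _) (h.e _), h₁]
    · rw [bind _ _ _ _ (h.e _) (h.f _), bind _ _ _ _ (h.f _) (h.e _), h₂]
    · rw [bind _ _ _ _ (h.f _) (h.e _), bind _ _ _ _ (h.e _) (h.f _), h₃]
    · rw [bind _ _ _ _ (h.f _) (h.f _), bind _ _ _ _ (h.f _) (h.f _), h₄]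
  · intro i hi b b' hb
    rw [← h.ε, ← h.ε, ← h.φ, ← h.φ]
    exact hY.string_bar i hi _ _ ((he _ b b').mp hb)

end QueerCrystal

namespace QueerCrystal

/-! ### Rows of decomposition tableaux -/

/-- A smaller letter somewhere after `y` forces `y` into the strictly decreasing part. -/
theorem RevHook.lt_of_mem {l₁ l₂ l₃ : List ℕ} {x y : ℕ} (h : RevHook (l₁ ++ y :: (l₂ ++ x :: l₃)))
    (hxy : x < y) : ∀ z ∈ l₁, y < z := by
  obtain ⟨p, q, he, hp, hq⟩ := h
  rcases List.append_eq_append_iff.mp he with ⟨m, rfl, h₂⟩ | ⟨m, rfl, h₂⟩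
  · cases m with
    | nil =>
      simp only [List.nil_append] at h₂
      subst h₂
      have := (List.pairwise_cons.mp hq).1 x (by simp)
      omega
    | cons y' m =>
      simp only [List.cons_append, List.cons.injEq] at h₂
      obtain ⟨rfl, -⟩ := h₂
      intro z hz
      exact (List.pairwise_append.mp hp).2.2 z hz y (by simp)
  · subst h₂
    have := (List.pairwise_cons.mp (List.pairwise_append.mp hq).2.1).1 x (by simp)
    omega

theorem RevHook.append_of_le {h : List ℕ} {m : ℕ} (hh : RevHook h) (hm : ∀ x ∈ h, x ≤ m) (a : ℕ) :
    RevHook (h ++ List.replicate a m) := by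
  obtain ⟨p, q, rfl, hp, hq⟩ := hh
  refine ⟨p, q ++ List.replicate a m, by simp, hp, ?_⟩
  rw [List.pairwise_append]
  refine ⟨hq, by simp [List.pairwise_replicate], fun x hx y hy => ?_⟩
  rw [List.eq_of_mem_replicate hy]
  exact hm x (by simp [hx])

theorem RevHook.concat {h : List ℕ} {x y : ℕ} (hh : RevHook (h ++ [y])) (hxy : y ≤ x) :
    RevHook (h ++ [y] ++ [x]) := by
  obtain ⟨p, q, he, hp, hq⟩ := hh
  rcases List.eq_nil_or_concat q with rfl | ⟨q, z, rfl⟩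
  · exact ⟨p, [x], by simp [he], hp, by simp⟩
  · rw [List.concat_eq_append] at *
    have : z = y := by
      have := congrArg List.getLast? he
      simpa using this.symm
    subst this
    refine ⟨p, q ++ [z] ++ [x], by simp [he], hp, ?_⟩
    rw [List.pairwise_append]
    refine ⟨hq, by simp, fun a ha b hb => ?_⟩
    rw [List.mem_singleton] at hb
    subst hb
    rcases List.mem_append.mp ha with ha | ha
    · exact ((List.pairwise_append.mp hq).2.2 a ha z (by simp)).trans hxy
    · rw [List.mem_singleton] at ha
      omega

theorem rowWord_replicate {n : ℕ} (a : ℕ) (m : Fin n) :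
    rowWord (List.replicate a m) = List.replicate a m.val := by
  simp [rowWord]

/-- By induction the leftmost letter of row `k` is at most `n - 1 - k`. A letter of row `k + 1`
violating the bound would be at least as large, so appending it to the reading of row `k` would give
a hook subword longer than that row. -/
theorem IsDecomposition.add_lt {n : ℕ} {T : Tableau n} (hT : IsDecomposition T) (k : Fin n) :
    ∀ a ∈ T k, a.val + k.val < n := by
  rw [isDecomposition_iff] at hT
  obtain ⟨h₁, h₂⟩ := hT
  obtain ⟨k, hk⟩ := k
  induction k with
  | zero => intro a _; exact a.2
  | succ k ih =>
    intro a ha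
    have hk' : k < n := by omega
    have h := h₂ ⟨k, hk'⟩ ⟨k + 1, hk⟩ rfl
    have ha' : ([a.val] : List ℕ).Sublist (rowWord (T ⟨k + 1, hk⟩)) :=
      List.singleton_sublist.mpr (mem_rowWord.mpr ⟨a, ha, rfl⟩)
    cases hT : T ⟨k, hk'⟩ with
    | nil =>
      have := h [a.val] (by rw [hT]; simpa using ha') ⟨[], [a.val], rfl, by simp, by simp⟩
      rw [hT] at this
      simp at this
    | cons y v =>
      have hy := ih hk' y (by rw [hT]; simp)
      simp only at hy ⊢
      by_contra hcon
      have hr := h₁ ⟨k, hk'⟩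
      rw [hT, rowWord_cons] at hr
      have := h (rowWord v ++ [y.val] ++ [a.val])
        (by rw [hT, rowWord_cons]; exact (List.Sublist.refl _).append ha')
        (hr.concat (by omega))
      rw [hT] at this
      simp at this

/-- Tableaux whose rows are, up to a long enough beginning `m, …, m`, arbitrary hook words. -/
theorem isDecomposition_of_replicate {n : ℕ} {T : Tableau n} (a : Fin n → ℕ)
    (c : Fin n → List (Fin n)) (hT : ∀ k, T k = List.replicate (a k) k.rev ++ c k)
    (hc : ∀ k, RevHook (rowWord (c k))) (hle : ∀ k, ∀ x ∈ c k, x ≤ k.rev)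
    (ha : ∀ k k' : Fin n, k'.1 = k.1 + 1 → (T k').length + 1 ≤ a k) : IsDecomposition T := by
  rw [isDecomposition_iff]
  have hleT : ∀ k, ∀ x ∈ rowWord (T k), x ≤ k.rev.val := by
    intro k x hx
    obtain ⟨y, hy, rfl⟩ := mem_rowWord.mp hx
    rw [hT] at hy
    rcases List.mem_append.mp hy with hy | hy
    · rw [List.eq_of_mem_replicate hy]
    · exact hle k y hy
  refine ⟨fun k => ?_, fun k k' hk h hs hh => ?_⟩
  · rw [hT, rowWord_append, rowWord_replicate]
    refine (hc k).append_of_le (fun x hx => ?_) _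
    obtain ⟨y, hy, rfl⟩ := mem_rowWord.mp hx
    exact hle k y hy
  · have hak := ha k k' hk
    have hw' := hleT k'
    have hwk := hleT k
    rw [hT k, List.length_append, List.length_replicate]
    rw [hT k, rowWord_append, rowWord_replicate] at hs hwk
    obtain ⟨h₁₂, h₃, rfl, hs₁₂, hs₃⟩ := List.sublist_append_iff.mp hs
    obtain ⟨h₁, h₂, rfl, hs₁, hs₂⟩ := List.sublist_append_iff.mp hs₁₂
    have l₁ := hs₁.length_le
    have l₂ := hs₂.length_le
    have l₃ := hs₃.length_le
    simp only [rowWord_length, List.length_replicate] at l₁ l₂ l₃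
    obtain ⟨b, hb, rfl⟩ := List.sublist_replicate_iff.mp hs₂
    simp only [List.length_append, List.length_replicate]
    cases h₃ with
    | nil => simp; omega
    | cons x h₃ =>
      have hx : x < k.rev.val := by
        have := hw' x (hs₃.subset (by simp))
        rw [Fin.val_rev] at this ⊢
        have := k'.2
        omega
      -- A hook that enters the next row meets a letter smaller than `m = k.rev`. So it uses at most
      -- one letter `m` of the run, and if it uses one, nothing can precede that `m`, because
      -- letters there would have to exceed `m`. In both cases its length is within the bound, by
      -- `ha`.
      by_cases hb1 : b ≤ 1
      · by_cases hb0 : b = 0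
        · simp only [List.length_cons] at l₃ ⊢
          omega
        · have hb1 : b = 1 := by omega
          subst hb1
          simp only [List.replicate_one, List.append_assoc, List.singleton_append] at hh
          have := RevHook.lt_of_mem (l₁ := h₁) (l₂ := []) (y := k.rev.val) hh hx
          cases h₁ with
          | nil => simp only [List.length_cons, List.length_nil] at l₃ ⊢; omega
          | cons z h₁ =>
            have h₅ := this z (by simp)
            have h₆ := hwk z (List.mem_append_left _ (hs₁.subset (by simp)))
            omega
      · obtain ⟨b, rfl⟩ := Nat.exists_eq_add_of_le' (show 2 ≤ b by omega)
        rw [List.replicate_succ, List.replicate_succ'] at hh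
        have := RevHook.lt_of_mem (l₁ := h₁ ++ k.rev.val :: List.replicate b k.rev.val)
          (y := k.rev.val) (l₂ := []) (x := x) (l₃ := h₃) (by simpa using hh) hx k.rev.val (by simp)
        omega

/-! ### Connectedness of the crystal of tableaux -/

/-- The element of lowest weight. -/
def lowestSDT {n : ℕ} (lam : Fin n → ℕ) (hlam : StrictAnti lam) : SDT lam :=
  ⟨fun k => List.replicate (lam k) k.rev, isDecomposition_of_replicate lam (fun _ => [])
    (by simp) (fun _ => ⟨[], [], rfl, by simp, by simp⟩) (by simp) (fun k k' hk => by
      have := hlam (show k < k' by rw [Fin.lt_def]; omega)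
      rw [List.length_replicate]; omega), by simp⟩

/-- Proceed from the top row down. In row `k`, let `x` be the first letter read that differs from
`k.rev`; it is smaller. The rows above do not contribute to `dif x`, so strictness at `x` requires
at least two letters `k.rev` read before it in this row, and then the row is not a hook word. -/
theorem eq_lowestSDT {n : ℕ} {lam : Fin n → ℕ} (hlam : StrictAnti lam) (S : SDT lam)
    (h : ∀ l, l + 1 < n → StrictLattice l (word S.1)) : S = lowestSDT lam hlam := by
  have key : ∀ m : ℕ, ∀ k : Fin n, k.1 = m → ∀ a ∈ S.1 k, a = k.rev := by
    intro m
    induction m using Nat.strong_induction_on with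
    | _ m ih =>
      intro k hk
      by_contra hcon
      have hex : ∃ t x R, rowWord (S.1 k) = List.replicate t k.rev.val ++ x :: R ∧
          x ≠ k.rev.val := by
        have hne : ¬ ∀ x ∈ rowWord (S.1 k), x = k.rev.val := by
          intro hall
          refine hcon fun a ha => Fin.ext (hall _ (mem_rowWord.mpr ⟨a, ha, rfl⟩))
        generalize rowWord (S.1 k) = w at hne
        induction w with
        | nil => simp at hne
        | cons y w ihw =>
          by_cases hy : y = k.rev.val
          · obtain ⟨t, x, R, rfl, hx⟩ := ihw fun hall => hne fun x hx => by
              rcases List.mem_cons.mp hx with rfl | hx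
              · exact hy
              · exact hall x hx
            exact ⟨t + 1, x, R, by simp [hy, List.replicate_succ], hx⟩
          · exact ⟨0, y, w, rfl, hy⟩
      obtain ⟨t, x, R, hw, hx⟩ := hex
      have hxm : x < k.rev.val := by
        have : x ∈ rowWord (S.1 k) := by rw [hw]; simp
        obtain ⟨a, ha, rfl⟩ := mem_rowWord.mp this
        have := S.2.1.add_lt k a ha
        rw [Fin.val_rev] at hx ⊢
        omega
      have hup : ∀ y ∈ upWord S.1 k, k.rev.val < y := by
        intro y hy
        obtain ⟨j, hj, hy⟩ := List.mem_flatMap.mp hy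
        rw [mem_take_finRange] at hj
        obtain ⟨a, ha, rfl⟩ := mem_rowWord.mp hy
        rw [ih j.1 (by rw [← hk]; exact hj) j rfl a ha, Fin.val_rev, Fin.val_rev]
        rw [Fin.lt_def] at hj
        omega
      have hn : x + 1 < n := by have := k.rev.2; omega
      have hs := h x hn (upWord S.1 k ++ List.replicate t k.rev.val ++ [x])
        (R ++ lowWord S.1 k) (by rw [word_eq S.1 k, hw]; simp) (by simp)
      rw [word_eq S.1 k, hw] at hs
      have hd : dif x (upWord S.1 k ++ (List.replicate t k.rev.val ++ x :: R) ++ lowWord S.1 k) =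
          dif x (upWord S.1 k) + dif x (List.replicate t k.rev.val) + dif x [x] +
            dif x (R ++ lowWord S.1 k) := by
        rw [← dif_append, ← dif_append, ← dif_append]
        simp
      rw [hd, dif_of_forall_ne (w := upWord S.1 k) (fun y hy => by have := hup y hy; omega),
        dif_cons, dif_nil] at hs
      simp only [dif, List.count_replicate, beq_iff_eq] at hs
      -- The `x` itself counts -1, and the excess of this beginning must be positive.
      have ht : 2 ≤ t := by
        split_ifs at hs <;> simp at hs <;> omega
      obtain ⟨t, rfl⟩ := Nat.exists_eq_add_of_le' ht
      have hh := ((isDecomposition_iff _).mp S.2.1).1 k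
      rw [hw, List.replicate_succ, List.replicate_succ'] at hh
      have := RevHook.lt_of_mem (l₁ := k.rev.val :: List.replicate t k.rev.val)
          (y := k.rev.val) (l₂ := []) (x := x) (l₃ := R) (by simpa using hh) hxm k.rev.val (by simp)
      omega
  apply Subtype.ext
  funext k
  change S.1 k = List.replicate (lam k) k.rev
  rw [List.eq_replicate_iff]
  exact ⟨S.2.2 k, key _ k rfl⟩

variable {n : ℕ} [n.AtLeastTwo]

theorem step_symm {B : Type*} {X : CrystalData n B} (hX : IsQCrystal X) {b b' : B}
    (h : X.Step b b') : X.Step b' b := by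
  obtain ⟨i, h | h⟩ := h
  · exact ⟨i, Or.inr ((hX.f_iff_e _ _ _).mpr h)⟩
  · exact ⟨i, Or.inl ((hX.f_iff_e _ _ _).mp h)⟩

theorem generated_symm {B : Type*} {X : CrystalData n B} (hX : IsQCrystal X) {b b' : B}
    (h : X.Generated b b') : X.Generated b' b := by
  induction h with
  | refl => exact Relation.ReflTransGen.refl
  | tail _ h ih => exact Relation.ReflTransGen.head (step_symm hX h) ih

theorem exists_generated_of_connLe {lam : Fin n → ℕ} {m : ℕ} (hm : m + 1 < n) (S : SDT lam)
    {w : List ℕ} (h : ConnLe m (word S.1) w) :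
    ∃ S', word S'.1 = w ∧ (sdtCrystal lam).Generated S S' := by
  induction h with
  | refl => exact ⟨S, rfl, Relation.ReflTransGen.refl⟩
  | tail _ h ih =>
    obtain ⟨S₁, rfl, hg⟩ := ih
    rcases h with ⟨i, hi, h | h⟩ | h | h
    · have h' : Arr (.num ⟨i, by omega⟩ : QIndex n) (word S₁.1) _ := h
      obtain ⟨S', rfl⟩ := exists_sdt_f h'
      exact ⟨S', rfl, hg.tail ⟨_, Or.inr (sdtCrystal_f.mpr h')⟩⟩
    · have h' : Arr (.num ⟨i, by omega⟩ : QIndex n) _ (word S₁.1) := h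
      obtain ⟨S', rfl⟩ := exists_sdt_e h'
      exact ⟨S', rfl, hg.tail ⟨_, Or.inl (sdtCrystal_e.mpr h')⟩⟩
    · have h' : Arr (.bar : QIndex n) (word S₁.1) _ := h
      obtain ⟨S', rfl⟩ := exists_sdt_f h'
      exact ⟨S', rfl, hg.tail ⟨_, Or.inr (sdtCrystal_f.mpr h')⟩⟩
    · have h' : Arr (.bar : QIndex n) _ (word S₁.1) := h
      obtain ⟨S', rfl⟩ := exists_sdt_e h'
      exact ⟨S', rfl, hg.tail ⟨_, Or.inl (sdtCrystal_e.mpr h')⟩⟩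

/-- A word that fails to be a strict lattice word is connected to a word of lower weight. -/
theorem exists_conn_sum {m : ℕ} {w : List ℕ} (h : ∃ l ≤ m, ¬ StrictLattice l w) :
    ∃ w', ConnLe m w w' ∧ w'.sum = w.sum + 1 := by
  have sum_of_count : ∀ {i : ℕ} {r r' : List ℕ}, (r'.count i : ℤ) = r.count i - 1 →
      (r'.count (i + 1) : ℤ) = r.count (i + 1) + 1 →
      (∀ j, j ≠ i → j ≠ i + 1 → r'.count j = r.count j) → r'.sum = r.sum + 1 := by
    intro i r r' h₁ h₂ h₃
    have : (i :: r').Perm ((i + 1) :: r) := by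
      rw [List.perm_iff_count]
      intro j
      rw [List.count_cons, List.count_cons]
      simp only [beq_iff_eq]
      by_cases hj : j = i
      · subst hj
        simp
        omega
      · by_cases hj' : j = i + 1
        · subst hj'
          simp
          omega
        · rw [h₃ j hj hj']
          split_ifs <;> omega
    have := this.sum_eq
    simp at this
    omega
  -- A single `f_l` suffices when one applies. Otherwise take the smallest index `i` at which
  -- strictness fails.
  by_cases hp : ∃ l ≤ m, 0 < phi l w
  · obtain ⟨l, hl, hp⟩ := hp
    obtain ⟨w', hc, a, b, c⟩ := exists_f_pow hl 1 (w := w) (by push_cast; omega)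
    exact ⟨w', hc, sum_of_count (by simpa using a) (by simpa using b) c⟩
  · classical
    push Not at hp
    have hmin : ∀ {l}, l < Nat.find h → ¬ (l ≤ m ∧ ¬ StrictLattice l w) :=
      fun hl => Nat.find_min h hl
    obtain ⟨him, hi⟩ := Nat.find_spec h
    generalize Nat.find h = i at hmin him hi
    have hS : ∀ l < i, StrictLattice l w := fun l hl => by
      by_contra hcon
      exact hmin hl ⟨by omega, hcon⟩
    have hphi : phi i w = 0 := le_antisymm (hp i him) (phi_nonneg i w)
    rw [StrictLattice] at hi
    push Not at hi
    obtain ⟨s, t, rfl, hmem, hd⟩ := hi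
    obtain ⟨pre, x, s₂, rfl, hpre, hx⟩ : ∃ pre x s₂, s = pre ++ x :: s₂ ∧
        (∀ y ∈ pre, y ≠ i ∧ y ≠ i + 1) ∧ (x = i ∨ x = i + 1) := by
      clear hd hphi hS hp hmin h
      induction s with
      | nil => simp at hmem
      | cons y s ih =>
        by_cases hy : y = i ∨ y = i + 1
        · exact ⟨[], y, s, rfl, by simp, hy⟩
        · push Not at hy
          obtain ⟨pre, x, s₂, rfl, h₁, h₂⟩ := ih (by
            rcases hmem with hmem | hmem
            · exact Or.inl ((List.mem_cons.mp hmem).resolve_left (Ne.symm hy.1))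
            · exact Or.inr ((List.mem_cons.mp hmem).resolve_left (Ne.symm hy.2)))
          refine ⟨y :: pre, x, s₂, rfl, fun z hz => ?_, h₂⟩
          rcases List.mem_cons.mp hz with rfl | hz
          · exact hy
          · exact h₁ z hz
    have hw : pre ++ x :: s₂ ++ t = pre ++ x :: (s₂ ++ t) := by simp
    rw [hw] at hd hphi hS hp ⊢
    have e₁ := dif_of_forall_ne hpre
    have e₂ := eps_of_forall_ne hpre
    have e₃ := dif_append i pre (x :: (s₂ ++ t))
    have e₄ := eps_append i pre (x :: (s₂ ++ t))
    have e₅ := dif_le_eps i (x :: (s₂ ++ t))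
    have e₆ := dif_cons i x (s₂ ++ t)
    have e₇ := dif_le_eps i (s₂ ++ t)
    have e₈ := eps_le_eps_cons i x (s₂ ++ t)
    have e₉ := dif_tail_le_eps i s₂ t
    have ph : ∀ v, phi i v = eps i v - dif i v := fun _ => rfl
    rw [ph] at hphi
    -- A leading `i` would be unmatched, against `phi i = 0`. The failure of strictness then shows
    -- that this first `i + 1` is matched later on.
    have hxi : x = i + 1 := by
      rcases hx with rfl | hx
      · rw [if_neg (by omega), if_pos rfl] at e₆
        omega
      · exact hx
    subst hxi
    rw [if_pos rfl, if_neg (by omega)] at e₆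
    -- Descending from `i`: if `l + 1` is missing from `pre`, strictness at `l` excludes `l` as
    -- well. So `pre` only contains letters above `i + 1`, which operators of index at most `i`
    -- ignore.
    have hbig : ∀ d l : ℕ, l + d = i → l ∉ pre := by
      intro d
      induction d with
      | zero =>
        rintro l rfl hl
        exact (hpre l hl).1 rfl
      | succ d ihd =>
        intro l hl hmem
        have h₁ := ihd (l + 1) (by omega)
        have h₂ := hS l (by omega) pre _ rfl (Or.inl hmem)
        have h₃ : dif l pre ≤ 0 := by
          rw [dif, List.count_eq_zero.mpr h₁]
          omega
        rw [dif_append] at h₂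
        omega
    have hlarge : ∀ y ∈ pre, i + 1 < y := by
      intro y hy
      by_contra hcon
      have := hpre y hy
      exact hbig (i - y) y (by omega) hy
    obtain ⟨r, hc, a, b, c⟩ := exists_lower i (s₂ ++ t) (by rw [ph]; omega)
      (by rw [ph]; omega) (fun l hl s' t' hst hm => by
        have h₁ := hS l hl (pre ++ s') t' (by rw [hst]; simp)
          (by rcases hm with hm | hm <;> simp [hm])
        rw [dif_append, dif_of_forall_ne (w := pre) (fun y hy => by
          have := hlarge y hy; omega)] at h₁
        omega)
    refine ⟨pre ++ r, (ConnLe.append_left hlarge hc).mono him, ?_⟩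
    rw [List.sum_append, List.sum_append, sum_of_count a b c]
    ring

/-- The sum of the letters is bounded on SDT(λ), and each lowering raises it by 1, so the process
ends at a strict lattice word. -/
theorem generated_lowestSDT {lam : Fin n → ℕ} (hlam : StrictAnti lam) (S : SDT lam) :
    (sdtCrystal lam).Generated (lowestSDT lam hlam) S := by
  apply generated_symm (isQCrystal_sdtCrystal lam)
  have hn := (Nat.AtLeastTwo.prop : 2 ≤ n)
  have hbound : ∀ S : SDT lam, (word S.1).sum ≤ (∑ k, lam k) * n := by
    intro S
    have hl : (word S.1).length = ∑ k, lam k := by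
      rw [word_eq_flatMap, List.length_flatMap, Fin.sum_univ_def]
      simp only [rowWord_length, S.2.2]
    rw [← hl, ← smul_eq_mul]
    refine List.sum_le_card_nsmul _ _ fun x hx => ?_
    obtain ⟨y, -, rfl⟩ := List.mem_map.mp hx
    exact y.letter.2.le
  obtain ⟨N, hN⟩ : ∃ N, (∑ k, lam k) * n - (word S.1).sum = N := ⟨_, rfl⟩
  induction N using Nat.strong_induction_on generalizing S with
  | _ N ih =>
    by_cases h : ∃ l ≤ n - 2, ¬ StrictLattice l (word S.1)
    · obtain ⟨w', hc, hs⟩ := exists_conn_sum h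
      obtain ⟨S', rfl, hg⟩ := exists_generated_of_connLe (by omega) S hc
      have := hbound S'
      exact hg.trans (ih _ (by omega) S' rfl)
    · push Not at h
      rw [eq_lowestSDT hlam S fun l hl => h l (by omega)]
      exact Relation.ReflTransGen.refl

end QueerCrystal

namespace QueerCrystal

/-! ### Leading runs and cores -/

section Refill

variable {n : ℕ}

/-- Put `a k` letters `k.rev` in front of row `k`. -/
def refill (a : Fin n → ℕ) (c : Tableau n) : Tableau n := fun k => List.replicate (a k) k.rev ++ c k

/-- Remove the leading letters `k.rev` from row `k`. -/
def core (T : Tableau n) : Tableau n := fun k => (T k).dropWhile fun a => a = k.rev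

/-- The lengths of the leading runs of the dual marginally large tableau with a given core. -/
def fillLength (c : Tableau n) (k : Fin n) : ℕ := 1 + ∑ j ∈ Finset.Ioi k, ((c j).length + 1)

/-- No row `k` starts with `k.rev`. -/
def IsCore (c : Tableau n) : Prop := ∀ k, (c k).head? ≠ some k.rev

theorem dropWhile_replicate_append {α : Type*} [DecidableEq α] {m : α} {l : List α} (a : ℕ)
    (h : l.head? ≠ some m) : (List.replicate a m ++ l).dropWhile (fun x => x = m) = l := by
  induction a with
  | zero =>
    cases l with
    | nil => rfl
    | cons x l =>
      have : x ≠ m := by simpa using h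
      simp [this]
  | succ a ih => simp only [List.replicate_succ, List.cons_append, List.dropWhile_cons, decide_true, if_true, ih]

theorem takeWhile_replicate_append {α : Type*} [DecidableEq α] {m : α} {l : List α} (a : ℕ)
    (h : l.head? ≠ some m) :
    (List.replicate a m ++ l).takeWhile (fun x => x = m) = List.replicate a m := by
  induction a with
  | zero =>
    cases l with
    | nil => rfl
    | cons x l =>
      have : x ≠ m := by simpa using h
      simp [this]
  | succ a ih => simp only [List.replicate_succ, List.cons_append, List.takeWhile_cons, decide_true, if_true, ih]

theorem exists_eq_replicate_append {α : Type*} [DecidableEq α] (m : α) (l : List α) :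
    ∃ y, l = List.replicate y m ++ l.dropWhile (fun x => x = m) ∧
      (l.dropWhile fun x => x = m).head? ≠ some m := by
  induction l with
  | nil => exact ⟨0, by simp⟩
  | cons x l ih =>
    by_cases hx : x = m
    · obtain ⟨y, h₁, h₂⟩ := ih
      subst hx
      refine ⟨y + 1, ?_, by simpa using h₂⟩
      simpa [List.replicate_succ] using h₁
    · exact ⟨0, by simp [hx]⟩

theorem core_refill {c : Tableau n} (hc : IsCore c) (a : Fin n → ℕ) : core (refill a c) = c :=
  funext fun k => dropWhile_replicate_append (a k) (hc k)

theorem isCore_core (T : Tableau n) : IsCore (core T) := fun k =>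
  (exists_eq_replicate_append k.rev (T k)).choose_spec.2

theorem exists_refill_core (T : Tableau n) : ∃ a, T = refill a (core T) :=
  ⟨fun k => (exists_eq_replicate_append k.rev (T k)).choose,
    funext fun k => (exists_eq_replicate_append k.rev (T k)).choose_spec.1⟩

theorem mem_of_mem_core {T : Tableau n} {k : Fin n} {x : Fin n} (h : x ∈ core T k) : x ∈ T k :=
  (List.dropWhile_sublist _).subset h

theorem fillLength_eq (c : Tableau n) {k k' : Fin n} (h : k'.val = k.val + 1) :
    fillLength c k = fillLength c k' + (c k').length + 1 := by
  have : Finset.Ioi k = insert k' (Finset.Ioi k') := by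
    ext j
    simp only [Finset.mem_Ioi, Finset.mem_insert, Fin.lt_def, Fin.ext_iff]
    omega
  rw [fillLength, this, Finset.sum_insert (by simp), fillLength]
  ring

theorem fillLength_pos (c : Tableau n) (k : Fin n) : 0 < fillLength c k := by
  rw [fillLength]
  omega

theorem rowLength_refill (a : Fin n → ℕ) (c : Tableau n) {k k' : Fin n} (h : k'.val = k.val + 1) :
    rowLength (refill a c) (k.val + 1) = a k' + (c k').length := by
  have : (⟨k.val + 1, h ▸ k'.2⟩ : Fin n) = k' := Fin.ext h.symm
  rw [rowLength, dif_pos (h ▸ k'.2), this, refill]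
  simp

theorem fillLength_eq_rowLength (c : Tableau n) (k : Fin n) :
    fillLength c k = rowLength (refill (fillLength c) c) (k.val + 1) + 1 := by
  by_cases h : k.val + 1 < n
  · rw [rowLength_refill _ _ (k' := ⟨k.val + 1, h⟩) rfl, ← fillLength_eq c rfl]
  · have : Finset.Ioi k = ∅ := by
      ext j
      simp only [Finset.mem_Ioi, Fin.lt_def, Finset.notMem_empty, iff_false]
      omega
    rw [rowLength, dif_neg h, fillLength, this]
    simp

theorem dualMarginallyLarge_refill {c : Tableau n} (hc : IsCore c) :
    DualMarginallyLarge (refill (fillLength c) c) := fun k => by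
  rw [refill, takeWhile_replicate_append _ (hc k), List.length_replicate]
  exact fillLength_eq_rowLength c k

theorem IsDecomposition.le_rev {T : Tableau n} (hT : IsDecomposition T) (k : Fin n) :
    ∀ x ∈ T k, x ≤ k.rev := fun x hx => by
  have := hT.add_lt k x hx
  rw [Fin.le_def, Fin.val_rev]
  omega

theorem isDecomposition_refill {T : Tableau n} (hT : IsDecomposition T) :
    IsDecomposition (refill (fillLength (core T)) (core T)) := by
  refine isDecomposition_of_replicate _ (core T) (fun k => rfl) (fun k => ?_)
    (fun k a ha => hT.le_rev k a (mem_of_mem_core ha)) fun k k' h => ?_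
  · exact (((isDecomposition_iff T).mp hT).1 k).sublist
      (List.reverse_sublist.mpr ((List.dropWhile_sublist _).map _))
  · rw [refill, List.length_append, List.length_replicate, fillLength_eq _ h]

/-- The dual marginally large tableau with the same core. -/
def enlarge (T : Tableau n) : Tableau n := refill (fillLength (core T)) (core T)

/-- The embedding of the tableaux of a given shape into the limit. -/
def toInf {lam : Fin n → ℕ} (S : SDT lam) : SDTInf n :=
  ⟨enlarge S.1, isDecomposition_refill S.2.1, dualMarginallyLarge_refill (isCore_core _)⟩

/-- The core forgets only the run lengths, and these are fixed by the prescribed row lengths. -/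
theorem toInf_injective {lam : Fin n → ℕ} : Function.Injective (toInf (lam := lam)) := by
  intro S S' h
  have hc : core S.1 = core S'.1 := by
    have := congrArg (fun T => core T.1) h
    simpa only [toInf, enlarge, core_refill (isCore_core _)] using this
  apply Subtype.ext
  obtain ⟨a, ha⟩ := exists_refill_core S.1
  obtain ⟨b, hb⟩ := exists_refill_core S'.1
  funext k
  have h₁ := S.2.2 k
  have h₂ := S'.2.2 k
  rw [ha, refill, List.length_append, List.length_replicate] at h₁
  rw [hb, refill, List.length_append, List.length_replicate, ← hc] at h₂
  rw [ha, hb, refill, refill, hc, show a k = b k by omega]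

theorem toInf_lowestSDT {lam : Fin n → ℕ} (hlam : StrictAnti lam) :
    toInf (lowestSDT lam hlam) = lowestInf n := by
  apply Subtype.ext
  have hc : core (lowestSDT lam hlam).1 = fun _ => [] := by
    have : (lowestSDT lam hlam).1 = refill lam fun _ => [] := by
      funext k
      simp [lowestSDT, refill]
    rw [this, core_refill]
    intro k
    simp
  change enlarge _ = lowestTableau n
  funext k
  rw [enlarge, hc, refill, lowestTableau, fillLength, List.append_nil]
  congr 1
  simp
  have := k.2
  omega

theorem content_refill (a : Fin n → ℕ) (c : Tableau n) (j : Fin n) :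
    content (refill a c) j = a j.rev + content c j := by
  simp only [content, refill, List.count_append, List.count_replicate, Nat.cast_add,
    Finset.sum_add_distrib]
  congr 1
  rw [Finset.sum_eq_single j.rev]
  · simp
  · intro k _ hk
    rw [if_neg]
    · rfl
    · intro h
      rw [beq_iff_eq] at h
      exact hk (by rw [← h, Fin.rev_rev])
  · simp

/-- Lengthening the run of row `j.rev` adds the same amount to the number of letters `j` and to the
length of that row. -/
theorem content_toInf {lam : Fin n → ℕ} (S : SDT lam) (k : ℤ) (j : Fin n) :
    content S.1 j = content (toInf S).1 j + shapeShift (toInf S).1 j + muWeight lam k j + k := by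
  obtain ⟨a, ha⟩ := exists_refill_core S.1
  have h := S.2.2 j.rev
  have h₁ : content S.1 j = a j.rev + content (core S.1) j := by
    conv_lhs => rw [ha]
    exact content_refill _ _ _
  rw [ha, refill, List.length_append, List.length_replicate] at h
  change content S.1 j = content (refill (fillLength (core S.1)) (core S.1)) j +
    -((refill (fillLength (core S.1)) (core S.1) j.rev).length : ℤ) + ((lam j.rev : ℤ) - k) + k
  rw [h₁, content_refill, refill, List.length_append, List.length_replicate]
  push_cast
  omega

end Refill

end QueerCrystal

namespace QueerCrystal

/-! ### Transfer of the operators to the limit -/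

section Signature

variable {n : ℕ}

theorem sig_of_le {i : ℕ} {w : List ℕ} (h : ∀ x ∈ w, x ≤ i) :
    sig i w = List.replicate (w.count i) i := by
  rw [sig, ← List.filter_beq]
  apply List.filter_congr
  intro x hx
  have := h x hx
  rw [Bool.eq_iff_iff, decide_eq_true_iff, beq_iff_eq]
  omega

theorem phi_hi_lo (i x y : ℕ) :
    phi i (List.replicate x (i + 1) ++ List.replicate y i) = max ((y : ℤ) - x) 0 := by
  have e₁ : eps i (List.replicate x (i + 1)) = x ∧ dif i (List.replicate x (i + 1)) = x := by
    induction x with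
    | zero => simp
    | succ x ih =>
      rw [List.replicate_succ, eps_cons, dif_cons, ih.1, ih.2]
      simp
  have e₂ : eps i (List.replicate y i) = 0 ∧ dif i (List.replicate y i) = -y := by
    induction y with
    | zero => simp
    | succ y ih =>
      rw [List.replicate_succ, eps_cons, dif_cons, ih.1, ih.2]
      simp
      omega
  rw [phi, eps_append, dif_append, e₁.1, e₁.2, e₂.1, e₂.2]
  omega

theorem sig_upWord_refill (i : I0 n) (a : Fin n → ℕ) (c : Tableau n) {k : Fin n}
    (hk : i.hi ≤ k.rev) : sig i.1 (upWord (refill a c) k) = sig i.1 (upWord c k) := by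
  rw [upWord, upWord, sig, sig, List.filter_flatMap, List.filter_flatMap]
  refine List.flatMap_congr fun j hj => ?_
  rw [mem_take_finRange] at hj
  change sig i.1 (rowWord (refill a c j)) = sig i.1 (rowWord (c j))
  rw [refill, rowWord_append, sig_append, rowWord_replicate, sig_eq_nil (w := List.replicate _ _),
    List.append_nil]
  intro x hx
  rw [List.eq_of_mem_replicate hx]
  rw [Fin.lt_def] at hj
  rw [Fin.le_def, Fin.val_rev, I0.hi] at hk
  rw [Fin.val_rev]
  simp only at hk
  omega

/-- The signature of the rows below row `k`, as a function of the lengths of the leading runs. -/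
theorem exists_sig_lowWord (i : I0 n) {c : Tableau n} (hc : ∀ k, ∀ x ∈ c k, x ≤ k.rev)
    {k : Fin n} (hk : i.hi ≤ k.rev) : ∃ N, ∀ a : Fin n → ℕ,
      sig i.1 (List.replicate (a k) k.rev.val ++ lowWord (refill a c) k) =
        N ++ (List.replicate (a i.hi.rev) (i.1 + 1) ++
          List.replicate (a i.lo.rev + (c i.lo.rev).count i.lo) i.1) := by
  obtain ⟨d, hd⟩ : ∃ d, k.val + d = i.hi.rev.val := by
    refine ⟨i.hi.rev.val - k.val, ?_⟩
    rw [Fin.le_def, Fin.val_rev] at hk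
    rw [Fin.val_rev]
    have := i.hi.2
    omega
  -- Here `d` counts the rows between `k` and the row whose run consists of letters `i + 1`. Runs
  -- above that row have larger letters; below the row with run `i`, all letters are smaller than
  -- `i`.
  induction d generalizing k with
  | zero =>
    obtain rfl : k = i.hi.rev := Fin.ext (by omega)
    refine ⟨[], fun a => ?_⟩
    have hr : i.lo.rev.val = i.hi.rev.val + 1 := by
      have := i.2
      rw [Fin.val_rev, Fin.val_rev, I0.lo, I0.hi]
      simp only
      omega
    have h₁ : sig i.1 (rowWord (c i.lo.rev)) =
        List.replicate ((c i.lo.rev).count i.lo) i.1 := by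
      rw [sig_of_le, ← count_rowWord]
      · rfl
      · intro x hx
        obtain ⟨y, hy, rfl⟩ := mem_rowWord.mp hx
        have := hc _ y hy
        rwa [Fin.rev_rev] at this
    have h₂ : sig i.1 (lowWord (refill a c) i.lo.rev) = [] := by
      apply sig_eq_nil
      intro x hx
      obtain ⟨j, hj, hx⟩ := List.mem_flatMap.mp hx
      rw [mem_drop_finRange, Fin.lt_def, Fin.val_rev, I0.lo] at hj
      obtain ⟨y, hy, rfl⟩ := mem_rowWord.mp hx
      have hyj : y ≤ j.rev := by
        rcases List.mem_append.mp hy with hy | hy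
        · exact (List.eq_of_mem_replicate hy).le
        · exact hc j y hy
      rw [Fin.le_def, Fin.val_rev] at hyj
      have := j.2
      have := i.2
      simp only at hj
      omega
    rw [lowWord_eq _ hr, sig_append, sig_append, h₂, refill, rowWord_append, sig_append, h₁,
      rowWord_replicate, Fin.rev_rev, Fin.rev_rev, List.append_nil, List.nil_append,
      show i.hi.val = i.1 + 1 from rfl, show i.lo.val = i.1 from rfl,
      sig, List.filter_eq_self.mpr, sig, List.filter_eq_self.mpr, ← List.replicate_add,
      add_comm (a i.lo.rev)]
    · intro x hx
      simp [List.eq_of_mem_replicate hx]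
    · intro x hx
      simp [List.eq_of_mem_replicate hx]
  | succ d ih =>
    have hk' : k.val + 1 < n := by
      have := i.hi.rev.2
      omega
    have hhi : i.hi ≤ (⟨k.val + 1, hk'⟩ : Fin n).rev := by
      rw [Fin.le_rev_iff, Fin.le_def]
      simp only
      omega
    obtain ⟨N, hN⟩ := ih (k := ⟨k.val + 1, hk'⟩) hhi (by simp only; omega)
    refine ⟨sig i.1 (rowWord (c ⟨k.val + 1, hk'⟩)) ++ N, fun a => ?_⟩
    rw [lowWord_eq (k' := ⟨k.val + 1, hk'⟩) _ rfl, sig_append, sig_eq_nil (w := List.replicate _ _),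
      List.nil_append, refill, rowWord_append, List.append_assoc, sig_append, rowWord_replicate,
      hN a, List.append_assoc]
    intro x hx
    rw [List.eq_of_mem_replicate hx]
    rw [Fin.le_def, Fin.val_rev, I0.hi] at hhi
    rw [Fin.val_rev]
    simp only at hhi
    omega

theorem word_eq_lowWord (T : Tableau n) {k : Fin n} (hk : k.val = 0) :
    word T = rowWord (T k) ++ lowWord T k := by
  rw [word_eq T k, upWord, hk]
  simp

theorem exists_sig_word (i : I0 n) {c : Tableau n} (hc : ∀ k, ∀ x ∈ c k, x ≤ k.rev) :
    ∃ M, ∀ a : Fin n → ℕ, sig i.1 (word (refill a c)) =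
      M ++ (List.replicate (a i.hi.rev) (i.1 + 1) ++
        List.replicate (a i.lo.rev + (c i.lo.rev).count i.lo) i.1) := by
  have hn : 0 < n := Nat.zero_lt_of_lt i.2
  obtain ⟨N, hN⟩ := exists_sig_lowWord i hc (k := ⟨0, hn⟩) (by
    rw [Fin.le_rev_iff, Fin.le_def]
    simp)
  refine ⟨sig i.1 (rowWord (c ⟨0, hn⟩)) ++ N, fun a => ?_⟩
  rw [word_eq_lowWord _ (k := ⟨0, hn⟩) rfl, refill, rowWord_append, List.append_assoc, sig_append,
    rowWord_replicate, hN a, List.append_assoc]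

/-- The leading runs are long enough not to influence the signature. -/
def Ample (a : Fin n → ℕ) (c : Tableau n) : Prop :=
  ∀ k k' : Fin n, k'.val = k.val + 1 → a k' + (c k').length ≤ a k

theorem Ample.phi_eq_zero {a : Fin n → ℕ} {c : Tableau n} (h : Ample a c) (i : I0 n) :
    phi i.1 (List.replicate (a i.hi.rev) (i.1 + 1) ++
      List.replicate (a i.lo.rev + (c i.lo.rev).count i.lo) i.1) = 0 := by
  have h₁ := h i.hi.rev i.lo.rev (by
    have := i.2
    rw [Fin.val_rev, Fin.val_rev, I0.lo, I0.hi]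
    simp only
    omega)
  have h₂ : (c i.lo.rev).count i.lo ≤ (c i.lo.rev).length := List.count_le_length
  rw [phi_hi_lo]
  omega

/-- Runs in the rows above `k` have letters too large to matter. After the changed letter, the runs
matter only through the final block of the signature, and for an ample `a` this block has no
unmatched `i`. The old run lengths `p` are arbitrary. -/
theorem sideCond_refill {q : QIndex n} [n.AtLeastTwo] {c : Tableau n} (hc : ∀ k, ∀ x ∈ c k, x ≤ k.rev)
    {p a : Fin n → ℕ} (ha : Ample a c) {k : Fin n} (hk : q.base.hi ≤ k.rev) {b l : List (Fin n)}
    (h : SideCond q (upWord (refill p c) k ++ rowWord l)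
      (rowWord b ++ (List.replicate (p k) k.rev.val ++ lowWord (refill p c) k))) :
    SideCond q (upWord (refill a c) k ++ rowWord l)
      (rowWord b ++ (List.replicate (a k) k.rev.val ++ lowWord (refill a c) k)) := by
  cases q with
  | num i =>
    obtain ⟨h₁, h₂⟩ := h
    change eps i.1 _ = 0 at h₁
    change phi i.1 _ = 0 at h₂
    obtain ⟨N, hN⟩ := exists_sig_lowWord i hc hk
    refine ⟨?_, ?_⟩
    · rw [← eps_sig, sig_append, sig_upWord_refill i _ _ hk] at h₁ ⊢
      exact h₁
    · rw [← phi_sig, sig_append, hN, ← List.append_assoc, phi_append] at h₂ ⊢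
      rw [ha.phi_eq_zero i]
      have := phi_nonneg i.1 (sig i.1 (rowWord b) ++ N)
      have := eps_nonneg i.1 (sig i.1 (rowWord b) ++ N)
      have : phi i.1 (sig i.1 (rowWord b) ++ N) = eps i.1 (sig i.1 (rowWord b) ++ N) -
        dif i.1 (sig i.1 (rowWord b) ++ N) := rfl
      omega
  | bar =>
    intro x hx
    rcases List.mem_append.mp hx with hx | hx
    · obtain ⟨j, hj, hx⟩ := List.mem_flatMap.mp hx
      obtain ⟨y, hy, rfl⟩ := mem_rowWord.mp hx
      rcases List.mem_append.mp hy with hy | hy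
      · rw [List.eq_of_mem_replicate hy]
        rw [mem_take_finRange, Fin.lt_def] at hj
        change (1 : ℕ) ≤ k.rev.val at hk
        rw [Fin.val_rev] at hk ⊢
        omega
      · exact h _ (List.mem_append_left _ (List.mem_flatMap.mpr
          ⟨j, hj, mem_rowWord.mpr ⟨y, List.mem_append_right _ hy, rfl⟩⟩))
    · exact h x (List.mem_append_right _ hx)

end Signature

variable {n : ℕ} [n.AtLeastTwo] {q : QIndex n}

theorem Arr.exists_row {T T' : Tableau n} (hs : SameShape T T') (h : Arr q (word T) (word T')) :
    ∃ k b c, T k = b ++ q.base.lo :: c ∧ T' = Function.update T k (b ++ q.base.hi :: c) ∧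
      SideCond q (upWord T k ++ rowWord c) (rowWord b ++ lowWord T k) := by
  obtain ⟨s, t, h₁, h₂, h₃⟩ := h
  obtain ⟨k, b, a, c, hk, ha, rfl, rfl⟩ := word_split h₁
  obtain rfl := letter_eq_lo.mpr ha
  refine ⟨k, b, c, hk, word_injective (fun j => ?_) ?_, h₃⟩
  · rw [hs j]
    by_cases hj : j = k
    · subst hj
      rw [Function.update_self, hk]
      simp
    · rw [Function.update_of_ne hj]
  · rw [h₂, word_update]
    simp [I0.hi]

theorem arr_update {T : Tableau n} {k : Fin n} {b c : List (Fin n)} (hk : T k = b ++ q.base.lo :: c)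
    (h : SideCond q (upWord T k ++ rowWord c) (rowWord b ++ lowWord T k)) :
    SameShape T (Function.update T k (b ++ q.base.hi :: c)) ∧
      Arr q (word T) (word (Function.update T k (b ++ q.base.hi :: c))) := by
  refine ⟨fun j => ?_, _, _, ?_, ?_, h⟩
  · by_cases hj : j = k
    · subst hj
      rw [Function.update_self, hk]
      simp
    · rw [Function.update_of_ne hj]
  · rw [word_eq T k, hk]
    simp [I0.lo]
  · rw [word_update]
    simp [I0.hi]

/-- An arrow changes a letter of the core. -/
theorem Arr.exists_core_row {T T' : Tableau n} (hT' : IsDecomposition T') (hT : IsDecomposition T)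
    (hs : SameShape T T') (h : Arr q (word T) (word T')) :
    ∃ k b c, q.base.hi ≤ k.rev ∧ core T k = b ++ q.base.lo :: c ∧
      (∀ a, Ample a (core T) →
        SideCond q (upWord (refill a (core T)) k ++ rowWord c)
          (rowWord b ++ (List.replicate (a k) k.rev.val ++ lowWord (refill a (core T)) k))) ∧
      (∀ p, T = refill p (core T) → SideCond q (upWord T k ++ rowWord c)
          (rowWord b ++ (List.replicate (p k) k.rev.val ++ lowWord T k))) ∧
      core T' = Function.update (core T) k
        (if b = [] ∧ q.base.hi = k.rev then c else b ++ q.base.hi :: c) ∧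
      (q.base.hi = k.rev → c.head? ≠ some k.rev) := by
  obtain ⟨k, b', c, hk, rfl, hc⟩ := h.exists_row hs
  -- The new letter must respect the row bound in `T'`. So the old letter is smaller than `k.rev`
  -- and cannot belong to the run.
  have hhi : q.base.hi ≤ k.rev := hT'.le_rev k _ (by rw [Function.update_self]; simp)
  have hlh : q.base.lo < q.base.hi := by
    rw [Fin.lt_def, I0.lo, I0.hi]
    simp
  obtain ⟨y, hy, hb⟩ := exists_eq_replicate_append k.rev b'
  generalize b'.dropWhile (fun x => x = k.rev) = b at hy hb
  have hcore : core T k = b ++ q.base.lo :: c := by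
    rw [core, hk, hy, List.append_assoc]
    apply dropWhile_replicate_append
    cases b with
    | nil => simpa using (hlh.trans_le hhi).ne
    | cons z b => simpa using hb
  -- A letter `k.rev` to the right of the changed box would be the last letter read before it: an
  -- unmatched `i + 1`, or for `1̄` a letter below 2, contrary to the side condition.
  have hhead : q.base.hi = k.rev → c.head? ≠ some k.rev := by
    intro he hcon
    cases c with
    | nil => simp at hcon
    | cons z c =>
      simp only [List.head?_cons, Option.some.injEq] at hcon
      rw [hcon, ← he, rowWord_cons] at hc
      cases q with
      | num i =>
        have h₁ : eps i.1 _ = 0 := hc.1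
        have h₂ := dif_tail_le_eps i.1 (upWord T k ++ rowWord c) [i.1 + 1]
        rw [List.append_assoc] at h₂
        have h₃ : (QIndex.num i).base.hi.val = i.1 + 1 := rfl
        rw [h₃] at h₁
        rw [h₁, dif_cons] at h₂
        simp at h₂
      | bar =>
        have := hc 1 (by simp [QIndex.base, I0.first, I0.hi])
        omega
  have hp : ∀ p, T = refill p (core T) → SideCond q (upWord T k ++ rowWord c)
          (rowWord b ++ (List.replicate (p k) k.rev.val ++ lowWord T k)) := by
    intro p hp
    have h₁ : T k = List.replicate (p k) k.rev ++ (b ++ q.base.lo :: c) := by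
      conv_lhs => rw [hp]
      rw [refill, hcore]
    have h₂ : y = p k := by
      rw [hk, hy, List.append_assoc] at h₁
      have := congrArg List.length h₁
      simp only [List.length_append, List.length_replicate] at this
      omega
    rw [hy, rowWord_append, rowWord_replicate, List.append_assoc, h₂] at hc
    exact hc
  refine ⟨k, b, c, hhi, hcore, fun a ha => ?_, hp, ?_, hhead⟩
  · obtain ⟨p, hp'⟩ := exists_refill_core T
    have := hp p hp'
    rw [hp'] at this
    exact sideCond_refill (fun k x hx => hT.le_rev k x (mem_of_mem_core hx)) ha hhi this
  · funext j
    by_cases hj : j = k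
    · subst hj
      rw [Function.update_self, core, Function.update_self, hy, List.append_assoc]
      split_ifs with h
      · rw [h.1, h.2, List.nil_append, ← List.singleton_append, ← List.append_assoc,
          ← List.replicate_succ' (n := y)]
        exact dropWhile_replicate_append _ (hhead h.2)
      · apply dropWhile_replicate_append
        cases b with
        | nil => simpa using fun h' => h ⟨rfl, h'⟩
        | cons z b => simpa using hb
    · rw [Function.update_of_ne hj, core, Function.update_of_ne hj, core]

theorem sdtInfCrystal_e {T T' : SDTInf n} {T₁ : Tableau n} (hs : SameShape T₁ T.1)
    (h : Arr q (word T₁) (word T.1)) (h₁ : DualMarginallyLarge T₁ → T₁ = T'.1)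
    (h₂ : ¬ DualMarginallyLarge T₁ → pushIn q.base T₁ = T'.1) :
    (sdtInfCrystal n).e q T = some T' := by
  classical
  obtain ⟨T', hT'⟩ := T'
  have h₃ : (if DualMarginallyLarge T₁ then T₁ else pushIn q.base T₁) = T' := by
    split_ifs with hd
    · exact h₁ hd
    · exact h₂ hd
  subst h₃
  change (changeE T.1 q).bind _ = _
  rw [changeE_eq_some_iff.mpr ⟨hs.symm, h⟩, Option.bind_some]
  exact dif_pos hT'

theorem sdtInfCrystal_f {T T' : SDTInf n} {T₁ : Tableau n} (hs : SameShape T.1 T₁)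
    (h : Arr q (word T.1) (word T₁)) (h₁ : DualMarginallyLarge T₁ → T₁ = T'.1)
    (h₂ : ¬ DualMarginallyLarge T₁ → pushOut q.base T₁ = T'.1) :
    (sdtInfCrystal n).f q T = some T' := by
  classical
  obtain ⟨T', hT'⟩ := T'
  have h₃ : (if DualMarginallyLarge T₁ then T₁ else pushOut q.base T₁) = T' := by
    split_ifs with hd
    · exact h₁ hd
    · exact h₂ hd
  subst h₃
  change (changeF T.1 q).bind _ = _
  rw [changeF_eq_some_iff.mpr ⟨hs, h⟩, Option.bind_some]
  exact dif_pos hT'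

end QueerCrystal

namespace QueerCrystal

/-! ### Compatibility of the embedding into the limit with arrows and string functions -/

section FillLength

variable {n : ℕ}

theorem fillLength_update (c : Tableau n) (k : Fin n) (u : List (Fin n)) (j : Fin n) :
    fillLength (Function.update c k u) j + (if j < k then (c k).length else 0) =
      fillLength c j + if j < k then u.length else 0 := by
  have h : ∀ x, (Function.update c k u x).length + 1 + (if x = k then (c k).length else 0) =
      (c x).length + 1 + if x = k then u.length else 0 := by
    intro x
    by_cases hx : x = k
    · subst hx
      rw [Function.update_self, if_pos rfl, if_pos rfl]
      ring
    · rw [Function.update_of_ne hx, if_neg hx, if_neg hx]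
  have := Finset.sum_congr (rfl : Finset.Ioi j = Finset.Ioi j) fun x _ => h x
  simp only [Finset.sum_add_distrib, Finset.sum_ite_eq', Finset.mem_Ioi] at this
  simp only [fillLength, Finset.sum_add_distrib]
  omega

theorem ample_fillLength (c : Tableau n) : Ample (fillLength c) c := fun k k' h => by
  rw [fillLength_eq c h]
  omega

theorem rowLength_congr {T T' : Tableau n} {k : Fin n} (h : ∀ j, k < j → (T' j).length = (T j).length) :
    rowLength T' (k.val + 1) = rowLength T (k.val + 1) := by
  unfold rowLength
  split_ifs with hk
  · exact h _ (Fin.lt_def.mpr (Nat.lt_succ_self _))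
  · rfl

theorem update_refill (a : Fin n → ℕ) (c : Tableau n) (k : Fin n) (u : List (Fin n)) :
    Function.update (refill a c) k (List.replicate (a k) k.rev ++ u) =
      refill a (Function.update c k u) := by
  funext j
  by_cases hj : j = k
  · subst hj
    rw [Function.update_self, refill, Function.update_self]
  · rw [Function.update_of_ne hj, refill, refill, Function.update_of_ne hj]

end FillLength

variable {n : ℕ} [n.AtLeastTwo] {q : QIndex n} {lam : Fin n → ℕ}

/-- The arrow changes a core letter and its side condition holds for any ample runs, so the same
change can be made in the limit. The result is again marginally large unless the new letter joins
the run of its row, and then pushing a column out or in restores the run lengths. -/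
theorem toInf_arr {S S' : SDT lam} (h : Arr q (word S.1) (word S'.1)) :
    (sdtInfCrystal n).f q (toInf S) = some (toInf S') ∧
      (sdtInfCrystal n).e q (toInf S') = some (toInf S) := by
  obtain ⟨k, b, c, hhi, hcore, hA, -, hcore', hhead⟩ :=
    h.exists_core_row S'.2.1 S.2.1 fun j => by rw [S.2.2, S'.2.2]
  have hC := isCore_core S.1
  have e₁ : (toInf S).1 = refill (fillLength (core S.1)) (core S.1) := rfl
  have e₂ : (toInf S').1 = refill (fillLength (core S'.1)) (core S'.1) := rfl
  rw [hcore'] at e₂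
  generalize core S.1 = C at *
  have hU : ∀ a, Ample a C →
      SameShape (refill a C) (refill a (Function.update C k (b ++ q.base.hi :: c))) ∧
      Arr q (word (refill a C)) (word (refill a (Function.update C k (b ++ q.base.hi :: c)))) := by
    intro a ha
    have := arr_update (q := q) (T := refill a C) (k := k) (b := List.replicate (a k) k.rev ++ b)
      (c := c) (by rw [refill, hcore, List.append_assoc]) (by
        rw [rowWord_append, rowWord_replicate, List.append_assoc]
        exact hA a ha)
    rwa [List.append_assoc, update_refill] at this
  by_cases hb : b = [] ∧ q.base.hi = k.rev
  · rw [if_pos hb] at e₂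
    obtain ⟨rfl, hm⟩ := hb
    rw [hm] at hU
    simp only [List.nil_append] at hcore hU
    have hle : ∀ j : Fin n, q.base.hi ≤ j.rev ↔ j ≤ k := by
      intro j
      rw [hm, Fin.rev_le_rev]
    have hc := hhead hm
    have hlo : q.base.lo ≠ k.rev := by
      rw [← hm, Ne, Fin.ext_iff, I0.lo, I0.hi]
      simp
    -- The core of row `k` has lost a box, so the runs of the rows above it become shorter by one.
    have hL : ∀ j, fillLength (Function.update C k c) j + (if j < k then 1 else 0) =
        fillLength C j := by
      intro j
      have := fillLength_update C k c j
      rw [hcore, List.length_cons] at this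
      split_ifs at this ⊢ <;> omega
    have hpos := fillLength_pos C
    have hrow := fillLength_eq_rowLength C k
    constructor
    · obtain ⟨h₁, h₂⟩ := hU _ (ample_fillLength C)
      rw [← e₁] at h₁ h₂
      refine sdtInfCrystal_f h₁ h₂ (fun hd => ?_) fun _ => ?_
      -- The run of row `k` has grown while the next row is unchanged, so the result cannot be
      -- marginally large.
      · have := hd k
        rw [refill, Function.update_self, ← List.singleton_append, ← List.append_assoc,
          ← List.replicate_succ', takeWhile_replicate_append _ hc, List.length_replicate,
          rowLength_congr (T := refill (fillLength C) C)] at this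
        · omega
        · intro j hj
          rw [refill, Function.update_of_ne hj.ne', refill]
      · rw [e₂]
        funext j
        have hj' := hL j
        rw [pushOut]
        simp only [hle]
        obtain ⟨y, hy⟩ := Nat.exists_eq_add_of_le' (hpos j)
        rcases lt_trichotomy j k with hj | rfl | hj
        · rw [if_pos hj] at hj'
          rw [if_pos hj.le, refill, refill, hy, Function.update_of_ne hj.ne,
            Function.update_of_ne hj.ne, List.replicate_succ, List.cons_append, List.tail_cons]
          congr 2
          omega
        · rw [if_neg (lt_irrefl _)] at hj'
          rw [if_pos le_rfl, refill, refill, Function.update_self, Function.update_self,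
            ← List.singleton_append, ← List.append_assoc, ← List.replicate_succ',
            List.replicate_succ, List.cons_append, List.tail_cons]
          congr 2
          omega
        · rw [if_neg hj.not_gt] at hj'
          rw [if_neg hj.not_ge, refill, refill, Function.update_of_ne hj.ne',
            Function.update_of_ne hj.ne']
          congr 2
          omega
    -- For `e`, the source of the arrow has to be what the change makes of `toInf S'` before pushing
    -- in: its runs in the rows up to `k` are one shorter than those of `toInf S`. These lengths are
    -- still ample.
    · obtain ⟨h₁, h₂⟩ := hU (fun j => if j ≤ k then fillLength C j - 1 else fillLength C j) (by
        intro j j' hj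
        have h₁ := fillLength_eq C hj
        have h₂ := hpos j'
        by_cases h₃ : j' ≤ k
        · have h₄ : j ≤ k := by
            rw [Fin.le_def] at h₃ ⊢
            omega
          simp only [if_pos h₃, if_pos h₄]
          omega
        · simp only [if_neg h₃]
          split_ifs <;> omega)
      have he : refill (fun j => if j ≤ k then fillLength C j - 1 else fillLength C j)
          (Function.update C k (k.rev :: c)) = (toInf S').1 := by
        rw [e₂]
        funext j
        have hj' := hL j
        have := hpos j
        rcases lt_trichotomy j k with hj | rfl | hj
        · rw [if_pos hj] at hj'
          simp only [refill, if_pos hj.le, Function.update_of_ne hj.ne]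
          congr 2
          omega
        · rw [if_neg (lt_irrefl _)] at hj'
          simp only [refill, if_pos le_rfl, Function.update_self]
          rw [← List.singleton_append, ← List.append_assoc, ← List.replicate_succ']
          congr 2
          omega
        · rw [if_neg hj.not_gt] at hj'
          simp only [refill, if_neg hj.not_ge, Function.update_of_ne hj.ne']
          congr 2
          omega
      rw [he] at h₁ h₂
      refine sdtInfCrystal_e h₁ h₂ (fun hd => ?_) fun _ => ?_
      · have := hd k
        rw [refill, takeWhile_replicate_append _ (hC k), List.length_replicate, if_pos le_rfl,
          rowLength_congr (T := refill (fillLength C) C)] at this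
        · omega
        · intro j hj
          rw [refill, if_neg hj.not_ge, refill]
      · rw [e₁]
        funext j
        rw [pushIn]
        simp only [hle, refill]
        have := hpos j
        split_ifs with hj
        · rw [← List.cons_append, ← List.replicate_succ]
          congr 2
          omega
        · rfl
  · rw [if_neg hb] at e₂
    have hL : fillLength (Function.update C k (b ++ q.base.hi :: c)) = fillLength C := by
      funext j
      have := fillLength_update C k (b ++ q.base.hi :: c) j
      rw [hcore] at this
      simp only [List.length_append, List.length_cons] at this
      omega
    rw [hL] at e₂
    obtain ⟨h₁, h₂⟩ := hU _ (ample_fillLength C)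
    rw [← e₁, ← e₂] at h₁ h₂
    exact ⟨sdtInfCrystal_f h₁ h₂ (fun _ => rfl) fun hd => absurd (toInf S').2.2 hd,
      sdtInfCrystal_e h₁ h₂ (fun _ => rfl) fun hd => absurd (toInf S).2.2 hd⟩

/-- The signatures are `M ++ V` with a common `M` and final blocks `V`. For `toInf S` the block has
no unmatched `i`, so `phi` is that of `M`. For `S` the block may be arbitrary, but if `phi` is
positive, the letter changed by `f_i` lies in the core, hence in `M`, and every `i` after it is
matched; so again `V` adds nothing. -/
theorem phi_toInf (i : I0 n) (S : SDT lam) : phi i.1 (word (toInf S).1) = phi i.1 (word S.1) := by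
  have hb : ∀ k, ∀ x ∈ core S.1 k, x ≤ k.rev := fun k x hx => S.2.1.le_rev k x (mem_of_mem_core hx)
  obtain ⟨M, hM⟩ := exists_sig_word i hb
  obtain ⟨a, ha⟩ := exists_refill_core S.1
  have h₁ := hM (fillLength (core S.1))
  have h₂ := hM a
  have h₃ := (ample_fillLength (core S.1)).phi_eq_zero i
  rw [← ha] at h₂
  change sig i.1 (word (toInf S).1) = _ at h₁
  rw [← phi_sig, h₁, ← phi_sig i.1 (word S.1), phi_append, h₃]
  have hphi : ∀ w, phi i.1 w = eps i.1 w - dif i.1 w := fun _ => rfl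
  have e₁ := phi_nonneg i.1 M
  have e₂ := eps_nonneg i.1 M
  have e₃ := hphi M
  rcases (phi_nonneg i.1 (word S.1)).eq_or_lt with h₀ | h₀
  · rw [← phi_sig, h₂, phi_append] at h₀
    rw [h₂, phi_append]
    omega
  · obtain ⟨w, hw⟩ := exists_f_of_phi_pos h₀
    obtain ⟨S', rfl⟩ := exists_sdt_f (q := .num i) hw
    obtain ⟨k, b, c, hhi, hcore, -, hA, -, -⟩ := Arr.exists_core_row (q := .num i) S'.2.1 S.2.1
      (fun j => by rw [S.2.2, S'.2.2]) hw
    obtain ⟨-, hA⟩ := hA a ha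
    obtain ⟨N, hN⟩ := exists_sig_lowWord i hb (k := k) hhi
    have h₄ := hN a
    rw [← ha] at h₄
    have h₅ : S.1 k = List.replicate (a k) k.rev ++ (b ++ i.lo :: c) := by
      conv_lhs => rw [ha]
      rw [refill, hcore]
      rfl
    have h₆ : sig i.1 (word S.1) = sig i.1 (upWord S.1 k ++ rowWord c) ++ (i.1 ::
        (sig i.1 (rowWord b) ++ N)) ++ (List.replicate (a i.hi.rev) (i.1 + 1) ++
          List.replicate (a i.lo.rev + (core S.1 i.lo.rev).count i.lo) i.1) := by
      have : word S.1 = upWord S.1 k ++ rowWord c ++ [i.1] ++ rowWord b ++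
          (List.replicate (a k) k.rev.val ++ lowWord S.1 k) := by
        rw [word_eq S.1 k, h₅]
        simp [rowWord_replicate, I0.lo]
      rw [this, sig_append, h₄]
      simp [sig]
    change phi i.1 _ = 0 at hA
    rw [← phi_sig, sig_append, h₄, ← List.append_assoc, phi_append] at hA
    rw [h₂] at h₆ ⊢
    have h₇ := List.append_cancel_right h₆
    rw [phi_append]
    generalize List.replicate (a i.hi.rev) (i.1 + 1) ++
          List.replicate (a i.lo.rev + (core S.1 i.lo.rev).count i.lo) i.1 = V at *
    generalize sig i.1 (rowWord b) ++ N = U at *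
    generalize sig i.1 (upWord S.1 k ++ rowWord c) = s at *
    have e₄ := phi_append i.1 s (i.1 :: U)
    have e₅ := dif_append i.1 s (i.1 :: U)
    have e₆ := eps_le_eps_cons i.1 i.1 U
    have e₇ := dif_cons i.1 i.1 U
    have e₈ := hphi (i.1 :: U)
    have e₉ := dif_le_eps i.1 U
    rw [if_neg (by omega), if_pos rfl] at e₇
    rw [← h₇] at e₄ e₅
    omega

theorem redLo_toInf (i : I0 n) (S : SDT lam) : redLo i (toInf S).1 = redLo i S.1 := by
  rw [redLo_eq, redLo_eq, phi_toInf]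

theorem redHi_eq_redLo_sub {n : ℕ} (i : I0 n) (T : Tableau n) :
    redHi i T = redLo i T - wtI i (content T) := by
  rw [redHi_eq, redLo_eq, wtI_content, phi]
  ring

/-- This is what the tensor product rule compares: `ε_i` of the left factor minus `φ_i` of the right
one equals `ε_i` of the finite tableau. -/
theorem redHi_toInf (i : I0 n) (S : SDT lam) (k : ℤ) :
    redHi i (toInf S).1 - wtI i (shapeShift (toInf S).1) - wtI i (muWeight lam k) =
      redHi i S.1 := by
  rw [redHi_eq_redLo_sub, redHi_eq_redLo_sub, redLo_toInf]
  have h₁ := content_toInf S k i.lo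
  have h₂ := content_toInf S k i.hi
  simp only [wtI]
  omega

/-! ### Odd operators, and vanishing of operators on embedded tableaux -/

theorem BarArr.not_symm {w w₁ w₂ : List ℕ} (h₁ : BarArr w w₁) (h₂ : BarArr w₂ w) : False := by
  obtain ⟨s, t, rfl, -, hs⟩ := h₁
  obtain ⟨s', t', -, h, hs'⟩ := h₂
  rcases List.append_eq_append_iff.mp h with ⟨m, rfl, h₂⟩ | ⟨m, rfl, h₂⟩
  · cases m with
    | nil => simp at h₂
    | cons y m =>
      rw [List.cons_append, List.cons.injEq] at h₂
      have := hs' y (by simp)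
      omega
  · cases m with
    | nil => simp at h₂
    | cons y m =>
      rw [List.cons_append, List.cons.injEq] at h₂
      have := hs y (by simp)
      omega

theorem exists_barArr {w : List ℕ} (h : ∃ x ∈ w, x < 2) :
    (∃ w', BarArr w w') ∨ ∃ w', BarArr w' w := by
  obtain ⟨s, x, t, rfl, hx, hs⟩ : ∃ s x t, w = s ++ x :: t ∧ x < 2 ∧ ∀ y ∈ s, 2 ≤ y := by
    induction w with
    | nil => simp at h
    | cons y w ih =>
      by_cases hy : y < 2
      · exact ⟨[], y, w, rfl, hy, by simp⟩
      · obtain ⟨x, hx, hx2⟩ := h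
        rcases List.mem_cons.mp hx with rfl | hx
        · exact absurd hx2 hy
        · obtain ⟨s, x, t, rfl, h₁, h₂⟩ := ih ⟨x, hx, hx2⟩
          refine ⟨y :: s, x, t, rfl, h₁, fun z hz => ?_⟩
          rcases List.mem_cons.mp hz with rfl | hz
          · omega
          · exact h₂ z hz
  obtain rfl | rfl : x = 0 ∨ x = 1 := by omega
  · exact Or.inl ⟨_, s, t, rfl, rfl, hs⟩
  · exact Or.inr ⟨_, s, t, rfl, rfl, hs⟩

/-- The last row but one is nonempty since λ is strictly decreasing, and by `IsDecomposition.add_lt`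
its letters are less than 2. -/
theorem exists_bar (hlam : StrictAnti lam) (S : SDT lam) :
    (∃ S' : SDT lam, Arr (.bar : QIndex n) (word S.1) (word S'.1)) ∨
      ∃ S' : SDT lam, Arr (.bar : QIndex n) (word S'.1) (word S.1) := by
  have hn := (Nat.AtLeastTwo.prop : 2 ≤ n)
  have hpos := hlam (show (⟨n - 2, by omega⟩ : Fin n) < ⟨n - 1, by omega⟩ by
    rw [Fin.lt_def]
    simp only
    omega)
  rw [← S.2.2 ⟨n - 2, by omega⟩] at hpos
  obtain ⟨x, hx⟩ := List.exists_mem_of_length_pos (Nat.zero_lt_of_lt hpos)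
  have hlt := S.2.1.add_lt _ x hx
  have hmem : x.val ∈ word S.1 := by
    rw [word_eq_flatMap]
    exact List.mem_flatMap.mpr ⟨_, List.mem_finRange _, mem_rowWord.mpr ⟨x, hx, rfl⟩⟩
  rcases exists_barArr ⟨x.val, hmem, by simp only at hlt; omega⟩ with ⟨w, hw⟩ | ⟨w, hw⟩
  · obtain ⟨S', rfl⟩ := exists_sdt_f (q := .bar) hw
    exact Or.inl ⟨S', hw⟩
  · obtain ⟨S', rfl⟩ := exists_sdt_e (q := .bar) hw
    exact Or.inr ⟨S', hw⟩

theorem exists_arr_of_sdtInfCrystal_f {T T' : SDTInf n} (h : (sdtInfCrystal n).f q T = some T') :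
    ∃ w, Arr q (word T.1) w := by
  obtain ⟨T₁, h₁, -⟩ := Option.bind_eq_some_iff.mp h
  exact ⟨_, (changeF_eq_some_iff.mp h₁).2⟩

theorem exists_arr_of_sdtInfCrystal_e {T T' : SDTInf n} (h : (sdtInfCrystal n).e q T = some T') :
    ∃ w, Arr q w (word T.1) := by
  obtain ⟨T₁, h₁, -⟩ := Option.bind_eq_some_iff.mp h
  exact ⟨_, (changeE_eq_some_iff.mp h₁).2⟩

/-- For `i ∈ I₀` this is the equality of `φ_i`. For `1̄`, if `f` vanishes on `S`, then `e` does not,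
so `e` applies to `toInf S`; the first letter below 2 cannot allow both. -/
theorem sdtInfCrystal_f_eq_none (hlam : StrictAnti lam) {S : SDT lam}
    (h : (sdtCrystal lam).f q S = none) : (sdtInfCrystal n).f q (toInf S) = none := by
  rw [Option.eq_none_iff_forall_ne_some] at h ⊢
  intro T' hT'
  obtain ⟨w, hw⟩ := exists_arr_of_sdtInfCrystal_f hT'
  cases q with
  | num i =>
    have h₁ := (NumArr.phi_eps (i := i.1) hw).1
    have h₂ := phi_nonneg i.1 w
    rw [phi_toInf] at h₁
    obtain ⟨w', hw'⟩ := exists_f_of_phi_pos (i := i.1) (w := word S.1) (by omega)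
    obtain ⟨S', rfl⟩ := exists_sdt_f (q := .num i) hw'
    exact h S' (sdtCrystal_f.mpr hw')
  | bar =>
    rcases exists_bar hlam S with ⟨S', hS'⟩ | ⟨S', hS'⟩
    · exact h S' (sdtCrystal_f.mpr hS')
    · obtain ⟨w', hw'⟩ := exists_arr_of_sdtInfCrystal_e (toInf_arr hS').2
      exact BarArr.not_symm hw hw'

theorem sdtInfCrystal_e_bar_eq_none (hlam : StrictAnti lam) {S : SDT lam}
    (h : (sdtCrystal lam).e .bar S = none) : (sdtInfCrystal n).e .bar (toInf S) = none := by
  rw [Option.eq_none_iff_forall_ne_some] at h ⊢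
  intro T' hT'
  obtain ⟨w, hw⟩ := exists_arr_of_sdtInfCrystal_e hT'
  rcases exists_bar hlam S with ⟨S', hS'⟩ | ⟨S', hS'⟩
  · obtain ⟨w', hw'⟩ := exists_arr_of_sdtInfCrystal_f (toInf_arr hS').1
    exact BarArr.not_symm hw' hw
  · exact h S' (sdtCrystal_e.mpr hS')

/-- The tensor product containing the component of the main theorem. -/
noncomputable abbrev shiftedLimit (lam : Fin n → ℕ) (k : ℤ) : CrystalData n (SDTInf n × Unit) :=
  tensor (sdtInfCrystal n) (dualR (muWeight lam k))

/-- By `redHi_toInf`, `φ_i` of the right factor never exceeds `ε_i` of the left one, so `f_i` always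
acts on the left. -/
theorem shiftedLimit_f (hlam : StrictAnti lam) (k : ℤ) (q : QIndex n) (S : SDT lam) :
    (shiftedLimit lam k).f q (toInf S, ()) =
      ((sdtCrystal lam).f q S).map fun S' => (toInf S', ()) := by
  have hf : (sdtInfCrystal n).f q (toInf S) = ((sdtCrystal lam).f q S).map toInf := by
    cases h : (sdtCrystal lam).f q S with
    | none => exact sdtInfCrystal_f_eq_none hlam h
    | some S' => exact (toInf_arr (sdtCrystal_f.mp h)).1
  cases q with
  | num i =>
    change (if _ then _ else _) = _
    rw [if_pos]
    · rw [hf, Option.map_map]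
      rfl
    · change ((wtI i (muWeight lam k) : ℤ) : WithBot ℤ) ≤
        ((redHi i (toInf S).1 - wtI i (shapeShift (toInf S).1) : ℤ) : WithBot ℤ)
      have h₁ := redHi_toInf i S k
      have h₂ := eps_nonneg i.1 (word S.1)
      rw [← redHi_eq] at h₂
      rw [WithBot.coe_le_coe]
      omega
  | bar =>
    change (if _ then _ else _) = _
    split_ifs with h
    · have h' := hf.symm.trans h.2
      rw [Option.map_eq_none_iff] at h'
      rw [h']
      rfl
    · rw [hf, Option.map_map]
      rfl

/-- The limit may allow `e_i` where `S` does not. Exactly when `ε_i(S) = 0`, the tensor product rule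
directs `e_i` to the right factor, where it vanishes. -/
theorem shiftedLimit_e (hlam : StrictAnti lam) (k : ℤ) (q : QIndex n) (S : SDT lam) :
    (shiftedLimit lam k).e q (toInf S, ()) =
      ((sdtCrystal lam).e q S).map fun S' => (toInf S', ()) := by
  cases q with
  | num i =>
    have hc : (dualR (muWeight lam k)).φ i () < (sdtInfCrystal n).ε i (toInf S) ↔
        0 < eps i.1 (word S.1) := by
      change ((wtI i (muWeight lam k) : ℤ) : WithBot ℤ) <
        ((redHi i (toInf S).1 - wtI i (shapeShift (toInf S).1) : ℤ) : WithBot ℤ) ↔ _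
      have h₁ := redHi_toInf i S k
      rw [← redHi_eq, WithBot.coe_lt_coe]
      omega
    change (if _ then _ else _) = _
    by_cases h : 0 < eps i.1 (word S.1)
    · rw [if_pos (hc.mpr h)]
      obtain ⟨w, hw⟩ := exists_e_of_eps_pos h
      obtain ⟨S', rfl⟩ := exists_sdt_e (q := .num i) hw
      rw [(sdtCrystal_e (q := .num i)).mpr hw, (toInf_arr (q := .num i) hw).2]
      rfl
    · rw [if_neg fun h' => h (hc.mp h')]
      cases hS : (sdtCrystal lam).e (.num i) S with
      | none => rfl
      | some S' =>
        have h₁ := (NumArr.phi_eps (i := i.1) (sdtCrystal_e.mp hS)).2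
        have h₂ := eps_nonneg i.1 (word S'.1)
        omega
  | bar =>
    have he : (sdtInfCrystal n).e .bar (toInf S) = ((sdtCrystal lam).e .bar S).map toInf := by
      cases h : (sdtCrystal lam).e .bar S with
      | none => exact sdtInfCrystal_e_bar_eq_none hlam h
      | some S' => exact (toInf_arr (sdtCrystal_e.mp h)).2
    change (if _ then _ else _) = _
    split_ifs with h
    · have h' := he.symm.trans h.1
      rw [Option.map_eq_none_iff] at h'
      rw [h']
      rfl
    · rw [he, Option.map_map]
      rfl

theorem shiftedLimit_wt (k : ℤ) (S : SDT lam) (j : Fin n) :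
    content S.1 j = (shiftedLimit lam k).wt (toInf S, ()) j + k :=
  content_toInf S k j

theorem shiftedLimit_ε (k : ℤ) (i : I0 n) (S : SDT lam) :
    (sdtCrystal lam).ε i S = (shiftedLimit lam k).ε i (toInf S, ()) := by
  change ((redHi i S.1 : ℤ) : WithBot ℤ) = max ((0 : ℤ) : WithBot ℤ)
    (((redHi i (toInf S).1 - wtI i (shapeShift (toInf S).1) : ℤ) : WithBot ℤ) +
      ((-wtI i (muWeight lam k) : ℤ) : WithBot ℤ))
  have h₁ := redHi_toInf i S k
  have h₂ := eps_nonneg i.1 (word S.1)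
  rw [← redHi_eq] at h₂
  rw [← WithBot.coe_add, ← sub_eq_add_neg, h₁, max_eq_right (WithBot.coe_le_coe.mpr h₂)]

/-- The second entry of the maximum is `φ_i(S) - ε_i(S)`, so the first one wins. -/
theorem shiftedLimit_φ (k : ℤ) (i : I0 n) (S : SDT lam) :
    (sdtCrystal lam).φ i S = (shiftedLimit lam k).φ i (toInf S, ()) := by
  change ((redLo i S.1 : ℤ) : WithBot ℤ) = max ((redLo i (toInf S).1 : ℤ) : WithBot ℤ)
    (((wtI i (muWeight lam k) : ℤ) : WithBot ℤ) +
      ((wtI i (content (toInf S).1 + shapeShift (toInf S).1) : ℤ) : WithBot ℤ))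
  have h₁ := redHi_toInf i S k
  have h₂ := eps_nonneg i.1 (word S.1)
  rw [← redHi_eq] at h₂
  rw [redHi_eq_redLo_sub, redLo_toInf] at h₁
  have h₃ : wtI i (muWeight lam k) + wtI i (content (toInf S).1 + shapeShift (toInf S).1) ≤
      redLo i S.1 := by
    simp only [wtI, Pi.add_apply] at h₁ ⊢
    omega
  rw [redLo_toInf, ← WithBot.coe_add, max_eq_left (WithBot.coe_le_coe.mpr h₃)]

theorem generated_toInf (hlam : StrictAnti lam) (k : ℤ) (S : SDT lam) :
    (shiftedLimit lam k).Generated (lowestInf n, ()) (toInf S, ()) := by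
  have h := generated_lowestSDT hlam S
  rw [← toInf_lowestSDT hlam]
  induction h with
  | refl => exact Relation.ReflTransGen.refl
  | tail _ h ih =>
    refine ih.tail ?_
    obtain ⟨q, h | h⟩ := h
    · exact ⟨q, Or.inl (by rw [shiftedLimit_e hlam, h]; rfl)⟩
    · exact ⟨q, Or.inr (by rw [shiftedLimit_f hlam, h]; rfl)⟩

/-- The operators of the tensor product never leave the image of `toInf`, so the component is no
larger than that image; connectedness of SDT(λ) gives the converse. -/
theorem exists_toInf_of_generated (hlam : StrictAnti lam) (k : ℤ) {b : SDTInf n × Unit}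
    (h : (shiftedLimit lam k).Generated (lowestInf n, ()) b) :
    ∃ S : SDT lam, (toInf S, ()) = b := by
  induction h with
  | refl => exact ⟨lowestSDT lam hlam, by rw [toInf_lowestSDT]⟩
  | tail _ h ih =>
    obtain ⟨S, rfl⟩ := ih
    obtain ⟨q, h | h⟩ := h
    · rw [shiftedLimit_e hlam, Option.map_eq_some_iff] at h
      exact ⟨h.choose, h.choose_spec.2⟩
    · rw [shiftedLimit_f hlam, Option.map_eq_some_iff] at h
      exact ⟨h.choose, h.choose_spec.2⟩

/-- The bijection between the tableaux of a given shape and the component of the limit. -/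
noncomputable def componentEquiv (hlam : StrictAnti lam) (k : ℤ) :
    SDT lam ≃ {b // (shiftedLimit lam k).Generated (lowestInf n, ()) b} :=
  Equiv.ofBijective (fun S => ⟨(toInf S, ()), generated_toInf hlam k S⟩)
    ⟨fun _ _ h => toInf_injective (congrArg (fun b => b.1.1) h), fun b => by
      obtain ⟨S, hS⟩ := exists_toInf_of_generated hlam k b.2
      exact ⟨S, Subtype.ext hS⟩⟩

theorem isShiftedIso_componentEquiv_symm (hlam : StrictAnti lam) (k : ℤ) :
    IsShiftedIso ((shiftedLimit lam k).component (lowestInf n, ())) (sdtCrystal lam) k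
      (componentEquiv hlam k).symm := by
  have pmap_eq : ∀ {α : Type} {P : α → Prop} (o : Option α) (h : ∀ a ∈ o, P a)
      (o' : Option (SDT lam)) (g : SDT lam → Subtype P), o = o'.map (fun S => (g S).1) →
      o.pmap Subtype.mk h = o'.map g := by
    rintro α P _ h o' g rfl
    cases o' <;> rfl
  have map_symm : ∀ o : Option (SDT lam),
      o = (o.map (componentEquiv hlam k)).map (componentEquiv hlam k).symm := by
    rintro (_ | S)
    · rfl
    · exact congrArg some ((componentEquiv hlam k).symm_apply_apply S).symm
  constructor
  · intro b j
    obtain ⟨S, rfl⟩ := (componentEquiv hlam k).surjective b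
    rw [Equiv.symm_apply_apply]
    exact shiftedLimit_wt k S j
  · intro i b
    obtain ⟨S, rfl⟩ := (componentEquiv hlam k).surjective b
    rw [Equiv.symm_apply_apply]
    exact shiftedLimit_ε k i S
  · intro i b
    obtain ⟨S, rfl⟩ := (componentEquiv hlam k).surjective b
    rw [Equiv.symm_apply_apply]
    exact shiftedLimit_φ k i S
  · intro i b
    obtain ⟨S, rfl⟩ := (componentEquiv hlam k).surjective b
    rw [Equiv.symm_apply_apply]
    have := pmap_eq _ (fun _ hc => Relation.ReflTransGen.tail (componentEquiv hlam k S).2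
      ⟨i, Or.inl hc⟩) ((sdtCrystal lam).e i S) (componentEquiv hlam k) (shiftedLimit_e hlam k i S)
    exact (map_symm _).trans (congrArg (Option.map (componentEquiv hlam k).symm) this).symm
  · intro i b
    obtain ⟨S, rfl⟩ := (componentEquiv hlam k).surjective b
    rw [Equiv.symm_apply_apply]
    have := pmap_eq _ (fun _ hc => Relation.ReflTransGen.tail (componentEquiv hlam k S).2
      ⟨i, Or.inr hc⟩) ((sdtCrystal lam).f i S) (componentEquiv hlam k) (shiftedLimit_f hlam k i S)
    exact (map_symm _).trans (congrArg (Option.map (componentEquiv hlam k).symm) this).symm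

end QueerCrystal

theorem mainTheorem2 {n : ℕ} [n.AtLeastTwo] (lam : Fin n → ℕ) (hlam : StrictAnti lam) (k : ℤ) :
    let C := (QueerCrystal.tensor (QueerCrystal.sdtInfCrystal n)
      (QueerCrystal.dualR (QueerCrystal.muWeight lam k))).component
        (QueerCrystal.lowestInf n, ())
    QueerCrystal.IsQCrystal C ∧ QueerCrystal.IsQCrystal (QueerCrystal.sdtCrystal lam) ∧
      ∃ ψ, QueerCrystal.IsShiftedIso C (QueerCrystal.sdtCrystal lam) k ψ := by
  intro C
  have h := QueerCrystal.isShiftedIso_componentEquiv_symm hlam k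
  exact ⟨QueerCrystal.isQCrystal_of_isShiftedIso h (QueerCrystal.isQCrystal_sdtCrystal lam),
    QueerCrystal.isQCrystal_sdtCrystal lam, _, h⟩
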